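/- Let $0<\alpha<1$ and let $k,j\in\{0,1,2,\dots\}\cup\{\infty\}$ with $k\ge j$. Notation. A family $\{E^t\}_{0\le t\le 1}$ of (possibly empty) subsets of $\mathbf C$ is identified with its total space $\mathcal E=\bigcup_t E^t\times\{t\}\subset \mathbf C\times[0,1]$, and a family of functions $f^t$ on $E^t$ with the function $(x,t)\mapsto f^t(x)$ on $\mathcal E$. For a set $\mathcal E$ that is open in $\mathbf C\times[0,1]$, or relatively open in the closure of such a set, $\{f^t\}\in C^{k+\alpha,j}(\mathcal E)$ means that $(x,t)\mapsto f^t(x)$ is continuous on $\mathcal E$ and, for all $i\le j$ and $L$ with $|L|+i\le k$, the partial derivatives $\partial_x^L\partial_t^i f^t(x)$ ($x\in\mathbf R^2=\mathbf C$) exist in the interior of $\mathcal E$ in $\mathbf C\times[0,1]$ and extend to continuous functions on $\mathcal E$ that are $\alpha$-Hölder continuous in $x$, uniformly in $t$, on each compact subset of $\mathcal E$. (For derivatives with respect to $t$ at $t=0,1$ one takes one-sided derivatives.) Let $\{D^t\}_{0\le t\le1}$ be a smooth family of bounded (not necessarily connected) domains in $\mathbf C$ with $C^{k+\alpha,j}\cap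 C^{1+\alpha,j}$ boundary; that is, the total space $\mathcal D$ is bounded and open in $\mathbf C\times[0,1]$, and there are an open neighbourhood $\mathcal U$ of $\overline{\mathcal D}$ in $\mathbf C\times[0,1]$ and a real function $r\in C^{k+\alpha,j}(\mathcal U)\cap C^{1+\alpha,j}(\mathcal U)$ such that $\mathcal D=\{(x,t)\in\mathcal U: r(x,t)<0\}$ and $\nabla_x r\ne0$ at every point of the boundary $\partial\mathcal D$ of $\mathcal D$ in $\mathbf C\times[0,1]$. Let $\{\mathcal D_a: a\in A\}$ be a covering of $\overline{\mathcal D}$ by relatively open subsets of $\overline{\mathcal D}$, where $\mathcal D_a$ is the total space of $\{D_a^t\}$. For all $a,b\in A$ let $\{f_{ab}^t\}\in C^{k+\alpha,j}(\mathcal D_a\cap\mathcal D_b)$ be a family of functions $f_{ab}^t$ that are holomorphic in the interior of $D_a^t\cap D_b^t$. (i) (First Cousin problem.) If, for all $a,b,c\in A$ and all $t$, $f_{ab}^t=-f_{ba}^t$ on $D_a^t\cap D_b^t$ and $f_{ab}^t+f_{bc}^t=f_{ac}^t$ on $D_a^t\cap D_b^t\cap D_c^t$, then there exist families $\{f_a^t\}\in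 C^{k+\alpha,j}(\mathcal D_a)$, $a\in A$, of functions $f_a^t$ holomorphic in the interior of $D_a^t$, such that $f_a^t-f_b^t=f_{ab}^t$ on $D_a^t\cap D_b^t$ for all $a,b\in A$ and all $t$. (ii) (Second Cousin problem.) Suppose that each $f_{ab}^t$ vanishes nowhere on $D_a^t\cap D_b^t$ and that, for all $a,b,c\in A$ and all $t$, $f_{ab}^t=(f_{ba}^t)^{-1}$ on $D_a^t\cap D_b^t$ and $f_{ab}^tf_{bc}^t=f_{ac}^t$ on $D_a^t\cap D_b^t\cap D_c^t$. If there exist families $\{g_a^t\}$, continuous on $\mathcal D_a$, of nowhere vanishing functions with $g_a^t(g_b^t)^{-1}=f_{ab}^t$ on $D_a^t\cap D_b^t$ for all $a,b\in A$ and all $t$, then there exist families $\{f_a^t\}\in C^{k+\alpha,j}(\mathcal D_a)$, $a\in A$, of nowhere vanishing functions $f_a^t$ on $D_a^t$, holomorphic in the interior of $D_a^t$, such that $f_a^t(f_b^t)^{-1}=f_{ab}^t$ on $D_a^t\cap D_b^t$ for all $a,b\in A$ and all $t$. -/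

import Mathlib

open Set Filter Topology

/-! A family `{D^t}`, `0 ≤ t ≤ 1`, of subsets of `ℂ` is identified with its total space
`⋃ₜ D^t × {t}`, a subset of `ℂ × ℝ` contained in the strip `ℂ × [0,1]` (some `D^t` may be empty).
A family of functions `f^t` on `D^t` is identified with the function `(x, t) ↦ f^t(x)` on the total
space; it is given as a function on `ℂ × ℝ` of which only the values on the total space matter. -/

namespace CousinParam

/-- The strip `ℂ × [0,1]`, as a subset of `ℂ × ℝ`. -/
def strip : Set (ℂ × ℝ) := univ ×ˢ Icc (0 : ℝ) 1

/-- `E` is a relatively open subset of `S`. -/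
def IsOpenIn (S E : Set (ℂ × ℝ)) : Prop := ∃ O : Set (ℂ × ℝ), IsOpen O ∧ E = O ∩ S

/-- The member `E^t = {z : (z,t) ∈ E}` of the family with total space `E`. -/
def slice (E : Set (ℂ × ℝ)) (t : ℝ) : Set ℂ := {z | (z, t) ∈ E}

/-- The interior of `E` relative to `ℂ × [0,1]`. -/
def relInterior (E : Set (ℂ × ℝ)) : Set (ℂ × ℝ) := {p | p ∈ strip ∧ E ∈ 𝓝[strip] p}

section HolderSpaces

variable {F : Type*} [NormedAddCommGroup F] [NormedSpace ℝ F]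

/-- The partial derivative `∂_t^i f` on the relatively open set `Ω ⊆ ℂ × [0,1]`
(one-sided at `t = 0` and `t = 1`). -/
noncomputable def dt (Ω : Set (ℂ × ℝ)) (i : ℕ) (f : ℂ × ℝ → F) (p : ℂ × ℝ) : F :=
  iteratedDerivWithin i (fun s : ℝ => f (p.1, s)) {s : ℝ | (p.1, s) ∈ Ω} p.2

/-- All the partial derivatives `∂_x^L ∂_t^i f` with `|L| = l`, collected into the `l`-th real
derivative in the variable `x ∈ ℂ = ℝ²` of `∂_t^i f`. -/
noncomputable def dxdt (Ω : Set (ℂ × ℝ)) (l i : ℕ) (f : ℂ × ℝ → F) (p : ℂ × ℝ) :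
    ContinuousMultilinearMap ℝ (fun _ : Fin l => ℂ) F :=
  iteratedFDeriv ℝ l (fun x : ℂ => dt Ω i f (x, p.2)) p.1

/-- `G` is `α`-Hölder in the variable `x`, uniformly in `t`, on every compact subset of `E`. -/
def LocallyHolderInX {G' : Type*} [NormedAddCommGroup G'] (E : Set (ℂ × ℝ)) (α : ℝ)
    (G : ℂ × ℝ → G') : Prop :=
  ∀ K : Set (ℂ × ℝ), K ⊆ E → IsCompact K →
    ∃ C : ℝ, ∀ (t : ℝ) (x y : ℂ), (x, t) ∈ K → (y, t) ∈ K →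
      ‖G (x, t) - G (y, t)‖ ≤ C * ‖x - y‖ ^ α

/-- The space `C^{k+α,j}(E)`, where `E` is a relatively open subset of `ℂ × [0,1]`, or a relatively
open subset of the closure of such a set (so that `E` may contain some of its boundary).
The function `f` is continuous on `E`, and for `i ≤ j` and `l + i ≤ k` the partial derivatives
`∂_x^L ∂_t^i f`, `|L| = l`, exist in the interior of `E` and extend to continuous functions on `E`
that are `α`-Hölder in `x` (uniformly in `t`) on the compact subsets of `E`. -/
def IsOfClass (E : Set (ℂ × ℝ)) (k j : ℕ∞) (α : ℝ) (f : ℂ × ℝ → F) : Prop :=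
  ContinuousOn f E ∧
  ∀ l i : ℕ, (i : ℕ∞) ≤ j → (l : ℕ∞) + (i : ℕ∞) ≤ k →
    (∀ x : ℂ, ContDiffOn ℝ i (fun s : ℝ => f (x, s)) {s : ℝ | (x, s) ∈ relInterior E}) ∧
    (∀ t : ℝ, ContDiffOn ℝ l (fun x : ℂ => dt (relInterior E) i f (x, t))
      (slice (relInterior E) t)) ∧
    ∃ G : ℂ × ℝ → ContinuousMultilinearMap ℝ (fun _ : Fin l => ℂ) F,
      EqOn G (dxdt (relInterior E) l i f) (relInterior E) ∧
      ContinuousOn G E ∧ LocallyHolderInX E α G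

end HolderSpaces

/-- `D` is the total space of a smooth family of bounded (not necessarily connected) domains in `ℂ`
with `C^{k+α,j} ∩ C^{1+α,j}` boundary: `D` is bounded and relatively open in `ℂ × [0,1]`, and it is
defined by `r < 0`, where `r` is a real function of class `C^{k+α,j} ∩ C^{1+α,j}` on a relatively
open neighbourhood `U` of the closure of `D` with `∇_x r ≠ 0` on the boundary of `D` in
`ℂ × [0,1]`. -/
def IsSmoothFamily (D : Set (ℂ × ℝ)) (k j : ℕ∞) (α : ℝ) : Prop :=
  Bornology.IsBounded D ∧ IsOpenIn strip D ∧
  ∃ (U : Set (ℂ × ℝ)) (r : ℂ × ℝ → ℝ),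
    IsOpenIn strip U ∧ closure D ⊆ U ∧
    IsOfClass U k j α r ∧ IsOfClass U 1 j α r ∧
    D = {p | p ∈ U ∧ r p < 0} ∧
    ∀ p ∈ closure D \ D, fderiv ℝ (fun x : ℂ => r (x, p.2)) p.1 ≠ 0

/-- For each `t`, the function `f^t` is holomorphic in the interior of `E^t`. -/
def HolomorphicInside (E : Set (ℂ × ℝ)) (f : ℂ × ℝ → ℂ) : Prop :=
  ∀ t : ℝ, DifferentiableOn ℂ (fun z : ℂ => f (z, t)) (interior (slice E t))

end CousinParam

set_option linter.unusedSectionVars false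

/-! Both problems reduce to solving ∂̄u = g with no loss of regularity in x up to the boundary or in
the parameter t.

First problem: with a smooth partition of unity χ_i subordinate to the covering, the sums Σ χ_i
f_{ai} already have the differences f_{ab}. Since ∂̄ only hits χ_i, the functions Σ (∂̄χ_i) f_{ai}
are again of class C^{k+α,j}, and by the cocycle relation they agree on overlaps, so they define one
function g on the closure of D. Subtracting a solution of ∂̄u = g makes the sums holomorphic
(`SmoothFamily.exists_additive`). The solution is explicit: extend g to a function on the whole
strip that vanishes for large |x| (`SmoothFamily.exists_extension`), then convolve it in x with a
multiple of 1/x. Derivatives in x and t fall on g and not on the kernel, so the class is kept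
(`classOn_cauchyConv`). The equation itself follows from the Cauchy–Pompeiu formula
(`hasDbarAt_integral`); it needs g to be C¹ in x only near the point considered, which holds inside
D even for k = 0, because there g is built from holomorphic functions.

The extension is of Seeley type. Choose a direction v transversal to the boundary {r = 0}. Outside D
the extension is Σ c_m ψ(λ_m r) h(x - λ_m r v, t), where Σ c_m = 1 and all moments Σ c_m λ_m^n, n ≥
1, vanish. Differentiating a term brings out factors λ_m, so the derivatives of the extension are
combinations of sums of the same kind, with coefficients c_m λ_m, multiplied by derivatives of r; on
the boundary the vanishing moments leave exactly the derivatives of h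
(`ReflectionBox.classOn_reflExt_off`). That nothing goes wrong on {r = 0} itself is
`ClassOn.of_crossing`. All inductions run over the recursive class `ClassOn`, shown to match
C^{k+α,j} by `IsOfClass.classOn` and `isOfClass_of_classOn`.

Second problem: on a finer covering V_p the continuous solutions have continuous logarithms l_p. The
differences l_p - l_{p'} are logarithms of the given f, hence holomorphic and of the right class,
and form an additive cocycle. If u_p solves the first problem for it, exp(u_p - l_p) is a global
continuous function w, and g_b w = f_{b a(p)} exp(u_p) is of the right class. -/

namespace CousinParam

/-! ### Functions that are continuous and locally Hölder in x -/

section Holder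

variable {F G H : Type*} [NormedAddCommGroup F] [NormedSpace ℝ F]
  [NormedAddCommGroup G] [NormedSpace ℝ G] [NormedAddCommGroup H] [NormedSpace ℝ H]
  {α : ℝ} {E E' : Set (ℂ × ℝ)} {f g : ℂ × ℝ → F}

/-- Continuity on `E` together with local Hölder continuity in `x`. -/
def HolderOn (α : ℝ) (E : Set (ℂ × ℝ)) (f : ℂ × ℝ → F) : Prop :=
  ContinuousOn f E ∧ LocallyHolderInX E α f

theorem HolderOn.mono (hf : HolderOn α E f) (h : E' ⊆ E) : HolderOn α E' f :=
  ⟨hf.1.mono h, fun K hK hKc => hf.2 K (hK.trans h) hKc⟩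

theorem HolderOn.congr (hf : HolderOn α E f) (h : EqOn g f E) : HolderOn α E g := by
  refine ⟨hf.1.congr h, fun K hK hKc => ?_⟩
  obtain ⟨C, hC⟩ := hf.2 K hK hKc
  refine ⟨C, fun t x y hx hy => ?_⟩
  rw [h (hK hx), h (hK hy)]
  exact hC t x y hx hy

theorem HolderOn.exists_bound (hf : HolderOn α E f) {K : Set (ℂ × ℝ)} (hK : K ⊆ E)
    (hKc : IsCompact K) : ∃ C M : ℝ, 0 ≤ C ∧ 0 ≤ M ∧ (∀ p ∈ K, ‖f p‖ ≤ M) ∧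
      ∀ (t : ℝ) (x y : ℂ), (x, t) ∈ K → (y, t) ∈ K → ‖f (x, t) - f (y, t)‖ ≤ C * ‖x - y‖ ^ α := by
  obtain ⟨C, hC⟩ := hf.2 K hK hKc
  obtain ⟨M, hM⟩ := hKc.exists_bound_of_continuousOn (hf.1.mono hK)
  refine ⟨max C 0, max M 0, le_max_right _ _, le_max_right _ _,
    fun p hp => (hM p hp).trans (le_max_left _ _), fun t x y hx hy => (hC t x y hx hy).trans ?_⟩
  gcongr
  exact le_max_left _ _

/-- Close pairs are covered by the local estimate; for pairs at distance bounded below, the supremum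
bound on the compact set suffices. Compactness leaves finitely many neighbourhoods. -/
theorem locallyHolderInX_of_local (hα : 0 ≤ α) (hf : ContinuousOn f E)
    (h : ∀ K ⊆ E, IsCompact K → ∀ p ∈ K, ∃ O ∈ 𝓝 p, ∃ C : ℝ, ∀ (t : ℝ) (x y : ℂ),
      (x, t) ∈ K ∩ O → (y, t) ∈ K ∩ O → ‖f (x, t) - f (y, t)‖ ≤ C * ‖x - y‖ ^ α) :
    LocallyHolderInX E α f := by
  intro K hK hKc
  obtain ⟨M, hM⟩ := hKc.exists_bound_of_continuousOn (hf.mono hK)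
  -- Only the first point is localized below, the second ranging over all of K; in this asymmetric
  -- form the property passes to finite unions.
  suffices H : ∃ C : ℝ, ∀ (t : ℝ) (x y : ℂ), (x, t) ∈ K → (x, t) ∈ K → (y, t) ∈ K →
      ‖f (x, t) - f (y, t)‖ ≤ C * ‖x - y‖ ^ α by
    obtain ⟨C, hC⟩ := H
    exact ⟨C, fun t x y hx hy => hC t x y hx hx hy⟩
  refine hKc.induction_on (p := fun S => ∃ C : ℝ, ∀ (t : ℝ) (x y : ℂ), (x, t) ∈ S → (x, t) ∈ K →
    (y, t) ∈ K → ‖f (x, t) - f (y, t)‖ ≤ C * ‖x - y‖ ^ α) ?_ ?_ ?_ ?_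
  · exact ⟨0, fun t x y hx => hx.elim⟩
  · rintro s t hst ⟨C, hC⟩
    exact ⟨C, fun t x y hx => hC t x y (hst hx)⟩
  · rintro s t ⟨C, hC⟩ ⟨C', hC'⟩
    refine ⟨max C C', fun t x y hx hxK hy => ?_⟩
    have h0 : 0 ≤ ‖x - y‖ ^ α := by positivity
    rcases hx with hx | hx
    · exact (hC t x y hx hxK hy).trans (by gcongr; exact le_max_left _ _)
    · exact (hC' t x y hx hxK hy).trans (by gcongr; exact le_max_right _ _)
  · intro p hp
    obtain ⟨O, hO, C, hC⟩ := h K hK hKc p hp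
    obtain ⟨ε, hε, hεO⟩ := Metric.mem_nhds_iff.1 hO
    refine ⟨Metric.ball p (ε / 2), mem_nhdsWithin_of_mem_nhds (Metric.ball_mem_nhds _ (by positivity)),
      max C (2 * M / (ε / 2) ^ α), fun t x y hx hxK hy => ?_⟩
    have hM0 : 0 ≤ M := (norm_nonneg _).trans (hM _ hp)
    by_cases hy' : (y, t) ∈ Metric.ball p ε
    · refine (hC t x y ⟨hxK, hεO (Metric.ball_subset_ball (by linarith) hx)⟩ ⟨hy, hεO hy'⟩).trans ?_
      gcongr
      exact le_max_left _ _
    · have hd : ε / 2 ≤ ‖x - y‖ := by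
        have h1 : dist (y, t) p ≤ dist (y, t) (x, t) + dist (x, t) p := dist_triangle _ _ _
        have h2 : dist (y, t) (x, t) = ‖x - y‖ := by
          rw [dist_comm, Prod.dist_eq]; simp [dist_eq_norm]
        rw [Metric.mem_ball] at hx hy'
        linarith
      have h3 : ‖f (x, t) - f (y, t)‖ ≤ 2 * M := by
        have := norm_sub_le (f (x, t)) (f (y, t))
        linarith [hM _ hxK, hM _ hy]
      have h4 : (ε / 2) ^ α ≤ ‖x - y‖ ^ α := Real.rpow_le_rpow (by positivity) hd hα
      have h5 : 0 < (ε / 2) ^ α := by positivity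
      calc _ ≤ 2 * M := h3
        _ = (2 * M / (ε / 2) ^ α) * (ε / 2) ^ α := by field_simp
        _ ≤ max C (2 * M / (ε / 2) ^ α) * ‖x - y‖ ^ α := by
          gcongr
          exact le_max_right _ _

theorem HolderOn.of_local (hα : 0 ≤ α)
    (h : ∀ p ∈ E, ∃ O, IsOpen O ∧ p ∈ O ∧ HolderOn α (E ∩ O) f) : HolderOn α E f := by
  have hc : ContinuousOn f E := by
    intro p hp
    obtain ⟨O, hO, hpO, hf⟩ := h p hp
    have := hf.1 p ⟨hp, hpO⟩
    rwa [continuousWithinAt_inter (hO.mem_nhds hpO)] at this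
  refine ⟨hc, locallyHolderInX_of_local hα hc fun K hK hKc p hp => ?_⟩
  obtain ⟨O, hO, hpO, hf⟩ := h p (hK hp)
  obtain ⟨ε, hε, hεO⟩ := Metric.nhds_basis_closedBall.mem_iff.1 (hO.mem_nhds hpO)
  obtain ⟨C, hC⟩ := hf.2 (K ∩ Metric.closedBall p ε) (inter_subset_inter hK hεO)
    (hKc.inter_right Metric.isClosed_closedBall)
  exact ⟨_, Metric.closedBall_mem_nhds _ hε, C, fun t x y hx hy => hC t x y hx hy⟩

theorem HolderOn.const (c : F) : HolderOn α E (fun _ => c) :=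
  ⟨continuousOn_const, fun _ _ _ => ⟨0, fun _ _ _ _ _ => by simp⟩⟩

theorem HolderOn.add (hf : HolderOn α E f) (hg : HolderOn α E g) :
    HolderOn α E (fun p => f p + g p) := by
  refine ⟨hf.1.add hg.1, fun K hK hKc => ?_⟩
  obtain ⟨C, hC⟩ := hf.2 K hK hKc
  obtain ⟨C', hC'⟩ := hg.2 K hK hKc
  refine ⟨C + C', fun t x y hx hy => ?_⟩
  rw [add_sub_add_comm, add_mul]
  exact (norm_add_le _ _).trans (add_le_add (hC t x y hx hy) (hC' t x y hx hy))

theorem HolderOn.bilin (B : F →L[ℝ] G →L[ℝ] H) (hf : HolderOn α E f) {g : ℂ × ℝ → G}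
    (hg : HolderOn α E g) : HolderOn α E (fun p => B (f p) (g p)) := by
  refine ⟨(B.continuous.comp_continuousOn hf.1).clm_apply hg.1, fun K hK hKc => ?_⟩
  obtain ⟨C, M, hC0, hM0, hM, hC⟩ := hf.exists_bound hK hKc
  obtain ⟨C', M', hC0', hM0', hM', hC'⟩ := hg.exists_bound hK hKc
  refine ⟨‖B‖ * C * M' + ‖B‖ * M * C', fun t x y hx hy => ?_⟩
  have e : B (f (x, t)) (g (x, t)) - B (f (y, t)) (g (y, t)) =
      B (f (x, t) - f (y, t)) (g (x, t)) + B (f (y, t)) (g (x, t) - g (y, t)) := by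
    simp
  rw [e]
  refine (norm_add_le _ _).trans ?_
  have h1 := B.le_opNorm₂ (f (x, t) - f (y, t)) (g (x, t))
  have h2 := B.le_opNorm₂ (f (y, t)) (g (x, t) - g (y, t))
  have h3 : ‖B‖ * ‖f (x, t) - f (y, t)‖ * ‖g (x, t)‖ ≤ ‖B‖ * (C * ‖x - y‖ ^ α) * M' := by
    gcongr
    · exact hC t x y hx hy
    · exact hM' _ hx
  have h4 : ‖B‖ * ‖f (y, t)‖ * ‖g (x, t) - g (y, t)‖ ≤ ‖B‖ * M * (C' * ‖x - y‖ ^ α) := by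
    gcongr
    · exact hM _ hy
    · exact hC' t x y hx hy
  linarith

theorem HolderOn.clm (B : F →L[ℝ] G) (hf : HolderOn α E f) : HolderOn α E (fun p => B (f p)) := by
  refine ⟨B.continuous.comp_continuousOn hf.1, fun K hK hKc => ?_⟩
  obtain ⟨C, M, hC0, hM0, hM, hC⟩ := hf.exists_bound hK hKc
  refine ⟨‖B‖ * C, fun t x y hx hy => ?_⟩
  rw [← map_sub, mul_assoc]
  exact (B.le_opNorm _).trans (by gcongr; exact hC t x y hx hy)

/-- A function that is locally Lipschitz on a neighbourhood of every point is Hölder. -/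
theorem HolderOn.of_locallyLipschitz (hα1 : α ≤ 1) (hα : 0 ≤ α) (hc : ContinuousOn f E)
    (h : ∀ p ∈ E, ∃ O ∈ 𝓝 p, ∃ C : ℝ, ∀ (t : ℝ) (x y : ℂ), (x, t) ∈ E ∩ O → (y, t) ∈ E ∩ O →
      ‖f (x, t) - f (y, t)‖ ≤ C * ‖x - y‖) : HolderOn α E f := by
  refine ⟨hc, locallyHolderInX_of_local hα hc fun K hK hKc p hp => ?_⟩
  obtain ⟨O, hO, C, hC⟩ := h p (hK hp)
  refine ⟨O ∩ Metric.ball p (1 / 2), inter_mem hO (Metric.ball_mem_nhds _ (by norm_num)), max C 0,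
    fun t x y hx hy => ?_⟩
  have h1 := hC t x y ⟨hK hx.1, hx.2.1⟩ ⟨hK hy.1, hy.2.1⟩
  have h2 : ‖x - y‖ ≤ 1 := by
    have h1 : dist (x, t) (y, t) ≤ dist (x, t) p + dist (y, t) p := dist_triangle_right _ _ _
    have h2 : dist (x, t) (y, t) = ‖x - y‖ := by
      rw [Prod.dist_eq]; simp [dist_eq_norm]
    have := hx.2.2
    have := hy.2.2
    rw [Metric.mem_ball] at *
    linarith
  have h3 : ‖x - y‖ ≤ ‖x - y‖ ^ α := by
    rcases (norm_nonneg (x - y)).eq_or_lt with h0 | h0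
    · rw [← h0]; positivity
    · exact Real.self_le_rpow_of_le_one h0.le h2 hα1
  calc _ ≤ C * ‖x - y‖ := h1
    _ ≤ max C 0 * ‖x - y‖ := by gcongr; exact le_max_left _ _
    _ ≤ max C 0 * ‖x - y‖ ^ α := by gcongr

theorem HolderOn.of_contDiff (hα1 : α ≤ 1) (hα : 0 ≤ α) (hf : ContDiff ℝ 1 f) :
    HolderOn α E f := by
  refine .of_locallyLipschitz hα1 hα hf.continuous.continuousOn fun p _ => ?_
  obtain ⟨K, O, hO, hL⟩ := hf.contDiffAt.exists_lipschitzOnWith (x := p)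
  refine ⟨O, hO, K, fun t x y hx hy => ?_⟩
  have := hL.dist_le_mul _ hx.2 _ hy.2
  rw [Prod.dist_eq] at this
  simpa [dist_eq_norm] using this

/-- A holomorphic map is C¹ and therefore locally Lipschitz, so it preserves local Hölder estimates.
-/
theorem HolderOn.comp_differentiableOn {f : ℂ × ℝ → ℂ} (hα : 0 ≤ α) (hf : HolderOn α E f)
    {V : Set ℂ} (hV : IsOpen V) {Φ : ℂ → ℂ} (hΦ : DifferentiableOn ℂ Φ V) (hfV : MapsTo f E V) :
    HolderOn α E (fun p => Φ (f p)) := by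
  have hc : ContinuousOn (fun p => Φ (f p)) E := hΦ.continuousOn.comp hf.1 hfV
  refine ⟨hc, locallyHolderInX_of_local hα hc fun K hK hKc p hp => ?_⟩
  have h1 : ContDiffAt ℂ 1 Φ (f p) :=
    (hΦ.analyticAt (hV.mem_nhds (hfV (hK hp)))).contDiffAt
  obtain ⟨L, S, hS, hL⟩ := h1.exists_lipschitzOnWith
  have h2 : f ⁻¹' S ∈ 𝓝[E] p := (hf.1 p (hK hp)) hS
  obtain ⟨O, hO, hOS⟩ := mem_nhdsWithin_iff_exists_mem_nhds_inter.1 h2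
  obtain ⟨C, M, hC0, hM0, hM, hC⟩ := hf.exists_bound hK hKc
  refine ⟨O, hO, L * C, fun t x y hx hy => ?_⟩
  have h3 := hL.dist_le_mul _ (hOS ⟨hx.2, hK hx.1⟩) _ (hOS ⟨hy.2, hK hy.1⟩)
  rw [dist_eq_norm, dist_eq_norm] at h3
  rw [mul_assoc]
  exact h3.trans (by gcongr; exact hC t x y hx.1 hy.1)

end Holder

/-! ### A recursive version of the classes C^{k+α,j} -/

section ClassOn

variable {F G H : Type*} [NormedAddCommGroup F] [NormedSpace ℝ F]
  [NormedAddCommGroup G] [NormedSpace ℝ G] [NormedAddCommGroup H] [NormedSpace ℝ H]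
  {α : ℝ} {Ω Ω' E E' : Set (ℂ × ℝ)} {f g : ℂ × ℝ → F} {n j : ℕ}

/-- The functions on `E` all of whose partial derivatives, of order at most `n` and of order at
most `j` in `t`, exist on `Ω` and have extensions to `E` in `HolderOn α E`. -/
def ClassOn (α : ℝ) (Ω E : Set (ℂ × ℝ)) : ℕ → ℕ → (ℂ × ℝ → F) → Prop
  | 0, _, f => HolderOn α E f
  | n + 1, j, f => HolderOn α E f ∧
      (∃ A : ℂ × ℝ → ℂ →L[ℝ] F, (∀ e, ClassOn α Ω E n j (fun p => A p e)) ∧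
        ∀ p ∈ Ω, HasFDerivAt (fun x => f (x, p.2)) (A p) p.1) ∧
      ∀ j', j = j' + 1 → ∃ f' : ℂ × ℝ → F, ClassOn α Ω E n j' f' ∧
        ∀ p ∈ Ω, HasDerivWithinAt (fun s => f (p.1, s)) (f' p) (Icc 0 1) p.2

theorem ClassOn.holderOn (hf : ClassOn α Ω E n j f) : HolderOn α E f := by
  cases n with
  | zero => exact hf
  | succ n => exact hf.1

theorem ClassOn.mono (hf : ClassOn α Ω E n j f) (hΩ : Ω' ⊆ Ω) (hE : E' ⊆ E) :
    ClassOn α Ω' E' n j f := by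
  induction n generalizing f j with
  | zero => exact HolderOn.mono hf hE
  | succ n ih =>
    obtain ⟨h0, ⟨A, hA, hA'⟩, ht⟩ := hf
    refine ⟨h0.mono hE, ⟨A, fun e => ih (hA e), fun p hp => hA' p (hΩ hp)⟩, fun j' hj => ?_⟩
    obtain ⟨f', hf', hf''⟩ := ht j' hj
    exact ⟨f', ih hf', fun p hp => hf'' p (hΩ hp)⟩

theorem ClassOn.of_succ_left (hf : ClassOn α Ω E (n + 1) j f) : ClassOn α Ω E n j f := by
  induction n generalizing f j with
  | zero => exact hf.holderOn
  | succ n ih =>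
    obtain ⟨h0, ⟨A, hA, hA'⟩, ht⟩ := hf
    refine ⟨h0, ⟨A, fun e => ih (hA e), hA'⟩, fun j' hj => ?_⟩
    obtain ⟨f', hf', hf''⟩ := ht j' hj
    exact ⟨f', ih hf', hf''⟩

theorem ClassOn.of_succ_right (hf : ClassOn α Ω E n (j + 1) f) : ClassOn α Ω E n j f := by
  induction n generalizing f j with
  | zero => exact hf
  | succ n ih =>
    obtain ⟨h0, ⟨A, hA, hA'⟩, ht⟩ := hf
    refine ⟨h0, ⟨A, fun e => ih (hA e), hA'⟩, fun j' hj => ?_⟩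
    subst hj
    obtain ⟨f', hf', hf''⟩ := ht _ rfl
    exact ⟨f', ih hf', hf''⟩

theorem IsOpenIn.eventually_x (h : IsOpenIn strip Ω) {p : ℂ × ℝ} (hp : p ∈ Ω) :
    ∀ᶠ x in 𝓝 p.1, (x, p.2) ∈ Ω := by
  obtain ⟨O, hO, rfl⟩ := h
  have h1 : ∀ᶠ x in 𝓝 p.1, (x, p.2) ∈ O :=
    (by fun_prop : Continuous fun x : ℂ => (x, p.2)).continuousAt.eventually (hO.mem_nhds hp.1)
  filter_upwards [h1] with x hx
  exact ⟨hx, ⟨mem_univ _, hp.2.2⟩⟩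

theorem IsOpenIn.eventually_t (h : IsOpenIn strip Ω) {p : ℂ × ℝ} (hp : p ∈ Ω) :
    ∀ᶠ s in 𝓝[Icc 0 1] p.2, (p.1, s) ∈ Ω := by
  obtain ⟨O, hO, rfl⟩ := h
  have h1 : ∀ᶠ s in 𝓝 p.2, (p.1, s) ∈ O :=
    (by fun_prop : Continuous fun s : ℝ => (p.1, s)).continuousAt.eventually (hO.mem_nhds hp.1)
  filter_upwards [mem_nhdsWithin_of_mem_nhds h1, self_mem_nhdsWithin] with s hs hs'
  exact ⟨hs, ⟨mem_univ _, hs'⟩⟩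

theorem IsOpenIn.inter_isOpen {S : Set (ℂ × ℝ)} (h : IsOpenIn S Ω) {O : Set (ℂ × ℝ)}
    (hO : IsOpen O) : IsOpenIn S (Ω ∩ O) := by
  obtain ⟨O', hO', rfl⟩ := h
  exact ⟨O' ∩ O, hO'.inter hO, by rw [inter_right_comm]⟩

theorem IsOpenIn.subset {S : Set (ℂ × ℝ)} (h : IsOpenIn S Ω) : Ω ⊆ S := by
  obtain ⟨O', hO', rfl⟩ := h
  exact inter_subset_right

theorem IsOpenIn.mem_Icc (h : IsOpenIn strip Ω) {p : ℂ × ℝ} (hp : p ∈ Ω) : p.2 ∈ Icc (0 : ℝ) 1 :=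
  (h.subset hp).2

theorem ClassOn.congr (hΩ : IsOpenIn strip Ω) (hΩE : Ω ⊆ E) (hf : ClassOn α Ω E n j f)
    (h : EqOn g f E) : ClassOn α Ω E n j g := by
  cases n with
  | zero => exact HolderOn.congr hf h
  | succ n =>
    obtain ⟨h0, ⟨A, hA, hA'⟩, ht⟩ := hf
    refine ⟨h0.congr h, ⟨A, hA, fun p hp => (hA' p hp).congr_of_eventuallyEq ?_⟩, fun j' hj => ?_⟩
    · filter_upwards [hΩ.eventually_x hp] with x hx using h (hΩE hx)
    · obtain ⟨f', hf', hf''⟩ := ht j' hj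
      refine ⟨f', hf', fun p hp => (hf'' p hp).congr_of_eventuallyEq ?_ (h (hΩE hp))⟩
      filter_upwards [hΩ.eventually_t hp] with x hx using h (hΩE hx)

theorem ClassOn.const (c : F) : ClassOn α Ω E n j (fun _ => c) := by
  induction n generalizing c j with
  | zero => exact HolderOn.const c
  | succ n ih =>
    exact ⟨HolderOn.const c, ⟨0, fun e => by simpa using ih 0, fun p _ => hasFDerivAt_const _ _⟩,
      fun j' _ => ⟨0, ih 0, fun p _ => hasDerivWithinAt_const _ _ _⟩⟩

theorem ClassOn.add (hf : ClassOn α Ω E n j f) (hg : ClassOn α Ω E n j g) :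
    ClassOn α Ω E n j (fun p => f p + g p) := by
  induction n generalizing f g j with
  | zero => exact HolderOn.add hf hg
  | succ n ih =>
    obtain ⟨h0, ⟨A, hA, hA'⟩, ht⟩ := hf
    obtain ⟨h1, ⟨B, hB, hB'⟩, ht'⟩ := hg
    refine ⟨h0.add h1, ⟨fun p => A p + B p, fun e => ih (hA e) (hB e),
      fun p hp => (hA' p hp).add (hB' p hp)⟩, fun j' hj => ?_⟩
    obtain ⟨f', hf', hf''⟩ := ht j' hj
    obtain ⟨g', hg', hg''⟩ := ht' j' hj
    exact ⟨_, ih hf' hg', fun p hp => (hf'' p hp).add (hg'' p hp)⟩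

theorem ClassOn.clm (B : F →L[ℝ] G) (hf : ClassOn α Ω E n j f) :
    ClassOn α Ω E n j (fun p => B (f p)) := by
  induction n generalizing f j with
  | zero => exact HolderOn.clm B hf
  | succ n ih =>
    obtain ⟨h0, ⟨A, hA, hA'⟩, ht⟩ := hf
    refine ⟨h0.clm B, ⟨fun p => B.comp (A p), fun e => ih (hA e),
      fun p hp => B.hasFDerivAt.comp p.1 (hA' p hp)⟩, fun j' hj => ?_⟩
    obtain ⟨f', hf', hf''⟩ := ht j' hj
    exact ⟨_, ih hf', fun p hp => B.hasFDerivAt.comp_hasDerivWithinAt p.2 (hf'' p hp)⟩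

theorem ClassOn.bilin (B : F →L[ℝ] G →L[ℝ] H) (hf : ClassOn α Ω E n j f) {g : ℂ × ℝ → G}
    (hg : ClassOn α Ω E n j g) : ClassOn α Ω E n j (fun p => B (f p) (g p)) := by
  induction n generalizing f g j with
  | zero => exact HolderOn.bilin B hf hg
  | succ n ih =>
    -- In the Leibniz rule the undifferentiated factor is needed only with one order less.
    have hf0 := hf.of_succ_left
    have hg0 := hg.of_succ_left
    obtain ⟨h0, ⟨A, hA, hA'⟩, ht⟩ := hf
    obtain ⟨h1, ⟨A₁, hA₁, hA₁'⟩, ht'⟩ := hg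
    refine ⟨h0.bilin B h1, ⟨fun p => B.precompR ℂ (f p) (A₁ p) + B.precompL ℂ (A p) (g p),
      fun e => (ih hf0 (hA₁ e)).add (ih (hA e) hg0),
      fun p hp => B.hasFDerivAt_of_bilinear (hA' p hp) (hA₁' p hp)⟩, fun j' hj => ?_⟩
    obtain ⟨f', hf', hf''⟩ := ht j' hj
    obtain ⟨g', hg', hg''⟩ := ht' j' hj
    subst hj
    exact ⟨_, (ih hf0.of_succ_right hg').add (ih hf' hg0.of_succ_right),
      fun p hp => B.hasDerivWithinAt_of_bilinear (hf'' p hp) (hg'' p hp)⟩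

theorem ClassOn.sub (hf : ClassOn α Ω E n j f) (hg : ClassOn α Ω E n j g) :
    ClassOn α Ω E n j (fun p => f p - g p) := by
  simpa [sub_eq_add_neg] using hf.add (hg.clm (-ContinuousLinearMap.id ℝ F))

theorem ClassOn.sum {ι : Type*} (s : Finset ι) {f : ι → ℂ × ℝ → F}
    (hf : ∀ i ∈ s, ClassOn α Ω E n j (f i)) : ClassOn α Ω E n j (fun p => ∑ i ∈ s, f i p) := by
  classical
  induction s using Finset.induction_on with
  | empty => simpa using ClassOn.const 0
  | insert a s ha ih =>
    simp only [Finset.sum_insert ha]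
    exact (hf a (Finset.mem_insert_self _ _)).add
      (ih fun i hi => hf i (Finset.mem_insert_of_mem hi))

theorem ClassOn.mul {f g : ℂ × ℝ → ℂ} (hf : ClassOn α Ω E n j f) (hg : ClassOn α Ω E n j g) :
    ClassOn α Ω E n j (fun p => f p * g p) :=
  hf.bilin (ContinuousLinearMap.mul ℝ ℂ) hg

theorem ClassOn.smul {f : ℂ × ℝ → ℝ} (hf : ClassOn α Ω E n j f) (hg : ClassOn α Ω E n j g) :
    ClassOn α Ω E n j (fun p => f p • g p) :=
  hf.bilin (ContinuousLinearMap.lsmul ℝ ℝ) hg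

open scoped ContDiff in
theorem ClassOn.of_contDiff (hα1 : α ≤ 1) (hα : 0 ≤ α) (hf : ContDiff ℝ ∞ f) :
    ClassOn α Ω E n j f := by
  induction n generalizing f j with
  | zero => exact HolderOn.of_contDiff hα1 hα (hf.of_le (by norm_cast))
  | succ n ih =>
    have hd : ContDiff ℝ ∞ (fderiv ℝ f) := hf.fderiv_right (by norm_cast)
    have hD : ∀ p, HasFDerivAt f (fderiv ℝ f p) p := fun p =>
      (hf.differentiable (by norm_num)).differentiableAt.hasFDerivAt
    refine ⟨HolderOn.of_contDiff hα1 hα (hf.of_le (by norm_cast)),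
      ⟨fun p => (fderiv ℝ f p).comp (ContinuousLinearMap.inl ℝ ℂ ℝ), fun e => ih ?_,
        fun p _ => ?_⟩, fun j' _ => ⟨fun p => fderiv ℝ f p (0, 1), ih ?_, fun p _ => ?_⟩⟩
    · exact hd.clm_apply contDiff_const
    · exact (hD p).comp p.1 (hasFDerivAt_prodMk_left p.1 p.2)
    · exact hd.clm_apply contDiff_const
    · have := (hD p).comp_hasDerivAt p.2 ((hasDerivAt_const p.2 p.1).prodMk (hasDerivAt_id p.2))
      exact this.hasDerivWithinAt

theorem ClassOn.comp_differentiableOn {f : ℂ × ℝ → ℂ} (hα : 0 ≤ α) (hf : ClassOn α Ω E n j f)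
    (hΩE : Ω ⊆ E) {V : Set ℂ} (hV : IsOpen V) {Φ : ℂ → ℂ} (hΦ : DifferentiableOn ℂ Φ V)
    (hfV : MapsTo f E V) : ClassOn α Ω E n j (fun p => Φ (f p)) := by
  induction n generalizing f j Φ with
  | zero => exact HolderOn.comp_differentiableOn hα hf hV hΦ hfV
  | succ n ih =>
    have hf0 := hf.of_succ_left
    have hd : ∀ p ∈ Ω, HasDerivAt Φ (deriv Φ (f p)) (f p) := fun p hp =>
      (hΦ.differentiableAt (hV.mem_nhds (hfV (hΩE hp)))).hasDerivAt
    have hΦ' := hΦ.deriv hV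
    have h1 := hf.holderOn
    obtain ⟨h0, ⟨A, hA, hA'⟩, ht⟩ := hf
    refine ⟨h1.comp_differentiableOn hα hV hΦ hfV, ⟨fun p => deriv Φ (f p) • A p,
      fun e => (ih hf0 hΦ' hfV).mul (hA e), fun p hp => ?_⟩, fun j' hj => ?_⟩
    · exact (hd p hp).comp_hasFDerivAt p.1 (hA' p hp)
    · obtain ⟨f', hf', hf''⟩ := ht j' hj
      subst hj
      exact ⟨_, (ih hf0.of_succ_right hΦ' hfV).mul hf', fun p hp =>
        (hd p hp).comp_hasDerivWithinAt p.2 (hf'' p hp)⟩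

/-- By density, the extension of a derivative from Ω to E is unique; this lets locally chosen
extensions be compared at boundary points. -/
theorem eq_of_eqOn_of_mem_closure {S T : Set (ℂ × ℝ)} {f g : ℂ × ℝ → F} {p : ℂ × ℝ}
    (hf : ContinuousWithinAt f T p) (hg : ContinuousWithinAt g T p) (hST : S ⊆ T)
    (hp : p ∈ closure S) (h : EqOn f g S) : f p = g p := by
  have : (𝓝[S] p).NeBot := mem_closure_iff_nhdsWithin_neBot.1 hp
  refine tendsto_nhds_unique (hf.mono hST) ((hg.mono hST).congr' ?_)
  filter_upwards [self_mem_nhdsWithin] with q hq using (h hq).symm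

/-- The local derivatives agree on Ω by uniqueness of derivatives, and on the rest of E by density
of Ω, so they glue. -/
theorem ClassOn.of_local (hα : 0 ≤ α) (hΩ : IsOpenIn strip Ω) (hΩE : Ω ⊆ E) (hEΩ : E ⊆ closure Ω)
    (h : ∀ p ∈ E, ∃ O, IsOpen O ∧ p ∈ O ∧ ClassOn α (Ω ∩ O) (E ∩ O) n j f) :
    ClassOn α Ω E n j f := by
  induction n generalizing f j with
  | zero => exact HolderOn.of_local hα h
  | succ n ih =>
    have h0 : HolderOn α E f := by
      refine HolderOn.of_local hα fun p hp => ?_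
      obtain ⟨O, hO, hpO, hf⟩ := h p hp
      exact ⟨O, hO, hpO, hf.1⟩
    choose! O hO hpO hf using h
    have hcl : ∀ p q, p ∈ E → q ∈ E → q ∈ O p → q ∈ closure (Ω ∩ (O p ∩ O q)) := by
      intro p q hp hq hqp
      exact ((hO p hp).inter (hO q hq)).closure_inter ⟨hEΩ hq, hqp, hpO q hq⟩
    refine ⟨h0, ?_, fun j' hj => ?_⟩
    · have hA : ∀ p ∈ E, ∃ A : ℂ × ℝ → ℂ →L[ℝ] F,
          (∀ e, ClassOn α (Ω ∩ O p) (E ∩ O p) n j (fun q => A q e)) ∧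
          ∀ q ∈ Ω ∩ O p, HasFDerivAt (fun x => f (x, q.2)) (A q) q.1 := fun p hp => (hf p hp).2.1
      choose! A hA hA' using hA
      have key : ∀ p ∈ E, ∀ q ∈ E ∩ O p, ∀ e, A q q e = A p q e := by
        intro p hp q hq e
        refine eq_of_eqOn_of_mem_closure (T := E ∩ (O p ∩ O q))
          (((hA q hq.1 e).holderOn.1.mono ?_) q ⟨hq.1, hq.2, hpO q hq.1⟩)
          (((hA p hp e).holderOn.1.mono ?_) q ⟨hq.1, hq.2, hpO q hq.1⟩)
          (inter_subset_inter_left _ hΩE) (hcl p q hp hq.1 hq.2) ?_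
        · exact inter_subset_inter_right _ inter_subset_right
        · exact inter_subset_inter_right _ inter_subset_left
        · rintro s ⟨hs, hs1, hs2⟩
          have := (hA' q hq.1 s ⟨hs, hs2⟩).unique (hA' p hp s ⟨hs, hs1⟩)
          simp [this]
      -- The glued derivative uses, at q, the neighbourhood chosen for q itself; `key` identifies it
      -- with any other choice.
      refine ⟨fun q => A q q, fun e => ih fun p hp => ⟨O p, hO p hp, hpO p hp, ?_⟩,
        fun p hp => hA' p (hΩE hp) p ⟨hp, hpO p (hΩE hp)⟩⟩
      exact (hA p hp e).congr (hΩ.inter_isOpen (hO p hp)) (inter_subset_inter_left _ hΩE)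
        fun q hq => key p hp q hq e
    · have hA : ∀ p ∈ E, ∃ f' : ℂ × ℝ → F,
          (ClassOn α (Ω ∩ O p) (E ∩ O p) n j' f') ∧
          ∀ q ∈ Ω ∩ O p, HasDerivWithinAt (fun s => f (q.1, s)) (f' q) (Icc 0 1) q.2 :=
        fun p hp => (hf p hp).2.2 j' hj
      choose! A hA hA' using hA
      have key : ∀ p ∈ E, ∀ q ∈ E ∩ O p, A q q = A p q := by
        intro p hp q hq
        refine eq_of_eqOn_of_mem_closure (T := E ∩ (O p ∩ O q))
          (((hA q hq.1).holderOn.1.mono ?_) q ⟨hq.1, hq.2, hpO q hq.1⟩)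
          (((hA p hp).holderOn.1.mono ?_) q ⟨hq.1, hq.2, hpO q hq.1⟩)
          (inter_subset_inter_left _ hΩE) (hcl p q hp hq.1 hq.2) ?_
        · exact inter_subset_inter_right _ inter_subset_right
        · exact inter_subset_inter_right _ inter_subset_left
        · rintro s ⟨hs, hs1, hs2⟩
          exact (uniqueDiffOn_Icc zero_lt_one s.2 (hΩ.mem_Icc hs)).eq_deriv _
            (hA' q hq.1 s ⟨hs, hs2⟩) (hA' p hp s ⟨hs, hs1⟩)
      refine ⟨fun q => A q q, ih fun p hp => ⟨O p, hO p hp, hpO p hp, ?_⟩,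
        fun p hp => hA' p (hΩE hp) p ⟨hp, hpO p (hΩE hp)⟩⟩
      exact (hA p hp).congr (hΩ.inter_isOpen (hO p hp)) (inter_subset_inter_left _ hΩE)
        fun q hq => key p hp q hq

/-- Multiplication by a smooth function with support in the open set `O` extends a function from
`E ∩ O` to `E`. -/
theorem ClassOn.smul_of_tsupport_subset (hα : 0 ≤ α) (hΩ : IsOpenIn strip Ω)
    (hΩE : Ω ⊆ E) (hEΩ : E ⊆ closure Ω) {O : Set (ℂ × ℝ)} (hO : IsOpen O) {χ : ℂ × ℝ → ℂ}
    (hχ : ClassOn α Ω E n j χ) (hχO : tsupport χ ⊆ O) {f : ℂ × ℝ → ℂ}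
    (hf : ClassOn α (Ω ∩ O) (E ∩ O) n j f) : ClassOn α Ω E n j (fun p => χ p * f p) := by
  refine .of_local hα hΩ hΩE hEΩ fun p hp => ?_
  by_cases h : p ∈ tsupport χ
  · exact ⟨O, hO, hχO h, (hχ.mono inter_subset_left inter_subset_left).mul hf⟩
  · refine ⟨(tsupport χ)ᶜ, (isClosed_tsupport χ).isOpen_compl, h, ?_⟩
    refine (ClassOn.const 0).congr (hΩ.inter_isOpen (isClosed_tsupport χ).isOpen_compl)
      (inter_subset_inter_left _ hΩE) fun q hq => ?_
    simp [image_eq_zero_of_notMem_tsupport hq.2]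

/-- The real linear map on `ℂ` with prescribed values at `1` and `I`. -/
noncomputable def lin (a b : F) : ℂ →L[ℝ] F :=
  Complex.reCLM.smulRight a + Complex.imCLM.smulRight b

theorem lin_apply (a b : F) (e : ℂ) : lin a b e = e.re • a + e.im • b := by
  simp [lin]

theorem eq_lin (A : ℂ →L[ℝ] F) : A = lin (A 1) (A Complex.I) := by
  ext x
  rw [lin_apply, ← map_smul, ← map_smul, ← map_add]
  simp

theorem ClassOn.lin_apply (hf : ClassOn α Ω E n j f) (hg : ClassOn α Ω E n j g) (e : ℂ) :
    ClassOn α Ω E n j (fun p => lin (f p) (g p) e) := by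
  simp only [CousinParam.lin_apply]
  exact (hf.clm (e.re • ContinuousLinearMap.id ℝ F)).add
    (hg.clm (e.im • ContinuousLinearMap.id ℝ F))

end ClassOn

/-! ### Relatively open sets and equality of mixed derivatives -/

section Bridge

variable {F : Type*} [NormedAddCommGroup F] [NormedSpace ℝ F]
  {α : ℝ} {Ω E : Set (ℂ × ℝ)} {f g : ℂ × ℝ → F} {n j : ℕ}

theorem relInterior_eq_self_of_isOpenIn (hΩ : IsOpenIn strip Ω) : relInterior Ω = Ω := by
  obtain ⟨O, hO, rfl⟩ := hΩ
  ext p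
  constructor
  · rintro ⟨hp, h⟩
    exact mem_of_mem_nhdsWithin hp h
  · rintro ⟨hp, h⟩
    exact ⟨h, inter_mem (mem_nhdsWithin_of_mem_nhds (hO.mem_nhds hp)) self_mem_nhdsWithin⟩

theorem isOpenIn_relInterior (E : Set (ℂ × ℝ)) : IsOpenIn strip (relInterior E) := by
  refine ⟨interior (E ∪ stripᶜ), isOpen_interior, ?_⟩
  ext p
  have : E ∈ 𝓝[strip] p ↔ p ∈ interior (E ∪ stripᶜ) := by
    rw [mem_interior_iff_mem_nhds, mem_nhdsWithin_iff_eventually, Filter.Eventually]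
    congr! 1
    ext q
    simp only [mem_ofPred_eq, mem_union, mem_compl_iff]
    tauto
  simp only [relInterior, mem_ofPred_eq, this, mem_inter_iff]
  tauto

theorem relInterior_subset (E : Set (ℂ × ℝ)) : relInterior E ⊆ E :=
  fun _ hp => mem_of_mem_nhdsWithin hp.1 hp.2

/-- Differentiation in t along a slice of Ω is thereby the same as differentiation within [0,1],
one-sided at the endpoints. -/
theorem IsOpenIn.nhdsWithin_eq (hΩ : IsOpenIn strip Ω) {p : ℂ × ℝ} (hp : p ∈ Ω) :
    𝓝[{s | (p.1, s) ∈ Ω}] p.2 = 𝓝[Icc 0 1] p.2 := by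
  refine le_antisymm (nhdsWithin_mono _ fun s hs => hΩ.mem_Icc hs) ?_
  exact nhdsWithin_le_iff.2 (hΩ.eventually_t hp)

theorem IsOpenIn.hasDerivWithinAt_iff (hΩ : IsOpenIn strip Ω) {p : ℂ × ℝ} (hp : p ∈ Ω)
    {φ : ℝ → F} {c : F} : HasDerivWithinAt φ c {s | (p.1, s) ∈ Ω} p.2 ↔
      HasDerivWithinAt φ c (Icc 0 1) p.2 := by
  rw [HasDerivWithinAt, HasDerivAtFilter, hΩ.nhdsWithin_eq hp]; rfl

theorem IsOpenIn.uniqueDiffOn (hΩ : IsOpenIn strip Ω) (x : ℂ) :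
    UniqueDiffOn ℝ {s | (x, s) ∈ Ω} := by
  intro s hs
  have := (uniqueDiffOn_Icc (zero_lt_one' ℝ)) s (hΩ.mem_Icc hs)
  have h := hΩ.nhdsWithin_eq hs
  dsimp only at h
  exact this.mono_nhds h.symm.le

theorem IsOpenIn.isOpen_slice (hΩ : IsOpenIn strip Ω) (t : ℝ) : IsOpen (slice Ω t) := by
  rw [isOpen_iff_mem_nhds]
  intro x hx
  exact hΩ.eventually_x (p := (x, t)) hx

/-- Equality of mixed derivatives. -/
theorem hasDerivWithinAt_of_commute (hΩ : IsOpenIn strip Ω) {u v u' v' : ℂ × ℝ → F} {e : ℂ}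
    (huv : ∀ p ∈ Ω, HasDerivWithinAt (fun s => u (p.1, s)) (v p) (Icc 0 1) p.2)
    (hu : ∀ p ∈ Ω, HasDerivAt (fun s : ℝ => u (p.1 + s • e, p.2)) (u' p) 0)
    (hv : ∀ p ∈ Ω, HasDerivAt (fun s : ℝ => v (p.1 + s • e, p.2)) (v' p) 0)
    (hv' : ContinuousOn v' Ω) {p : ℂ × ℝ} (hp : p ∈ Ω) :
    HasDerivWithinAt (fun s => u' (p.1, s)) (v' p) (Icc 0 1) p.2 := by
  obtain ⟨x, t⟩ := p
  rw [hasDerivWithinAt_iff_isLittleO, Asymptotics.isLittleO_iff]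
  intro ε hε
  obtain ⟨O, hO, hOΩ⟩ := hΩ
  have hpO : (x, t) ∈ O := by rw [hOΩ] at hp; exact hp.1
  have h1 : ∀ᶠ q in 𝓝[Ω] (x, t), ‖v' q - v' (x, t)‖ < ε := by
    have := (hv' _ hp)
    have := this.sub_const (v' (x, t))
    have := this.norm
    exact this.eventually (gt_mem_nhds (by simpa using hε))
  obtain ⟨δ, hδ, hδ'⟩ := Metric.mem_nhdsWithin_iff.1 h1
  obtain ⟨δ₁, hδ₁, hδ₁'⟩ := Metric.isOpen_iff.1 hO _ hpO
  obtain ⟨ρ, hρ, hρ1, hρ2⟩ : ∃ ρ > 0, ρ ≤ δ ∧ ρ ≤ δ₁ :=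
    ⟨min δ δ₁, lt_min hδ hδ₁, min_le_left _ _, min_le_right _ _⟩
  have hbox : ∀ (y : ℂ) (s : ℝ), dist y x < ρ → dist s t < ρ → s ∈ Icc (0 : ℝ) 1 →
      (y, s) ∈ Ω ∧ ‖v' (y, s) - v' (x, t)‖ ≤ ε := by
    intro y s hy hs hs'
    have hd : dist (y, s) (x, t) < ρ := by rw [Prod.dist_eq]; exact max_lt hy hs
    have h2 : (y, s) ∈ Ω := by
      rw [hOΩ]
      exact ⟨hδ₁' (hd.trans_le hρ2), mem_univ _, hs'⟩
    exact ⟨h2, (hδ' ⟨hd.trans_le hρ1, h2⟩).le⟩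
  have ht : t ∈ Icc (0 : ℝ) 1 := by rw [hOΩ] at hp; exact hp.2.2
  filter_upwards [mem_nhdsWithin_of_mem_nhds (Metric.ball_mem_nhds t hρ), self_mem_nhdsWithin]
    with s hs hsI
  have hsub : uIcc t s ⊆ Icc (0 : ℝ) 1 := ordConnected_Icc.uIcc_subset ht hsI
  have hsubρ : ∀ τ ∈ uIcc t s, dist τ t < ρ := by
    intro τ hτ
    have := abs_sub_left_of_mem_uIcc hτ
    rw [Real.dist_eq]
    exact this.trans_lt (by simpa [Real.dist_eq, abs_sub_comm] using hs)
  -- the second difference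
  have hsmall : ∀ᶠ σ in 𝓝 (0 : ℝ), ∀ σ' ∈ uIcc 0 σ, dist (x + σ' • e) x < ρ := by
    have hc : Continuous fun σ : ℝ => |σ| * ‖e‖ := by fun_prop
    have := hc.continuousAt.eventually
      (gt_mem_nhds (show |(0 : ℝ)| * ‖e‖ < ρ by simpa using hρ))
    filter_upwards [this] with σ hσ σ' hσ'
    rw [dist_eq_norm, add_sub_cancel_left, norm_smul, Real.norm_eq_abs]
    refine lt_of_le_of_lt ?_ hσ
    have := abs_sub_left_of_mem_uIcc hσ'
    rw [sub_zero, sub_zero] at this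
    exact mul_le_mul_of_nonneg_right this (norm_nonneg _)
  -- Two applications of the mean value inequality, first in direction e and then in t, bound the
  -- second difference with a constant independent of σ; only the limit σ → 0 remains to be taken.
  have key : ∀ᶠ σ in 𝓝[≠] (0 : ℝ), ‖σ⁻¹ • (u (x + σ • e, s) - u (x, s)) -
      σ⁻¹ • (u (x + σ • e, t) - u (x, t)) - (s - t) • v' (x, t)‖ ≤ ε * ‖s - t‖ := by
    filter_upwards [mem_nhdsWithin_of_mem_nhds hsmall, self_mem_nhdsWithin] with σ hσ hσ0
    have hσ0' : σ ≠ 0 := hσ0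
    -- derivative in `t` of the first difference
    have hφ : ∀ τ ∈ uIcc t s, ‖v (x + σ • e, τ) - v (x, τ) - σ • v' (x, t)‖ ≤ ε * |σ| := by
      intro τ hτ
      have hd : ∀ σ' ∈ uIcc 0 σ, HasDerivWithinAt
          (fun σ : ℝ => v (x + σ • e, τ) - σ • v' (x, t))
          (v' (x + σ' • e, τ) - v' (x, t)) (uIcc 0 σ) σ' := by
        intro σ' hσ'
        have h3 := hv _ (hbox _ τ (hσ σ' hσ') (hsubρ τ hτ) (hsub hτ)).1
        have h4 : HasDerivAt (fun σ : ℝ => v (x + σ • e, τ)) (v' (x + σ' • e, τ)) σ' := by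
          have := HasDerivAt.comp_sub_const σ' σ' (f := fun s : ℝ => v (x + σ' • e + s • e, τ))
            (f' := v' (x + σ' • e, τ)) (by simpa using h3)
          refine this.congr_of_eventuallyEq (Eventually.of_forall fun σ => ?_)
          simp only
          congr 2
          rw [add_assoc, ← add_smul]; congr 2; ring
        have h5 := (hasDerivAt_id σ').smul_const (v' (x, t))
        simpa using (h4.fun_sub h5).hasDerivWithinAt (s := uIcc 0 σ)
      have := (convex_uIcc 0 σ).norm_image_sub_le_of_norm_hasDerivWithin_le hd
        (fun σ' hσ' => (hbox _ τ (hσ σ' hσ') (hsubρ τ hτ) (hsub hτ)).2) left_mem_uIcc right_mem_uIcc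
      simp only [zero_smul, add_zero, sub_zero] at this
      rwa [sub_right_comm] at this
    have hx0 : dist x x < ρ := by simpa
    have hσx := hσ σ right_mem_uIcc
    have hd : ∀ τ ∈ uIcc t s, HasDerivWithinAt
        (fun τ : ℝ => u (x + σ • e, τ) - u (x, τ) - τ • (σ • v' (x, t)))
        (v (x + σ • e, τ) - v (x, τ) - σ • v' (x, t)) (uIcc t s) τ := by
      intro τ hτ
      have h3 := (huv _ (hbox _ τ hσx (hsubρ τ hτ) (hsub hτ)).1).mono hsub
      have h4 := (huv _ (hbox _ τ hx0 (hsubρ τ hτ) (hsub hτ)).1).mono hsub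
      have h5 := ((hasDerivAt_id τ).smul_const (σ • v' (x, t))).hasDerivWithinAt (s := uIcc t s)
      simpa using (h3.fun_sub h4).fun_sub h5
    have := (convex_uIcc t s).norm_image_sub_le_of_norm_hasDerivWithin_le hd hφ
      left_mem_uIcc right_mem_uIcc
    have h6 : σ⁻¹ • (u (x + σ • e, s) - u (x, s)) - σ⁻¹ • (u (x + σ • e, t) - u (x, t)) -
        (s - t) • v' (x, t) = σ⁻¹ • ((u (x + σ • e, s) - u (x, s) - s • (σ • v' (x, t))) -
          (u (x + σ • e, t) - u (x, t) - t • (σ • v' (x, t)))) := by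
      have : ∀ w : F, ∀ a : ℝ, σ⁻¹ • (a • (σ • w)) = a • w := by
        intro w a
        rw [smul_comm a, smul_smul, inv_mul_cancel₀ hσ0', one_smul]
      simp only [smul_sub, this, sub_smul]
      abel
    rw [h6, norm_smul, norm_inv, Real.norm_eq_abs]
    calc |σ|⁻¹ * _ ≤ |σ|⁻¹ * (ε * |σ| * ‖s - t‖) := by gcongr
      _ = ε * ‖s - t‖ := by
        have : |σ| ≠ 0 := abs_ne_zero.2 hσ0'
        field_simp
  have hslope : ∀ τ, (x, τ) ∈ Ω → Tendsto (fun σ : ℝ => σ⁻¹ • (u (x + σ • e, τ) - u (x, τ)))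
      (𝓝[≠] 0) (𝓝 (u' (x, τ))) := by
    intro τ hτ
    have := (hu _ hτ).tendsto_slope_zero
    simpa using this
  have hxs := (hbox x s (by simpa) (hsubρ s right_mem_uIcc) hsI).1
  exact le_of_tendsto (((hslope s hxs).sub (hslope t hp)).sub_const _).norm key

end Bridge

/-! ### Comparison of the recursive classes with C^{k+α,j} -/

section Bridge

variable {F : Type*} [NormedAddCommGroup F] [NormedSpace ℝ F]
  {α : ℝ} {Ω E : Set (ℂ × ℝ)} {f g : ℂ × ℝ → F} {n j : ℕ}

theorem HolderOn.isometry {G : Type*} [NormedAddCommGroup G] (hf : HolderOn α E f) {S : F → G}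
    (hS : Isometry S) : HolderOn α E (fun p => S (f p)) := by
  refine ⟨hS.continuous.comp_continuousOn hf.1, fun K hK hKc => ?_⟩
  obtain ⟨C, hC⟩ := hf.2 K hK hKc
  refine ⟨C, fun t x y hx hy => ?_⟩
  rw [← dist_eq_norm, hS.dist_eq, dist_eq_norm]
  exact hC t x y hx hy

theorem hasDerivAt_line {φ : ℂ → F} {L : ℂ →L[ℝ] F} {x : ℂ} (h : HasFDerivAt φ L x) (e : ℂ) :
    HasDerivAt (fun s : ℝ => φ (x + s • e)) (L e) 0 := by
  have h1 : HasDerivAt (fun s : ℝ => x + s • e) e 0 := by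
    simpa using ((hasDerivAt_id (0 : ℝ)).smul_const e).const_add x
  have h2 : HasFDerivAt φ L (x + (0 : ℝ) • e) := by simpa using h
  exact h2.comp_hasDerivAt (0 : ℝ) h1

/-- The definition of C^{k+α,j} only provides ∂_x^L ∂_t^i f, with the t-derivatives taken first,
whereas `ClassOn` also asks for t-derivatives of x-derivatives. Interchanging the order by
`hasDerivWithinAt_of_commute` shows that the extensions G l i are derivatives of one another in both
variables. -/
theorem IsOfClass.classOn {k j : ℕ∞} (hE : E ⊆ closure (relInterior E))
    (hf : IsOfClass E k j α f) {n j' : ℕ} (hn : (n : ℕ∞) ≤ k)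
    (hj : (j' : ℕ∞) ≤ j) : ClassOn α (relInterior E) E n j' f := by
  obtain ⟨hc, hf⟩ := hf
  have hΩ := isOpenIn_relInterior E
  have hcond : ∀ l i : ℕ, i ≤ j' → l + i ≤ n → (i : ℕ∞) ≤ j ∧ (l : ℕ∞) + (i : ℕ∞) ≤ k :=
    fun l i hi hl => ⟨le_trans (by exact_mod_cast hi) hj, le_trans (by exact_mod_cast hl) hn⟩
  have hf' := fun l i hi hl => hf l i (hcond l i hi hl).1 (hcond l i hi hl).2
  set Ω := relInterior E with hΩdef
  have hΩE : Ω ⊆ E := relInterior_subset E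
  have hG := fun l i hi hl => (hf' l i hi hl).2.2
  choose! G hGeq hGc hGh using hG
  have hx : ∀ l i, i ≤ j' → l + 1 + i ≤ n → ∀ (m : Fin l → ℂ), ∀ p ∈ Ω,
      HasFDerivAt (fun x => G l i (x, p.2) m) (lin (G (l + 1) i p (Fin.cons 1 m))
        (G (l + 1) i p (Fin.cons Complex.I m))) p.1 := by
    intro l i hi hl m p hp
    have h1 : ContDiffAt ℝ ((l + 1 : ℕ) : ℕ∞) (fun x : ℂ => dt Ω i f (x, p.2)) p.1 :=
      ((hf' (l + 1) i hi hl).2.1 p.2).contDiffAt ((hΩ.isOpen_slice p.2).mem_nhds hp)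
    have h2 := h1.differentiableAt_iteratedFDeriv (m := l) (by norm_cast; omega)
    have h3 := (h2.continuousMultilinear_apply_const m).hasFDerivAt
    rw [eq_lin (fderiv ℝ _ p.1)] at h3
    have h4 : ∀ e, fderiv ℝ (fun y => iteratedFDeriv ℝ l (fun x : ℂ => dt Ω i f (x, p.2)) y m) p.1 e
        = G (l + 1) i p (Fin.cons e m) := by
      intro e
      rw [hGeq (l + 1) i hi hl hp, dxdt, h2.iteratedFDeriv_succ_apply_left']
      simp
    rw [h4, h4] at h3
    refine h3.congr_of_eventuallyEq ?_
    filter_upwards [hΩ.eventually_x hp] with x hx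
    rw [hGeq l i hi (by omega) hx, dxdt]
  -- Induction on the number of x-derivatives: for l = 0 this is the recursion for iterated
  -- t-derivatives, and each further x-derivative is passed through by commutation.
  have ht : ∀ i, i + 1 ≤ j' → ∀ l, l + (i + 1) ≤ n → ∀ (m : Fin l → ℂ), ∀ p ∈ Ω,
      HasDerivWithinAt (fun s => G l i (p.1, s) m) (G l (i + 1) p m) (Icc 0 1) p.2 := by
    intro i hi l
    induction l with
    | zero =>
      intro hl m p hp
      have h0 : ∀ i', i' ≤ j' → 0 + i' ≤ n → ∀ q ∈ Ω, G 0 i' q m =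
          iteratedDerivWithin i' (fun s : ℝ => f (q.1, s)) {s : ℝ | (q.1, s) ∈ Ω} q.2 := by
        intro i' hi' hl' q hq
        rw [hGeq 0 i' hi' hl' hq, dxdt, iteratedFDeriv_zero_apply, dt]
      have h1 := (hf' 0 (i + 1) hi hl).1 p.1
      have h2 := h1.differentiableOn_iteratedDerivWithin (m := i) (by norm_cast; omega)
        (hΩ.uniqueDiffOn p.1) p.2 hp
      have h3 := h2.hasDerivWithinAt
      rw [← iteratedDerivWithin_succ, ← h0 (i + 1) hi hl p hp, hΩ.hasDerivWithinAt_iff hp] at h3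
      refine h3.congr_of_eventuallyEq ?_ (h0 i (by omega) (by omega) p hp)
      filter_upwards [hΩ.eventually_t hp] with s hs using h0 i (by omega) (by omega) (p.1, s) hs
    | succ l ih =>
      intro hl m p hp
      have hcons : ∀ i' q, i' ≤ j' → l + 1 + i' ≤ n → q ∈ Ω →
          HasDerivAt (fun s : ℝ => G l i' (q.1 + s • m 0, q.2) (Fin.tail m)) (G (l + 1) i' q m) 0 := by
        intro i' q hi' hl' hq
        have h1 := hx l i' hi' (by omega) (Fin.tail m) q hq
        have h2 := hasDerivAt_line h1 (m 0)
        have h3 : lin (G (l + 1) i' q (Fin.cons 1 (Fin.tail m)))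
            (G (l + 1) i' q (Fin.cons Complex.I (Fin.tail m))) (m 0) = G (l + 1) i' q m := by
          rw [lin_apply, ← ContinuousMultilinearMap.cons_smul, ← ContinuousMultilinearMap.cons_smul,
            ← ContinuousMultilinearMap.cons_add]
          simp
        rwa [h3] at h2
      exact hasDerivWithinAt_of_commute hΩ (u := fun q => G l i q (Fin.tail m))
        (v := fun q => G l (i + 1) q (Fin.tail m)) (u' := fun q => G (l + 1) i q m)
        (v' := fun q => G (l + 1) (i + 1) q m) (ih (by omega) (Fin.tail m))
        (fun q hq => hcons i q (by omega) (by omega) hq)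
        (fun q hq => hcons (i + 1) q (by omega) (by omega) hq)
        (((continuous_eval_const m).comp_continuousOn (hGc (l + 1) (i + 1) hi hl)).mono hΩE) hp
  have main : ∀ N J l i (m : Fin l → ℂ), i + J ≤ j' → l + i + N ≤ n →
      ClassOn α Ω E N J (fun p => G l i p m) := by
    intro N
    induction N with
    | zero =>
      intro J l i m hi hl
      exact (show HolderOn α E (G l i) from ⟨hGc l i (by omega) (by omega),
        hGh l i (by omega) (by omega)⟩).clm (ContinuousMultilinearMap.apply ℝ (fun _ : Fin l => ℂ) F m)
    | succ N ih =>
      intro J l i m hi hl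
      refine ⟨(show HolderOn α E (G l i) from ⟨hGc l i (by omega) (by omega),
        hGh l i (by omega) (by omega)⟩).clm (ContinuousMultilinearMap.apply ℝ (fun _ : Fin l => ℂ) F m),
        ⟨_, fun e => ?_, hx l i (by omega) (by omega) m⟩, fun J' hJ => ⟨_, ?_,
          ht i (by omega) l (by omega) m⟩⟩
      · exact (ih J (l + 1) i _ hi (by omega)).lin_apply (ih J (l + 1) i _ hi (by omega)) e
      · exact ih J' l (i + 1) m (by omega) (by omega)
  have h00 := main n j' 0 0 Fin.elim0 (by omega) (by omega)
  -- `G 0 0` is known to be f only on the relative interior; continuity of both gives equality on E.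
  refine h00.congr hΩ hΩE fun p hp => ?_
  refine eq_of_eqOn_of_mem_closure (hc p hp) (h00.holderOn.1 p hp) hΩE (hE hp) fun q hq => ?_
  simp [hGeq 0 0 (by omega) (by omega) hq, dxdt, dt]

/-- All t-derivatives are peeled off first, as in the definition of C^{k+α,j}; each one costs one
unit of total order and one of order in t. -/
theorem ClassOn.exists_iterate_t (hΩ : IsOpenIn strip Ω) (hΩE : Ω ⊆ E) {i : ℕ}
    (hf : ClassOn α Ω E (n + i) (j + i) f) : ∃ g, ClassOn α Ω E n j g ∧
      (∀ p ∈ Ω, dt Ω i f p = g p) ∧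
      ∀ x : ℂ, ContDiffOn ℝ i (fun s : ℝ => f (x, s)) {s : ℝ | (x, s) ∈ Ω} := by
  induction i generalizing f with
  | zero =>
    refine ⟨f, hf, fun p hp => by simp [dt], fun x => ?_⟩
    exact contDiffOn_zero.2 (hf.holderOn.1.comp (by fun_prop) fun s hs => hΩE hs)
  | succ i ih =>
    obtain ⟨h0, -, ht⟩ := hf
    obtain ⟨f', hf', hd⟩ := ht (j + i) rfl
    obtain ⟨g, hg, hg', hcd⟩ := ih hf'
    have hder : ∀ x, EqOn (derivWithin (fun s : ℝ => f (x, s)) {s : ℝ | (x, s) ∈ Ω})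
        (fun s => f' (x, s)) {s : ℝ | (x, s) ∈ Ω} := fun x s hs =>
      ((hΩ.hasDerivWithinAt_iff hs).2 (hd _ hs)).derivWithin (hΩ.uniqueDiffOn x s hs)
    refine ⟨g, hg, fun p hp => ?_, fun x => ?_⟩
    · rw [← hg' p hp, dt, dt, iteratedDerivWithin_succ']
      exact iteratedDerivWithin_congr (hder p.1) hp
    · have := (contDiffOn_succ_iff_derivWithin (𝕜 := ℝ) (n := i) (hΩ.uniqueDiffOn x)
        (f := fun s : ℝ => f (x, s))).2 ⟨fun s hs =>
          ((hΩ.hasDerivWithinAt_iff hs).2 (hd _ hs)).differentiableWithinAt, by simp,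
          (hcd x).congr (hder x)⟩
      exact_mod_cast this

/-- The derivative of order n + 1 is the curried n-th derivative of the first derivative, and the
first derivative is determined by its values at 1 and I, to which the induction hypothesis applies.
Currying is an isometry and so preserves Hölder bounds. -/
theorem ClassOn.exists_iteratedFDeriv (hΩ : IsOpenIn strip Ω) (hΩE : Ω ⊆ E)
    (hf : ClassOn α Ω E n j f) :
    (∀ t : ℝ, ContDiffOn ℝ n (fun x : ℂ => f (x, t)) (slice Ω t)) ∧
    ∃ G : ℂ × ℝ → ContinuousMultilinearMap ℝ (fun _ : Fin n => ℂ) F,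
      EqOn G (fun p => iteratedFDeriv ℝ n (fun x : ℂ => f (x, p.2)) p.1) Ω ∧
      HolderOn α E G := by
  induction n generalizing f with
  | zero =>
    refine ⟨fun t => ?_, fun p => (continuousMultilinearCurryFin0 ℝ ℂ F).symm (f p), fun p hp => ?_,
      HolderOn.clm (continuousMultilinearCurryFin0 ℝ ℂ F).symm.toContinuousLinearEquiv.toContinuousLinearMap
        hf⟩
    · refine contDiffOn_zero.2 ?_
      exact hf.holderOn.1.comp (by fun_prop) fun x hx => hΩE hx
    · ext m
      simp
  | succ n ih =>
    obtain ⟨h0, ⟨A, hA, hd⟩, -⟩ := hf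
    obtain ⟨hc1, G1, hG1, hG1'⟩ := ih (hA 1)
    obtain ⟨hcI, GI, hGI, hGI'⟩ := ih (hA Complex.I)
    have hfd : ∀ t, EqOn (fun x => fderiv ℝ (fun x => f (x, t)) x)
        (fun x => lin (A (x, t) 1) (A (x, t) Complex.I)) (slice Ω t) := by
      intro t x hx
      dsimp only
      rw [(hd (x, t) hx).fderiv, ← eq_lin]
    let L1 : F →L[ℝ] (ℂ →L[ℝ] F) := ContinuousLinearMap.smulRightL ℝ ℂ F Complex.reCLM
    let LI : F →L[ℝ] (ℂ →L[ℝ] F) := ContinuousLinearMap.smulRightL ℝ ℂ F Complex.imCLM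
    have hlin : ∀ a b : F, lin a b = L1 a + LI b := fun a b => rfl
    have hcd : ∀ t, ContDiffOn ℝ n (fun x => L1 (A (x, t) 1)) (slice Ω t) := fun t =>
      L1.contDiff.comp_contDiffOn (hc1 t)
    have hcd' : ∀ t, ContDiffOn ℝ n (fun x => LI (A (x, t) Complex.I)) (slice Ω t) := fun t =>
      LI.contDiff.comp_contDiffOn (hcI t)
    refine ⟨fun t => ?_, fun p => (continuousMultilinearCurryRightEquiv' ℝ n ℂ F).symm
      (L1.compContinuousMultilinearMap (G1 p) + LI.compContinuousMultilinearMap (GI p)),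
      fun p hp => ?_, ?_⟩
    · have := (contDiffOn_succ_iff_fderiv_of_isOpen (𝕜 := ℝ) (n := n) (hΩ.isOpen_slice t)
        (f := fun x : ℂ => f (x, t))).2 ⟨fun x hx => (hd (x, t) hx).differentiableAt.differentiableWithinAt,
          by simp, ((hcd t).add (hcd' t)).congr fun x hx => hfd t hx⟩
      exact_mod_cast this
    · have hev : (fun x => fderiv ℝ (fun x => f (x, p.2)) x) =ᶠ[𝓝 p.1]
          (fun x => L1 (A (x, p.2) 1) + LI (A (x, p.2) Complex.I)) := by
        filter_upwards [(hΩ.isOpen_slice p.2).mem_nhds hp] with x hx using hfd p.2 hx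
      have hn := (hΩ.isOpen_slice p.2).mem_nhds hp
      dsimp only
      rw [iteratedFDeriv_succ_eq_comp_right, Function.comp_apply, (hev.iteratedFDeriv ℝ n).eq_of_nhds]
      congr 1
      have e1 := iteratedFDeriv_add_apply (𝕜 := ℝ) (i := n) ((hcd p.2).contDiffAt hn)
        ((hcd' p.2).contDiffAt hn)
      have e2 := L1.iteratedFDeriv_comp_left (i := n) ((hc1 p.2).contDiffAt hn) le_rfl
      have e3 := LI.iteratedFDeriv_comp_left (i := n) ((hcI p.2).contDiffAt hn) le_rfl
      rw [hG1 hp, hGI hp]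
      refine Eq.trans ?_ e1.symm
      congr 1
      · exact e2.symm
      · exact e3.symm
    · let T := ContinuousLinearMap.compContinuousMultilinearMapL ℝ (fun _ : Fin n => ℂ) F (ℂ →L[ℝ] F)
      have h1 := HolderOn.clm (F := ContinuousMultilinearMap ℝ (fun _ : Fin n => ℂ) F)
        (G := ContinuousMultilinearMap ℝ (fun _ : Fin n => ℂ) (ℂ →L[ℝ] F)) (T L1) hG1'
      have h2 := HolderOn.clm (F := ContinuousMultilinearMap ℝ (fun _ : Fin n => ℂ) F)
        (G := ContinuousMultilinearMap ℝ (fun _ : Fin n => ℂ) (ℂ →L[ℝ] F)) (T LI) hGI'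
      have h3 := h1.add h2
      exact h3.isometry (continuousMultilinearCurryRightEquiv' ℝ n ℂ F).symm.isometry

theorem isOfClass_of_classOn {k j : ℕ∞}
    (hf : ∀ n j' : ℕ, (n : ℕ∞) ≤ k → (j' : ℕ∞) ≤ j → ClassOn α (relInterior E) E n j' f) :
    IsOfClass E k j α f := by
  refine ⟨(hf 0 0 (by simp) (by simp)).holderOn.1, fun l i hi hl => ?_⟩
  have hΩ := isOpenIn_relInterior E
  have h1 := hf (l + i) i (by exact_mod_cast hl) hi
  obtain ⟨g, hg, hg', hcd⟩ := ClassOn.exists_iterate_t (j := 0) hΩ (relInterior_subset E) (by simpa using h1)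
  obtain ⟨hcx, G, hG, hG'⟩ := hg.exists_iteratedFDeriv hΩ (relInterior_subset E)
  refine ⟨hcd, fun t => (hcx t).congr fun x hx => hg' (x, t) hx, G, fun p hp => ?_, hG'⟩
  rw [hG hp, dxdt]
  have : (fun x : ℂ => dt (relInterior E) i f (x, p.2)) =ᶠ[𝓝 p.1] fun x => g (x, p.2) := by
    filter_upwards [hΩ.eventually_x hp] with x hx using hg' (x, p.2) hx
  exact (this.iteratedFDeriv ℝ l).eq_of_nhds.symm

end Bridge

/-! ### Coefficients with vanishing moments -/

section Seeley

/-- The coefficients of `∏_{i ≥ 1} (1 - z / 2 ^ i)`. -/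
noncomputable def eulerCoeff (m : ℕ) : ℝ := ∏ i ∈ Finset.range m, (-(1 / (2 ^ (i + 1) - 1) : ℝ))

theorem eulerCoeff_succ (m : ℕ) : eulerCoeff (m + 1) = -(eulerCoeff m / (2 ^ (m + 1) - 1)) := by
  rw [eulerCoeff, Finset.prod_range_succ, ← eulerCoeff]; ring

theorem one_le_two_pow_sub (m : ℕ) : (1 : ℝ) ≤ 2 ^ (m + 1) - 1 := by
  have : (1 : ℝ) ≤ 2 ^ m := one_le_pow₀ (by norm_num)
  rw [pow_succ]; linarith

/-- The ratio of consecutive terms has absolute value 2^n / (2^{m+1} - 1), which tends to 0. -/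
theorem summable_eulerCoeff (n : ℕ) : Summable fun m : ℕ => eulerCoeff m * ((2 : ℝ) ^ m) ^ n := by
  refine summable_of_ratio_norm_eventually_le (r := 1 / 2) (by norm_num) ?_
  filter_upwards [eventually_ge_atTop (n + 2)] with m hm
  rw [eulerCoeff_succ]
  have h1 : (2 : ℝ) ^ (n + 2) ≤ 2 ^ m := pow_le_pow_right₀ (by norm_num) hm
  have h2 := one_le_two_pow_sub m
  have h3 : (2 : ℝ) ^ n * 2 ≤ 2 ^ (m + 1) - 1 := by
    have : (1 : ℝ) ≤ 2 ^ m := one_le_pow₀ (by norm_num)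
    rw [pow_add] at h1; rw [pow_succ]; linarith
  have e : -(eulerCoeff m / (2 ^ (m + 1) - 1)) * ((2 : ℝ) ^ (m + 1)) ^ n =
      -(2 ^ n / (2 ^ (m + 1) - 1)) * (eulerCoeff m * (2 ^ m) ^ n) := by
    rw [pow_succ (2 : ℝ) m, mul_pow]; ring
  rw [e, norm_mul, norm_neg, Real.norm_of_nonneg (by positivity)]
  refine mul_le_mul_of_nonneg_right ?_ (norm_nonneg _)
  rw [div_le_iff₀ (by linarith)]; linarith

/-- This is the functional equation P(2z) = (1 - z) P(z) of P(z) = ∏_{i ≥ 1} (1 - z / 2^i) at z =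
2^n, derived from the recursion of the coefficients. -/
theorem tsum_eulerCoeff_succ (n : ℕ) : ∑' m : ℕ, eulerCoeff m * ((2 : ℝ) ^ m) ^ (n + 1) =
    (1 - 2 ^ n) * ∑' m : ℕ, eulerCoeff m * ((2 : ℝ) ^ m) ^ n := by
  have h1 := summable_eulerCoeff n
  have h2 := summable_eulerCoeff (n + 1)
  have h3 := (h2.sub h1).tsum_eq_zero_add
  have e : ∀ m, eulerCoeff (m + 1) * ((2 : ℝ) ^ (m + 1)) ^ (n + 1) -
      eulerCoeff (m + 1) * ((2 : ℝ) ^ (m + 1)) ^ n =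
      (-2 ^ n) * (eulerCoeff m * ((2 : ℝ) ^ m) ^ n) := by
    intro m
    have := one_le_two_pow_sub m
    have h0 : (2 : ℝ) ^ (m + 1) - 1 ≠ 0 := by linarith
    have e1 : eulerCoeff (m + 1) * (2 ^ (m + 1) - 1) = - eulerCoeff m := by
      rw [eulerCoeff_succ]; field_simp
    calc _ = (eulerCoeff (m + 1) * (2 ^ (m + 1) - 1)) * ((2 : ℝ) ^ (m + 1)) ^ n := by ring
      _ = _ := by rw [e1, pow_succ (2 : ℝ) m, mul_pow]; ring
  rw [h2.tsum_sub h1] at h3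
  simp only [e, tsum_mul_left] at h3
  simp only [pow_zero, one_pow] at h3
  linarith

/-- P vanishes at 2, where the factor 1 - 2^0 is zero, and the functional equation carries the zero
to the higher powers of 2. -/
theorem tsum_eulerCoeff_eq_zero (n : ℕ) :
    ∑' m : ℕ, eulerCoeff m * ((2 : ℝ) ^ m) ^ (n + 1) = 0 := by
  induction n with
  | zero => rw [tsum_eulerCoeff_succ]; simp
  | succ n ih => rw [tsum_eulerCoeff_succ, ih, mul_zero]

theorem tsum_eulerCoeff_ne_zero : ∑' m : ℕ, eulerCoeff m ≠ 0 := by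
  have h0 : Summable eulerCoeff := by simpa using summable_eulerCoeff 0
  -- Here 1/21 is the absolute value of the coefficient of index 3. The first three coefficients add
  -- up to 1/3, and the tail is at most 2/21.
  have hb : ∀ m, ‖eulerCoeff (m + 3)‖ ≤ 1 / 21 * (1 / 2) ^ m := by
    intro m
    induction m with
    | zero => norm_num [eulerCoeff, Finset.prod_range_succ]
    | succ m ih =>
      rw [show m + 1 + 3 = (m + 3) + 1 by ring, eulerCoeff_succ, norm_neg, norm_div]
      have h1 : (2 : ℝ) ≤ 2 ^ (m + 3 + 1) - 1 := by
        have : (1 : ℝ) ≤ 2 ^ m := one_le_pow₀ (by norm_num)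
        rw [pow_add, pow_add]; linarith
      rw [Real.norm_of_nonneg (by linarith : (0 : ℝ) ≤ 2 ^ (m + 3 + 1) - 1)]
      rw [div_le_iff₀ (by linarith)]
      calc _ ≤ 1 / 21 * (1 / 2 : ℝ) ^ m := ih
        _ = 1 / 21 * (1 / 2) ^ (m + 1) * 2 := by ring
        _ ≤ _ := by gcongr
  have h1 := tsum_of_norm_bounded ((hasSum_geometric_two).mul_left (1 / 21 : ℝ)) hb
  have h2 := h0.sum_add_tsum_nat_add 3
  have h3 : ∑ i ∈ Finset.range 3, eulerCoeff i = 1 / 3 := by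
    norm_num [eulerCoeff, Finset.sum_range_succ, Finset.prod_range_succ]
  intro h
  rw [h, h3] at h2
  rw [show ∑' i, eulerCoeff (i + 3) = -(1 / 3) by linarith] at h1
  norm_num at h1

/-- The dilation factors of the reflections. -/
def dil (m : ℕ) : ℝ := 4 * 2 ^ m

/-- Rapidly decreasing sequences whose moments of positive order with respect to `dil` vanish. -/
def SeeleySeq (c : ℕ → ℝ) : Prop :=
  (∀ n : ℕ, Summable fun m => |c m| * dil m ^ n) ∧ ∀ n : ℕ, ∑' m, c m * dil m ^ (n + 1) = 0

theorem dil_pos (m : ℕ) : 0 < dil m := by unfold dil; positivity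

/-- A displacement by s against v lowers r by at least s/2. With s = dil m · r, the factor 4 gives
s/2 ≥ 2r, which is more than r when r > 0, so reflected points fall strictly inside D. -/
theorem four_le_dil (m : ℕ) : 4 ≤ dil m := by
  have : (1 : ℝ) ≤ 2 ^ m := one_le_pow₀ (by norm_num)
  unfold dil; linarith

/-- Differentiating a reflected term produces a factor `dil m`; the admissible sequences must be
stable under it. -/
theorem SeeleySeq.mul_dil {c : ℕ → ℝ} (hc : SeeleySeq c) : SeeleySeq fun m => c m * dil m := by
  refine ⟨fun n => (hc.1 (n + 1)).congr fun m => ?_, fun n => ?_⟩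
  · rw [abs_mul, abs_of_pos (dil_pos m)]; ring
  · rw [← hc.2 (n + 1)]
    exact tsum_congr fun m => by ring

theorem SeeleySeq.tsum_mul_dil {c : ℕ → ℝ} (hc : SeeleySeq c) : ∑' m, c m * dil m = 0 := by
  simpa using hc.2 0

theorem SeeleySeq.summable {c : ℕ → ℝ} (hc : SeeleySeq c) : Summable c := by
  have := hc.1 0
  simp only [pow_zero, mul_one] at this
  exact this.of_abs

theorem exists_seeleySeq : ∃ c : ℕ → ℝ, SeeleySeq c ∧ ∑' m, c m = 1 := by
  refine ⟨fun m => (∑' m, eulerCoeff m)⁻¹ * eulerCoeff m, ⟨fun n => ?_, fun n => ?_⟩, ?_⟩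
  · have := (((summable_eulerCoeff n).mul_left (4 ^ n * (∑' m, eulerCoeff m)⁻¹)).abs)
    refine this.congr fun m => ?_
    dsimp only
    rw [← abs_of_pos (pow_pos (dil_pos m) n), ← abs_mul]
    congr 1
    rw [dil, mul_pow]; ring
  · have : ∀ m, (∑' m, eulerCoeff m)⁻¹ * eulerCoeff m * dil m ^ (n + 1) =
      (4 ^ (n + 1) * (∑' m, eulerCoeff m)⁻¹) * (eulerCoeff m * (2 ^ m) ^ (n + 1)) := by
      intro m; rw [dil, mul_pow]; ring
    simp only [this, tsum_mul_left, tsum_eulerCoeff_eq_zero, mul_zero]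
  · rw [tsum_mul_left, inv_mul_cancel₀ tsum_eulerCoeff_ne_zero]

end Seeley

/-! ### Differentiability across a transversal zero set -/

section Crossing

variable {F : Type*} [NormedAddCommGroup F] [NormedSpace ℝ F]
  {α : ℝ} {N : Set (ℂ × ℝ)} {f : ℂ × ℝ → F} {n j : ℕ} {r : ℂ × ℝ → ℝ}
  {ar : ℂ × ℝ → ℂ →L[ℝ] ℝ} {v : ℂ}

theorem hasDerivAt_line' {φ : ℂ → F} {L : ℂ →L[ℝ] F} {y e : ℂ} {s : ℝ}
    (h : HasFDerivAt φ L (y + s • e)) : HasDerivAt (fun s : ℝ => φ (y + s • e)) (L e) s := by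
  have h1 : HasDerivAt (fun s : ℝ => y + s • e) e s := by
    simpa using ((hasDerivAt_id s).smul_const e).const_add y
  exact h.comp_hasDerivAt s h1

theorem add_half_le_of_line (hr : ∀ p ∈ N, HasFDerivAt (fun x => r (x, p.2)) (ar p) p.1)
    (hv : ∀ p ∈ N, 1 / 2 ≤ ar p v) {y : ℂ} {τ s s' : ℝ} (hs : s ≤ s')
    (hN : ∀ σ ∈ Icc s s', (y + σ • v, τ) ∈ N) :
    r (y + s • v, τ) + (s' - s) / 2 ≤ r (y + s' • v, τ) := by
  have hd : ∀ σ ∈ Icc s s', HasDerivAt (fun σ : ℝ => r (y + σ • v, τ)) (ar (y + σ • v, τ) v) σ :=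
    fun σ hσ => hasDerivAt_line' (φ := fun x => r (x, τ)) (hr _ (hN σ hσ))
  have := (convex_Icc s s').mul_sub_le_image_sub_of_le_deriv (C := 1 / 2)
    (fun σ hσ => (hd σ hσ).continuousAt.continuousWithinAt)
    (fun σ hσ => (hd σ (interior_subset hσ)).differentiableAt.differentiableWithinAt)
    (fun σ hσ => by rw [(hd σ (interior_subset hσ)).deriv]; exact hv _ (hN σ (interior_subset hσ)))
    s (left_mem_Icc.2 hs) s' (right_mem_Icc.2 hs) hs
  linarith

/-- Since r increases strictly along v, the segment meets {r = 0} at most once. As f is continuous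
there, the fundamental theorem of calculus still holds along the segment. -/
theorem norm_leg_le [CompleteSpace F]
    (hr : ∀ p ∈ N, HasFDerivAt (fun x => r (x, p.2)) (ar p) p.1)
    (hv : ∀ p ∈ N, 1 / 2 ≤ ar p v) {A : ℂ × ℝ → ℂ →L[ℝ] F} (hf : ContinuousOn f N)
    (hA : ContinuousOn A N)
    (hfA : ∀ p ∈ N, r p ≠ 0 → HasFDerivAt (fun x => f (x, p.2)) (A p) p.1)
    {y : ℂ} {τ s ε : ℝ} (hs : 0 ≤ s) (hN : ∀ σ ∈ Icc 0 s, (y + σ • v, τ) ∈ N) {a : F}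
    (ha : ∀ σ ∈ Icc 0 s, ‖A (y + σ • v, τ) v - a‖ ≤ ε) :
    ‖f (y + s • v, τ) - f (y, τ) - s • a‖ ≤ ε * s := by
  have hline : ContinuousOn (fun σ : ℝ => (y + σ • v, τ)) (Icc 0 s) := by fun_prop
  have hint : IntervalIntegrable (fun σ : ℝ => A (y + σ • v, τ) v) MeasureTheory.volume 0 s := by
    refine ContinuousOn.intervalIntegrable ?_
    rw [uIcc_of_le hs]
    exact (hA.comp hline fun σ hσ => hN σ hσ).clm_apply continuousOn_const
  have hsub : {σ ∈ Icc 0 s | r (y + σ • v, τ) = 0}.Subsingleton := by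
    have aux : ∀ σ₁ ∈ Icc 0 s, ∀ σ₂ ∈ Icc 0 s, r (y + σ₁ • v, τ) = 0 → r (y + σ₂ • v, τ) = 0 →
        σ₂ ≤ σ₁ := by
      intro σ₁ h₁ σ₂ h₂ e₁ e₂
      by_contra! hlt
      have := add_half_le_of_line hr hv hlt.le
        (fun σ hσ => hN σ ⟨h₁.1.trans hσ.1, hσ.2.trans h₂.2⟩)
      rw [e₁, e₂] at this
      linarith
    rintro σ₁ ⟨h₁, e₁⟩ σ₂ ⟨h₂, e₂⟩
    exact le_antisymm (aux _ h₂ _ h₁ e₂ e₁) (aux _ h₁ _ h₂ e₁ e₂)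
  have key := MeasureTheory.integral_eq_of_hasDerivAt_off_countable
    (fun σ : ℝ => f (y + σ • v, τ)) (fun σ => A (y + σ • v, τ) v) (a := 0) (b := s)
    hsub.countable ?_ ?_ hint
  · have h2 : ∫ σ in (0 : ℝ)..s, (A (y + σ • v, τ) v - a) =
        f (y + s • v, τ) - f (y, τ) - s • a := by
      rw [intervalIntegral.integral_sub hint (by simp), key]
      simp
    rw [← h2]
    have := intervalIntegral.norm_integral_le_of_norm_le_const (a := 0) (b := s) (C := ε)
      (f := fun σ => A (y + σ • v, τ) v - a) ?_
    · rwa [sub_zero, abs_of_nonneg hs] at this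
    · intro σ hσ
      rw [uIoc_of_le hs] at hσ
      exact ha σ (Ioc_subset_Icc_self hσ)
  · rw [uIcc_of_le hs]
    exact hf.comp hline fun σ hσ => hN σ hσ
  · rintro σ ⟨hσ, hσ'⟩
    rw [min_eq_left hs, max_eq_right hs] at hσ
    have hσ2 := Ioo_subset_Icc_self hσ
    refine hasDerivAt_line' (φ := fun x => f (x, τ)) (hfA _ (hN σ hσ2) fun h0 => hσ' ⟨hσ2, h0⟩)

theorem exists_box (hN : IsOpenIn strip N) {p : ℂ × ℝ} (hp : p ∈ N) {P : ℂ × ℝ → Prop}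
    (hP : ∀ᶠ q in 𝓝[N] p, P q) : ∃ ρ > 0, ∀ (y : ℂ) (s : ℝ), ‖y - p.1‖ < ρ → |s - p.2| < ρ →
      s ∈ Icc (0 : ℝ) 1 → (y, s) ∈ N ∧ P (y, s) := by
  obtain ⟨O, hO, rfl⟩ := hN
  obtain ⟨δ, hδ, hδ'⟩ := Metric.mem_nhdsWithin_iff.1 hP
  obtain ⟨δ₁, hδ₁, hδ₁'⟩ := Metric.isOpen_iff.1 hO _ hp.1
  refine ⟨min δ δ₁, lt_min hδ hδ₁, fun y s hy hs hsI => ?_⟩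
  have hd : dist (y, s) p < min δ δ₁ := by
    rw [Prod.dist_eq]; exact max_lt (by rwa [dist_eq_norm]) (by rwa [Real.dist_eq])
  have h2 : (y, s) ∈ O ∩ strip :=
    ⟨hδ₁' (hd.trans_le (min_le_right _ _)), mem_univ _, hsI⟩
  exact ⟨h2, hδ' ⟨hd.trans_le (min_le_left _ _), h2⟩⟩

/-- At a point p with r p = 0, join x to p by the path x → x + Kδv → p + Kδv → p with δ = |x - p|.
The outer legs cross {r = 0} at most once and are handled by `norm_leg_le`; the middle one lies in
{r > 0}, where f is differentiable. The linear parts of the outer legs cancel. -/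
theorem hasFDerivAt_of_crossing [CompleteSpace F] (hN : IsOpenIn strip N)
    (hr : ∀ p ∈ N, HasFDerivAt (fun x => r (x, p.2)) (ar p) p.1)
    (hv : ∀ p ∈ N, 1 / 2 ≤ ar p v) {A : ℂ × ℝ → ℂ →L[ℝ] F} (hf : ContinuousOn f N)
    (hA : ContinuousOn A N)
    (hfA : ∀ p ∈ N, r p ≠ 0 → HasFDerivAt (fun x => f (x, p.2)) (A p) p.1)
    {p : ℂ × ℝ} (hp : p ∈ N) : HasFDerivAt (fun x => f (x, p.2)) (A p) p.1 := by
  by_cases h0 : r p ≠ 0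
  · exact hfA p hp h0
  push Not at h0
  obtain ⟨L, hL⟩ := (hr p hp).isBigO_sub.bound
  -- On the segment from p to x one has r ≥ -Lδ, and the shift by Kδv adds at least Kδ/2, so K > 2L
  -- puts the middle leg in {r > 0}.
  obtain ⟨K, hK0, hKL⟩ : ∃ K : ℝ, 0 < K ∧ L < K / 2 := ⟨2 * |L| + 1, by positivity, by
    have := le_abs_self L; linarith⟩
  rw [hasFDerivAt_iff_isLittleO, Asymptotics.isLittleO_iff]
  intro ε hε
  -- The errors are ε'δ on the middle leg and ε'‖v‖Kδ on each of the two outer legs.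
  set ε' := ε / (1 + 2 * K * ‖v‖) with hε'
  have hε'0 : 0 < ε' := by positivity
  have hAe : ∀ᶠ q in 𝓝[N] p, ‖A q - A p‖ < ε' := by
    have := ((hA p hp).sub_const (A p)).norm
    exact this.eventually (gt_mem_nhds (by simpa using hε'0))
  obtain ⟨ρ, hρ, hbox⟩ := exists_box hN hp hAe
  obtain ⟨η, hη, hη'⟩ := Metric.eventually_nhds_iff.1 hL
  have hc : ∀ᶠ x in 𝓝 p.1, ‖x - p.1‖ + K * ‖x - p.1‖ * ‖v‖ < min ρ η := by
    have : Continuous fun x : ℂ => ‖x - p.1‖ + K * ‖x - p.1‖ * ‖v‖ := by fun_prop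
    exact this.continuousAt.eventually (gt_mem_nhds (by simpa using ⟨hρ, hη⟩))
  filter_upwards [hc] with x hx
  set δ := ‖x - p.1‖ with hδ
  rcases (norm_nonneg (x - p.1)).eq_or_lt with hδ0 | hδ0
  · have : x = p.1 := sub_eq_zero.1 (norm_eq_zero.1 hδ0.symm)
    simp only [this, sub_self, map_zero, norm_zero]
    exact mul_nonneg hε.le (norm_nonneg _)
  rw [← hδ] at hδ0
  have hpI := hN.mem_Icc hp
  have hs0 : 0 ≤ K * δ := by positivity
  have hin : ∀ y, ‖y - p.1‖ ≤ δ → ∀ σ ∈ Icc 0 (K * δ), (y + σ • v, p.2) ∈ N ∧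
      ‖A (y + σ • v, p.2) - A p‖ < ε' := by
    intro y hy σ hσ
    refine hbox _ _ ?_ (by simpa using hρ) hpI
    calc ‖y + σ • v - p.1‖ = ‖(y - p.1) + σ • v‖ := by congr 1; ring
      _ ≤ ‖y - p.1‖ + ‖σ • v‖ := norm_add_le _ _
      _ ≤ δ + K * δ * ‖v‖ := by
        rw [norm_smul, Real.norm_of_nonneg hσ.1]
        gcongr
        exact hσ.2
      _ < ρ := hx.trans_le (min_le_left _ _)
  have hleg : ∀ y, ‖y - p.1‖ ≤ δ →
      ‖f (y + (K * δ) • v, p.2) - f (y, p.2) - (K * δ) • A p v‖ ≤ ε' * ‖v‖ * (K * δ) := by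
    intro y hy
    refine norm_leg_le hr hv hf hA hfA hs0 (fun σ hσ => (hin y hy σ hσ).1) fun σ hσ => ?_
    rw [← sub_apply]
    exact (ContinuousLinearMap.le_opNorm _ _).trans (by gcongr; exact (hin y hy σ hσ).2.le)
  have hmid : ‖f (x + (K * δ) • v, p.2) - f (p.1 + (K * δ) • v, p.2) - A p (x - p.1)‖ ≤
      ε' * δ := by
    have hseg : ∀ y ∈ segment ℝ p.1 x, ‖y - p.1‖ ≤ δ := fun y hy => by
      simpa [dist_eq_norm, hδ] using norm_sub_le_of_mem_segment hy
    have := (convex_segment (𝕜 := ℝ) p.1 x).norm_image_sub_le_of_norm_hasFDerivWithin_le'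
      (f := fun y => f (y + (K * δ) • v, p.2)) (f' := fun y => A (y + (K * δ) • v, p.2))
      (φ := A p) (C := ε') (fun y hy => ?_)
      (fun y hy => (hin y (hseg y hy) _ (right_mem_Icc.2 hs0)).2.le)
      (left_mem_segment ℝ p.1 x) (right_mem_segment ℝ p.1 x)
    · exact this
    · have hy' := hseg y hy
      have hpos : r (y + (K * δ) • v, p.2) ≠ 0 := by
        have h1 := add_half_le_of_line hr hv hs0 (y := y) (fun σ hσ => (hin y hy' σ hσ).1)
        have h2 := hη' (y := y) (by
          rw [dist_eq_norm]
          have := hx.trans_le (min_le_right _ _)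
          have : 0 ≤ K * δ * ‖v‖ := by positivity
          linarith)
        simp only [zero_smul, add_zero, sub_zero] at h1
        have h0' : r (p.1, p.2) = 0 := h0
        rw [h0', sub_zero, Real.norm_eq_abs] at h2
        have h3 := neg_abs_le (r (y, p.2))
        have h4 : L * ‖y - p.1‖ < K * δ / 2 := by
          rcases le_or_gt L 0 with hL0 | hL0
          · have : L * ‖y - p.1‖ ≤ 0 := mul_nonpos_of_nonpos_of_nonneg hL0 (norm_nonneg _)
            have : 0 < K * δ / 2 := by positivity
            linarith
          · calc L * ‖y - p.1‖ ≤ L * δ := by gcongr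
              _ < K / 2 * δ := by gcongr
              _ = _ := by ring
        linarith
      have h1 := hfA _ (hin y hy' _ (right_mem_Icc.2 hs0)).1 hpos
      have h2 : HasFDerivAt (fun y : ℂ => y + (K * δ) • v) (ContinuousLinearMap.id ℝ ℂ) y :=
        (hasFDerivAt_id y).add_const _
      exact (HasFDerivAt.comp (g := fun x => f (x, p.2)) y h1 h2).hasFDerivWithinAt
  have h1 := hleg x le_rfl
  have h2 := hleg p.1 (by simp [hδ0.le])
  have e : f (x, p.2) - f (p.1, p.2) - A p (x - p.1) =
      (f (x + (K * δ) • v, p.2) - f (p.1 + (K * δ) • v, p.2) - A p (x - p.1)) -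
      (f (x + (K * δ) • v, p.2) - f (x, p.2) - (K * δ) • A p v) +
      (f (p.1 + (K * δ) • v, p.2) - f (p.1, p.2) - (K * δ) • A p v) := by abel
  rw [e]
  refine (norm_add_le _ _).trans ((add_le_add (norm_sub_le _ _) le_rfl).trans ?_)
  calc _ ≤ ε' * δ + ε' * ‖v‖ * (K * δ) + ε' * ‖v‖ * (K * δ) := by gcongr
    _ = ε' * (1 + 2 * K * ‖v‖) * δ := by ring
    _ = ε * δ := by rw [hε', div_mul_cancel₀ _ (by positivity)]

/-- The same three-leg path, with the middle leg in the direction of t. Differentiability of r in t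
at p supplies the linear bound on r that keeps this leg in {r > 0}. -/
theorem hasDerivWithinAt_of_crossing [CompleteSpace F] (hN : IsOpenIn strip N)
    (hr : ∀ p ∈ N, HasFDerivAt (fun x => r (x, p.2)) (ar p) p.1)
    (hv : ∀ p ∈ N, 1 / 2 ≤ ar p v) {A : ℂ × ℝ → ℂ →L[ℝ] F} (hf : ContinuousOn f N)
    (hA : ContinuousOn A N)
    (hfA : ∀ p ∈ N, r p ≠ 0 → HasFDerivAt (fun x => f (x, p.2)) (A p) p.1)
    {f' : ℂ × ℝ → F} (hf' : ContinuousOn f' N)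
    (hff' : ∀ p ∈ N, r p ≠ 0 → HasDerivWithinAt (fun s => f (p.1, s)) (f' p) (Icc 0 1) p.2)
    {p : ℂ × ℝ} (hp : p ∈ N)
    (hrt : ∃ r', HasDerivWithinAt (fun s => r (p.1, s)) r' (Icc 0 1) p.2) :
    HasDerivWithinAt (fun s => f (p.1, s)) (f' p) (Icc 0 1) p.2 := by
  by_cases h0 : r p ≠ 0
  · exact hff' p hp h0
  push Not at h0
  obtain ⟨r', hr'⟩ := hrt
  obtain ⟨L, hL⟩ := hr'.differentiableWithinAt.isBigO_sub.bound
  obtain ⟨K, hK0, hKL⟩ : ∃ K : ℝ, 0 < K ∧ L < K / 2 := ⟨2 * |L| + 1, by positivity, by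
    have := le_abs_self L; linarith⟩
  rw [hasDerivWithinAt_iff_isLittleO, Asymptotics.isLittleO_iff]
  intro ε hε
  set ε' := ε / (1 + 2 * K * ‖v‖) with hε'
  have hε'0 : 0 < ε' := by positivity
  have hAe : ∀ᶠ q in 𝓝[N] p, ‖A q - A p‖ < ε' ∧ ‖f' q - f' p‖ < ε' := by
    have h1 := ((hA p hp).sub_const (A p)).norm
    have h2 := ((hf' p hp).sub_const (f' p)).norm
    exact (h1.eventually (gt_mem_nhds (by simpa using hε'0))).and
      (h2.eventually (gt_mem_nhds (by simpa using hε'0)))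
  obtain ⟨ρ, hρ, hbox⟩ := exists_box hN hp hAe
  obtain ⟨η, hη, hη'⟩ := Metric.mem_nhdsWithin_iff.1 hL
  have hc : ∀ᶠ t in 𝓝 p.2, |t - p.2| + K * |t - p.2| * ‖v‖ < min ρ η := by
    have : Continuous fun t : ℝ => |t - p.2| + K * |t - p.2| * ‖v‖ := by fun_prop
    exact this.continuousAt.eventually (gt_mem_nhds (by simpa using ⟨hρ, hη⟩))
  filter_upwards [mem_nhdsWithin_of_mem_nhds hc, self_mem_nhdsWithin] with t ht htI
  set δ := |t - p.2| with hδ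
  rcases (abs_nonneg (t - p.2)).eq_or_lt with hδ0 | hδ0
  · have : t = p.2 := sub_eq_zero.1 (abs_eq_zero.1 hδ0.symm)
    simp [this]
  rw [← hδ] at hδ0
  have hpI := hN.mem_Icc hp
  have hs0 : 0 ≤ K * δ := by positivity
  have hin : ∀ τ ∈ Icc (0 : ℝ) 1, |τ - p.2| ≤ δ → ∀ σ ∈ Icc 0 (K * δ), (p.1 + σ • v, τ) ∈ N ∧
      ‖A (p.1 + σ • v, τ) - A p‖ < ε' ∧ ‖f' (p.1 + σ • v, τ) - f' p‖ < ε' := by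
    intro τ hτ hy σ hσ
    have hlt : δ + K * δ * ‖v‖ < ρ := ht.trans_le (min_le_left _ _)
    have h1 : ‖σ • v‖ ≤ K * δ * ‖v‖ := by
      rw [norm_smul, Real.norm_of_nonneg hσ.1]
      gcongr
      exact hσ.2
    refine hbox _ _ ?_ ?_ hτ
    · rw [add_sub_cancel_left]; linarith
    · have : 0 ≤ K * δ * ‖v‖ := by positivity
      linarith
  have hleg : ∀ τ ∈ Icc (0 : ℝ) 1, |τ - p.2| ≤ δ →
      ‖f (p.1 + (K * δ) • v, τ) - f (p.1, τ) - (K * δ) • A p v‖ ≤ ε' * ‖v‖ * (K * δ) := by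
    intro τ hτI hτ
    refine norm_leg_le hr hv hf hA hfA hs0 (fun σ hσ => (hin τ hτI hτ σ hσ).1) fun σ hσ => ?_
    rw [← sub_apply]
    exact (ContinuousLinearMap.le_opNorm _ _).trans (by gcongr; exact (hin τ hτI hτ σ hσ).2.1.le)
  have hsub : uIcc p.2 t ⊆ Icc (0 : ℝ) 1 := ordConnected_Icc.uIcc_subset hpI htI
  have hseg : ∀ τ ∈ uIcc p.2 t, |τ - p.2| ≤ δ := fun τ hτ => abs_sub_left_of_mem_uIcc hτ
  have hmid : ‖f (p.1 + (K * δ) • v, t) - f (p.1 + (K * δ) • v, p.2) - (t - p.2) • f' p‖ ≤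
      ε' * δ := by
    have := (convex_uIcc p.2 t).norm_image_sub_le_of_norm_hasDerivWithin_le
      (f := fun τ => f (p.1 + (K * δ) • v, τ) - τ • f' p)
      (f' := fun τ => f' (p.1 + (K * δ) • v, τ) - f' p) (C := ε') (fun τ hτ => ?_)
      (fun τ hτ => (hin τ (hsub hτ) (hseg τ hτ) _ (right_mem_Icc.2 hs0)).2.2.le)
      left_mem_uIcc right_mem_uIcc
    · rw [Real.norm_eq_abs, ← hδ] at this
      convert this using 2
      rw [sub_smul]; abel
    · have hτ' := hseg τ hτ
      have hpos : r (p.1 + (K * δ) • v, τ) ≠ 0 := by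
        have h1 := add_half_le_of_line hr hv hs0 (y := p.1)
          (fun σ hσ => (hin τ (hsub hτ) hτ' σ hσ).1)
        have h2 := hη' (a := τ) ⟨by
          rw [Metric.mem_ball, Real.dist_eq]
          have := ht.trans_le (min_le_right _ _)
          have : 0 ≤ K * δ * ‖v‖ := by positivity
          linarith, hsub hτ⟩
        simp only [zero_smul, add_zero, sub_zero] at h1
        have h0' : r (p.1, p.2) = 0 := h0
        simp only [mem_ofPred_eq, h0', sub_zero, Real.norm_eq_abs] at h2
        have h3 := neg_abs_le (r (p.1, τ))
        have h4 : L * |τ - p.2| < K * δ / 2 := by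
          rcases le_or_gt L 0 with hL0 | hL0
          · have : L * |τ - p.2| ≤ 0 := mul_nonpos_of_nonpos_of_nonneg hL0 (abs_nonneg _)
            have : 0 < K * δ / 2 := by positivity
            linarith
          · calc L * |τ - p.2| ≤ L * δ := by gcongr
              _ < K / 2 * δ := by gcongr
              _ = _ := by ring
        linarith
      have h1 := (hff' _ (hin τ (hsub hτ) hτ' _ (right_mem_Icc.2 hs0)).1 hpos).mono hsub
      have h2 := ((hasDerivAt_id τ).smul_const (f' p)).hasDerivWithinAt (s := uIcc p.2 t)
      simpa using h1.fun_sub h2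
  have h1 := hleg t htI le_rfl
  have h2 := hleg p.2 hpI (by simp [hδ0.le])
  have e : f (p.1, t) - f (p.1, p.2) - (t - p.2) • f' p =
      (f (p.1 + (K * δ) • v, t) - f (p.1 + (K * δ) • v, p.2) - (t - p.2) • f' p) -
      (f (p.1 + (K * δ) • v, t) - f (p.1, t) - (K * δ) • A p v) +
      (f (p.1 + (K * δ) • v, p.2) - f (p.1, p.2) - (K * δ) • A p v) := by abel
  rw [e]
  refine (norm_add_le _ _).trans ((add_le_add (norm_sub_le _ _) le_rfl).trans ?_)
  calc _ ≤ ε' * δ + ε' * ‖v‖ * (K * δ) + ε' * ‖v‖ * (K * δ) := by gcongr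
    _ = ε' * (1 + 2 * K * ‖v‖) * δ := by ring
    _ = ε * δ := by rw [hε', div_mul_cancel₀ _ (by positivity)]

/-- A function that is of class `ClassOn` off the zero set of `r`, a set transversal to `v`, is
of that class. -/
theorem ClassOn.of_crossing [CompleteSpace F] (hN : IsOpenIn strip N)
    (hr : ∀ p ∈ N, HasFDerivAt (fun x => r (x, p.2)) (ar p) p.1)
    (hv : ∀ p ∈ N, 1 / 2 ≤ ar p v)
    (hrt : 0 < n → 0 < j → ∀ p ∈ N, ∃ r', HasDerivWithinAt (fun s => r (p.1, s)) r' (Icc 0 1) p.2)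
    (hf : ClassOn α (N \ {p | r p = 0}) N n j f) : ClassOn α N N n j f := by
  induction n generalizing f j with
  | zero => exact hf
  | succ n ih =>
    obtain ⟨h0, ⟨A, hA, hA'⟩, ht⟩ := hf
    have hAc : ContinuousOn A N := continuousOn_clm_apply.2 fun e => (hA e).holderOn.1
    have hfA : ∀ p ∈ N, r p ≠ 0 → HasFDerivAt (fun x => f (x, p.2)) (A p) p.1 :=
      fun p hp h => hA' p ⟨hp, h⟩
    refine ⟨h0, ⟨A, fun e => ih (fun _ hj => hrt (by omega) hj) (hA e), fun p hp =>
      hasFDerivAt_of_crossing hN hr hv h0.1 hAc hfA hp⟩, fun j' hj => ?_⟩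
    obtain ⟨f', hf', hff'⟩ := ht j' hj
    refine ⟨f', ih (fun _ _ => hrt (by omega) (by omega)) hf', fun p hp => ?_⟩
    exact hasDerivWithinAt_of_crossing hN hr hv h0.1 hAc hfA hf'.holderOn.1
      (fun p hp h => hff' p ⟨hp, h⟩) hp (hrt (by omega) (by omega) p hp)

end Crossing

/-! ### Extension by reflections: definition and Hölder estimate -/

section Reflection

open scoped ContDiff

/-- Smooth functions supported in `[-σ / 2, σ / 2]`. -/
def IsCutoff (σ : ℝ) (ψ : ℝ → ℝ) : Prop := ContDiff ℝ ∞ ψ ∧ ∀ s, σ / 2 < |s| → ψ s = 0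

theorem IsCutoff.eventually_eq_zero {σ : ℝ} {ψ : ℝ → ℝ} (h : IsCutoff σ ψ) {s : ℝ}
    (hs : σ / 2 < |s|) : ψ =ᶠ[𝓝 s] 0 := by
  filter_upwards [continuous_abs.continuousAt.eventually (lt_mem_nhds hs)] with x hx using h.2 x hx

theorem IsCutoff.deriv {σ : ℝ} {ψ : ℝ → ℝ} (h : IsCutoff σ ψ) : IsCutoff σ (deriv ψ) :=
  ⟨(contDiff_infty_iff_deriv.1 h.1).2, fun s hs => by
    rw [(h.eventually_eq_zero hs).deriv_eq]; simp⟩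

theorem IsCutoff.hasDerivAt {σ : ℝ} {ψ : ℝ → ℝ} (h : IsCutoff σ ψ) (s : ℝ) :
    HasDerivAt ψ (_root_.deriv ψ s) s :=
  (h.1.differentiable (by norm_num)).differentiableAt.hasDerivAt

theorem IsCutoff.hasCompactSupport {σ : ℝ} {ψ : ℝ → ℝ} (h : IsCutoff σ ψ) :
    HasCompactSupport ψ := by
  refine HasCompactSupport.of_support_subset_isCompact (isCompact_Icc (a := -(σ / 2)) (b := σ / 2))
    fun s hs => ?_
  rw [mem_Icc, ← abs_le]
  by_contra! hlt
  exact hs (h.2 s hlt)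

theorem exists_isCutoff {σ : ℝ} (hσ : 0 < σ) : ∃ ψ, IsCutoff σ ψ ∧ ψ 0 = 1 := by
  let b : ContDiffBump (0 : ℝ) := ⟨σ / 4, σ / 2, by positivity, by linarith⟩
  refine ⟨b, ⟨b.contDiff, fun s hs => b.zero_of_le_dist ?_⟩, b.one_of_mem_closedBall ?_⟩
  · rw [Real.dist_eq, sub_zero]; exact hs.le
  · simpa using b.rIn_pos.le

/-- Near a boundary point of `D`, where `D` is `{r < 0}` and the boundary is transversal to `v`:
translates of points of `N` by `-s • v` belong to `K ⊆ closure D`, or to `D`, once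
`r ≤ s / 2 ≤ σ / 2`, respectively `r < s / 2 ≤ σ / 2`. -/
structure ReflectionBox (D N K : Set (ℂ × ℝ)) (r : ℂ × ℝ → ℝ) (ar : ℂ × ℝ → ℂ →L[ℝ] ℝ) (v : ℂ)
    (σ : ℝ) : Prop where
  isOpenIn : IsOpenIn strip N
  pos : 0 < σ
  continuousOn : ContinuousOn r N
  lipschitz : ∃ L : ℝ, 0 ≤ L ∧ ∀ t x y, (x, t) ∈ N → (y, t) ∈ N →
    |r (x, t) - r (y, t)| ≤ L * ‖x - y‖
  bounded : ∃ R : ℝ, 0 < R ∧ ∀ t x y, (x, t) ∈ N → (y, t) ∈ N → ‖x - y‖ ≤ R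
  hasFDerivAt : ∀ p ∈ N, HasFDerivAt (fun x => r (x, p.2)) (ar p) p.1
  transversal : ∀ p ∈ N, 1 / 2 ≤ ar p v
  isCompact : IsCompact K
  subset : K ⊆ closure D
  mem_compact : ∀ p ∈ N, ∀ s, 0 ≤ s → s ≤ σ → r p ≤ s / 2 → (p.1 - s • v, p.2) ∈ K
  mem_domain : ∀ p ∈ N, ∀ s, 0 ≤ s → s ≤ σ → r p < s / 2 → (p.1 - s • v, p.2) ∈ D
  nonpos : ∀ p ∈ N, p ∈ closure D → r p ≤ 0

variable {F : Type*} [NormedAddCommGroup F] [NormedSpace ℝ F]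
  {α : ℝ} {D N K : Set (ℂ × ℝ)} {r : ℂ × ℝ → ℝ} {ar : ℂ × ℝ → ℂ →L[ℝ] ℝ} {v : ℂ} {σ : ℝ}
  {c : ℕ → ℝ} {ψ : ℝ → ℝ} {h : ℂ × ℝ → F} {n j : ℕ} {p : ℂ × ℝ}

/-- The `m`-th term of the extension by reflections. -/
noncomputable def reflTerm (r : ℂ × ℝ → ℝ) (v : ℂ) (c : ℕ → ℝ) (ψ : ℝ → ℝ) (h : ℂ × ℝ → F) (m : ℕ)
    (p : ℂ × ℝ) : F :=
  (c m * ψ (dil m * max (r p) 0)) • h (p.1 - (dil m * max (r p) 0) • v, p.2)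

/-- The extension of `h` by reflections. -/
noncomputable def reflExt (r : ℂ × ℝ → ℝ) (v : ℂ) (c : ℕ → ℝ) (ψ : ℝ → ℝ) (h : ℂ × ℝ → F)
    (p : ℂ × ℝ) : F :=
  ∑' m, reflTerm r v c ψ h m p

/-- For r ≤ 0 every displacement is zero, so all terms evaluate h at p. -/
theorem reflExt_of_nonpos (hc : Summable c) (hp : r p ≤ 0) :
    reflExt r v c ψ h p = ((∑' m, c m) * ψ 0) • h p := by
  simp only [reflExt, reflTerm, max_eq_right hp, mul_zero, zero_smul, sub_zero]
  by_cases h0 : ψ 0 = 0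
  · simp [h0]
  · rw [← tsum_mul_right]
    exact (hc.mul_right (ψ 0)).tsum_smul_const (h p)

theorem reflTerm_eq_zero (hψ : IsCutoff σ ψ) {m : ℕ} (hm : σ / 2 < dil m * r p) :
    reflTerm r v c ψ h m p = 0 := by
  have : dil m * r p ≤ dil m * max (r p) 0 := by
    have := (dil_pos m).le
    gcongr
    exact le_max_left _ _
  rw [reflTerm, hψ.2 _ (hm.trans_le (this.trans (le_abs_self _)))]
  simp

namespace ReflectionBox

theorem refl_mem (B : ReflectionBox D N K r ar v σ) (hp : p ∈ N) {m : ℕ}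
    (hm : dil m * max (r p) 0 ≤ σ) : (p.1 - (dil m * max (r p) 0) • v, p.2) ∈ K := by
  have h4 := four_le_dil m
  have h0 : 0 ≤ max (r p) 0 := le_max_right _ _
  refine B.mem_compact p hp _ (by positivity) hm ?_
  have := le_max_left (r p) 0
  nlinarith

theorem refl_mem_domain (B : ReflectionBox D N K r ar v σ) (hp : p ∈ N) (hr : 0 < r p) {m : ℕ}
    (hm : dil m * r p ≤ σ) : (p.1 - (dil m * r p) • v, p.2) ∈ D := by
  have h4 := four_le_dil m
  refine B.mem_domain p hp _ (by positivity) hm ?_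
  nlinarith

/-- The terms are bounded by a multiple of |c m|, and their Hölder constants grow at most linearly
in `dil m`, so the finite moments of order 0 and 1 give uniform convergence and a common Hölder
constant. -/
theorem holderOn_reflExt (B : ReflectionBox D N K r ar v σ) (hα : 0 ≤ α) (hα1 : α ≤ 1)
    [CompleteSpace F] (hc : SeeleySeq c) (hψ : IsCutoff σ ψ) (hh : HolderOn α (closure D) h) :
    HolderOn α N (reflExt r v c ψ h) := by
  obtain ⟨C, M, hC0, hM0, hM, hC⟩ := hh.exists_bound B.subset B.isCompact
  obtain ⟨Mψ, hMψ⟩ := hψ.hasCompactSupport.exists_bound_of_continuous hψ.1.continuous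
  obtain ⟨Lψ, hLψ⟩ := (hψ.1.of_le (by norm_cast) : ContDiff ℝ 1 ψ).lipschitzWith_of_hasCompactSupport
    hψ.hasCompactSupport (by norm_num)
  obtain ⟨L, hL0, hL⟩ := B.lipschitz
  obtain ⟨R, hR0, hR⟩ := B.bounded
  have hMψ0 : 0 ≤ Mψ := (norm_nonneg _).trans (hMψ 0)
  have hsum0 : Summable fun m => |c m| := by simpa using hc.1 0
  have hsum1 : Summable fun m => |c m| * dil m := by simpa using hc.1 1
  have hb : ∀ m, ∀ p ∈ N, ‖reflTerm r v c ψ h m p‖ ≤ |c m| * (Mψ * M) := by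
    intro m p hp
    by_cases hm : dil m * max (r p) 0 ≤ σ
    · rw [reflTerm, norm_smul, norm_mul, mul_assoc, Real.norm_eq_abs (c m)]
      gcongr
      · exact hMψ _
      · exact hM _ (B.refl_mem hp hm)
    · rw [reflTerm, hψ.2 _ (((half_lt_self B.pos).trans (not_le.1 hm)).trans_le (le_abs_self _))]
      simp only [mul_zero, zero_smul, norm_zero]
      positivity
  have hcr : ∀ m, ContinuousOn (fun p => dil m * max (r p) 0) N := fun m =>
    (continuousOn_const.mul (B.continuousOn.sup continuousOn_const))
  have hterm : ∀ m, ContinuousOn (reflTerm r v c ψ h m) N := by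
    intro m p hp
    by_cases hm : dil m * max (r p) 0 < σ
    · have h1 : ContinuousOn (reflTerm r v c ψ h m) (N ∩ {p | dil m * max (r p) 0 ≤ σ}) := by
        have h0 := (hcr m).mono (inter_subset_left (t := {p | dil m * max (r p) 0 ≤ σ}))
        refine ((continuousOn_const).mul (hψ.1.continuous.comp_continuousOn h0)).smul
          ((hh.1.mono B.subset).comp ((continuousOn_fst.sub (h0.smul continuousOn_const)).prodMk
            continuousOn_snd) fun q hq => B.refl_mem hq.1 hq.2)
      refine (h1 p ⟨hp, hm.le⟩).mono_of_mem_nhdsWithin (inter_mem self_mem_nhdsWithin ?_)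
      filter_upwards [(hcr m p hp).eventually (gt_mem_nhds hm)] with q hq using le_of_lt hq
    · have hm' : σ / 2 < dil m * max (r p) 0 := (half_lt_self B.pos).trans_le (not_lt.1 hm)
      have h0 : ∀ q, σ / 2 < dil m * max (r q) 0 → reflTerm r v c ψ h m q = 0 := fun q hq => by
        rw [reflTerm, hψ.2 _ (hq.trans_le (le_abs_self _))]; simp
      refine (continuousWithinAt_const (b := (0 : F))).congr_of_eventuallyEq ?_ (h0 p hm')
      filter_upwards [(hcr m p hp).eventually (lt_mem_nhds hm')] with q hq using h0 q hq
  refine ⟨continuousOn_tsum hterm (hsum0.mul_right (Mψ * M)) fun m p hp => hb m p hp,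
    fun S hS _ => ?_⟩
  -- The cutoff contributes a Lipschitz bound; on a set of diameter at most R it becomes a Hölder
  -- bound through |x - y| ≤ R^{1-α} |x - y|^α.
  set C₁ := Lψ * L * M * R ^ (1 - α) with hC₁
  have hC₁0 : 0 ≤ C₁ := by positivity
  have hdiff : ∀ m t x y, (x, t) ∈ N → (y, t) ∈ N →
      ‖reflTerm r v c ψ h m (x, t) - reflTerm r v c ψ h m (y, t)‖ ≤
        (|c m| * dil m * C₁ + |c m| * (Mψ * C) + |c m| * dil m * (Mψ * C * (L * ‖v‖))) *
          ‖x - y‖ ^ α := by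
    intro m t x y hx hy
    have hd0 := dil_pos m
    have hα0 : 0 ≤ ‖x - y‖ ^ α := by positivity
    have hxy : ‖x - y‖ ≤ R ^ (1 - α) * ‖x - y‖ ^ α := by
      rcases (norm_nonneg (x - y)).eq_or_lt with h0 | h0
      · rw [← h0]; positivity
      · calc ‖x - y‖ = ‖x - y‖ ^ (1 - α) * ‖x - y‖ ^ α := by
              rw [← Real.rpow_add h0]; simp
          _ ≤ R ^ (1 - α) * ‖x - y‖ ^ α := by
              gcongr
              exact hR t x y hx hy
    have hmax : |max (r (x, t)) 0 - max (r (y, t)) 0| ≤ L * ‖x - y‖ :=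
      (abs_max_sub_max_le_abs _ _ _).trans (hL t x y hx hy)
    set a := dil m * max (r (x, t)) 0 with ha
    set b := dil m * max (r (y, t)) 0 with hbdef
    have hab : |a - b| ≤ dil m * (L * ‖x - y‖) := by
      rw [ha, hbdef, ← mul_sub, abs_mul, abs_of_pos hd0]
      gcongr
    have hψab : |ψ a - ψ b| ≤ Lψ * (dil m * (L * ‖x - y‖)) := by
      have := hLψ.dist_le_mul a b
      rw [Real.dist_eq, Real.dist_eq] at this
      exact this.trans (by gcongr)
    have hψab' : |c m| * |ψ a - ψ b| * M ≤ |c m| * dil m * C₁ * ‖x - y‖ ^ α := by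
      calc _ ≤ |c m| * (Lψ * (dil m * (L * (R ^ (1 - α) * ‖x - y‖ ^ α)))) * M := by
            gcongr
            exact hψab.trans (by gcongr)
        _ = _ := by rw [hC₁]; ring
    have hrest : 0 ≤ (|c m| * (Mψ * C) + |c m| * dil m * (Mψ * C * (L * ‖v‖))) * ‖x - y‖ ^ α := by
      positivity
    have htx : reflTerm r v c ψ h m (x, t) = (c m * ψ a) • h (x - a • v, t) := rfl
    have hty : reflTerm r v c ψ h m (y, t) = (c m * ψ b) • h (y - b • v, t) := rfl
    have hz : ∀ s, ¬ s ≤ σ → ψ s = 0 := fun s hs =>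
      hψ.2 _ (((half_lt_self B.pos).trans (not_le.1 hs)).trans_le (le_abs_self _))
    -- Beyond displacement σ nothing is known about h at the reflected point, but the cutoff
    -- vanishes there already. If just one of the two points is beyond σ, the Lipschitz bound on ψ
    -- alone estimates the difference.
    by_cases hxσ : a ≤ σ
    · have hxK := hM _ (B.refl_mem hx hxσ)
      by_cases hyσ : b ≤ σ
      · have hφ : ‖h (x - a • v, t) - h (y - b • v, t)‖ ≤
            C * ((1 + dil m * (L * ‖v‖)) * ‖x - y‖ ^ α) := by
          refine (hC t _ _ (B.refl_mem hx hxσ) (B.refl_mem hy hyσ)).trans ?_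
          gcongr
          have h1 : ‖(x - a • v) - (y - b • v)‖ ≤ (1 + dil m * (L * ‖v‖)) * ‖x - y‖ := by
            have : (x - a • v) - (y - b • v) = (x - y) - (a - b) • v := by rw [sub_smul]; abel
            rw [this]
            refine (norm_sub_le _ _).trans ?_
            rw [norm_smul, Real.norm_eq_abs]
            have : |a - b| * ‖v‖ ≤ dil m * (L * ‖x - y‖) * ‖v‖ := by gcongr
            linarith
          have h2 : 1 ≤ 1 + dil m * (L * ‖v‖) := by
            have : 0 ≤ dil m * (L * ‖v‖) := by positivity
            linarith
          calc ‖(x - a • v) - (y - b • v)‖ ^ α ≤ ((1 + dil m * (L * ‖v‖)) * ‖x - y‖) ^ α := by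
                gcongr
            _ = (1 + dil m * (L * ‖v‖)) ^ α * ‖x - y‖ ^ α := by
                rw [Real.mul_rpow (by linarith) (norm_nonneg _)]
            _ ≤ _ := by
                gcongr
                exact (Real.rpow_le_rpow_of_exponent_le h2 hα1).trans (by simp)
        have e : (c m * ψ a) • h (x - a • v, t) - (c m * ψ b) • h (y - b • v, t) =
            (c m * (ψ a - ψ b)) • h (x - a • v, t) +
            (c m * ψ b) • (h (x - a • v, t) - h (y - b • v, t)) := by
          rw [smul_sub, mul_sub, sub_smul]; abel
        rw [htx, hty, e]
        refine (norm_add_le _ _).trans ?_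
        rw [norm_smul, norm_smul, norm_mul, norm_mul, Real.norm_eq_abs, Real.norm_eq_abs]
        have h1 : |c m| * |ψ a - ψ b| * ‖h (x - a • v, t)‖ ≤ |c m| * |ψ a - ψ b| * M := by gcongr
        have h2 : |c m| * ‖ψ b‖ * ‖h (x - a • v, t) - h (y - b • v, t)‖ ≤
            |c m| * Mψ * (C * ((1 + dil m * (L * ‖v‖)) * ‖x - y‖ ^ α)) := by
          gcongr
          exact hMψ _
        linarith
      · rw [htx, hty, hz b hyσ]
        rw [hz b hyσ, sub_zero] at hψab'
        simp only [mul_zero, zero_smul, sub_zero]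
        rw [norm_smul, norm_mul, Real.norm_eq_abs, Real.norm_eq_abs]
        have h1 : |c m| * |ψ a| * ‖h (x - a • v, t)‖ ≤ |c m| * |ψ a| * M := by gcongr
        linarith
    · rw [htx, hty, hz a hxσ]
      rw [hz a hxσ, zero_sub, abs_neg] at hψab'
      simp only [mul_zero, zero_smul, zero_sub, norm_neg]
      by_cases hyσ : b ≤ σ
      · have hyK := hM _ (B.refl_mem hy hyσ)
        rw [norm_smul, norm_mul, Real.norm_eq_abs, Real.norm_eq_abs]
        have h1 : |c m| * |ψ b| * ‖h (y - b • v, t)‖ ≤ |c m| * |ψ b| * M := by gcongr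
        linarith
      · rw [hz b hyσ]
        simp only [mul_zero, zero_smul, norm_zero]
        positivity
  have hsC : Summable fun m =>
      (|c m| * dil m * C₁ + |c m| * (Mψ * C) + |c m| * dil m * (Mψ * C * (L * ‖v‖))) :=
    ((hsum1.mul_right _).add (hsum0.mul_right _)).add (hsum1.mul_right _)
  refine ⟨∑' m, (|c m| * dil m * C₁ + |c m| * (Mψ * C) + |c m| * dil m * (Mψ * C * (L * ‖v‖))),
    fun t x y hx hy => ?_⟩
  have hsx : ∀ p ∈ N, Summable fun m => ‖reflTerm r v c ψ h m p‖ := fun p hp =>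
    Summable.of_nonneg_of_le (fun _ => norm_nonneg _) (fun m => hb m p hp) (hsum0.mul_right (Mψ * M))
  rw [reflExt, reflExt, ← (hsx _ (hS hx)).of_norm.tsum_sub (hsx _ (hS hy)).of_norm, ← tsum_mul_right]
  exact tsum_of_norm_bounded (hsC.mul_right _).hasSum fun m => hdiff m t x y (hS hx) (hS hy)

end ReflectionBox

end Reflection

/-! ### Derivatives of the extension by reflections -/

section Derivatives

open scoped ContDiff

variable {F : Type*} [NormedAddCommGroup F] [NormedSpace ℝ F]
  {α : ℝ} {D N K Ω : Set (ℂ × ℝ)} {r : ℂ × ℝ → ℝ} {ar : ℂ × ℝ → ℂ →L[ℝ] ℝ} {v : ℂ} {σ : ℝ}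
  {c : ℕ → ℝ} {ψ : ℝ → ℝ} {h : ℂ × ℝ → F} {n j : ℕ} {p : ℂ × ℝ}

/-- The chain rule in `t` from continuous partial derivatives. -/
theorem hasDerivWithinAt_comp_curve (hΩ : IsOpenIn strip Ω) {A : ℂ × ℝ → ℂ →L[ℝ] F} {h' : F}
    (hA : ContinuousOn A Ω) (hhA : ∀ p ∈ Ω, HasFDerivAt (fun x => h (x, p.2)) (A p) p.1)
    {γ : ℝ → ℂ} {γ' : ℂ} {t : ℝ} (hγ : HasDerivWithinAt γ γ' (Icc 0 1) t) (hp : (γ t, t) ∈ Ω)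
    (hh' : HasDerivWithinAt (fun s => h (γ t, s)) h' (Icc 0 1) t) :
    HasDerivWithinAt (fun s => h (γ s, s)) (A (γ t, t) γ' + h') (Icc 0 1) t := by
  have htI := hΩ.mem_Icc hp
  have h1 : HasDerivWithinAt (fun s => A (γ t, t) (γ s)) (A (γ t, t) γ') (Icc 0 1) t :=
    (A (γ t, t)).hasFDerivAt.comp_hasDerivWithinAt t hγ
  have h2 : HasDerivWithinAt (fun s => h (γ s, s) - h (γ t, s) - A (γ t, t) (γ s - γ t)) 0
      (Icc 0 1) t := by
    obtain ⟨L, hL⟩ := hγ.differentiableWithinAt.isBigO_sub.bound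
    rw [hasDerivWithinAt_iff_isLittleO, Asymptotics.isLittleO_iff]
    intro ε hε
    set ε' := ε / (|L| + 1) with hε'
    have hε'0 : 0 < ε' := by positivity
    have hAe : ∀ᶠ q in 𝓝[Ω] (γ t, t), ‖A q - A (γ t, t)‖ < ε' := by
      have := ((hA _ hp).sub_const (A (γ t, t))).norm
      exact this.eventually (gt_mem_nhds (by simpa using hε'0))
    obtain ⟨ρ, hρ, hbox⟩ := exists_box hΩ hp hAe
    have e1 : ∀ᶠ s in 𝓝[Icc 0 1] t, ‖γ s - γ t‖ < ρ :=
      ((hγ.continuousWithinAt.sub_const (γ t)).norm).eventually (gt_mem_nhds (by simpa using hρ))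
    have e2 : ∀ᶠ s in 𝓝[Icc 0 1] t, |s - t| < ρ := by
      have : Continuous fun s : ℝ => |s - t| := by fun_prop
      exact mem_nhdsWithin_of_mem_nhds (this.continuousAt.eventually (gt_mem_nhds (by simpa using hρ)))
    filter_upwards [hL, e1, e2, self_mem_nhdsWithin] with s hsL hs1 hs2 hsI
    have hball : ∀ y ∈ Metric.ball (γ t) ρ, (y, s) ∈ Ω ∧ ‖A (y, s) - A (γ t, t)‖ < ε' := fun y hy =>
      hbox y s (by rwa [← dist_eq_norm]) hs2 hsI
    have := (convex_ball (γ t) ρ).norm_image_sub_le_of_norm_hasFDerivWithin_le'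
      (f := fun y => h (y, s)) (f' := fun y => A (y, s)) (φ := A (γ t, t)) (C := ε')
      (fun y hy => (hhA _ (hball y hy).1).hasFDerivWithinAt) (fun y hy => (hball y hy).2.le)
      (Metric.mem_ball_self hρ) (show γ s ∈ Metric.ball (γ t) ρ by rwa [Metric.mem_ball, dist_eq_norm])
    simp only [sub_self, map_zero, smul_zero, sub_zero]
    calc _ ≤ ε' * ‖γ s - γ t‖ := this
      _ ≤ ε' * (L * ‖s - t‖) := by gcongr
      _ ≤ ε' * ((|L| + 1) * ‖s - t‖) := by
        gcongr
        linarith [le_abs_self L]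
      _ = ε * ‖s - t‖ := by rw [← mul_assoc, hε', div_mul_cancel₀ _ (by positivity)]
  have h3 := (h2.fun_add (h1.sub_const (A (γ t, t) (γ t)))).fun_add hh'
  rw [zero_add] at h3
  refine h3.congr_of_eventuallyEq (Eventually.of_forall fun s => ?_) ?_
  · simp only [map_sub]; abel
  · simp

theorem dil_tendsto : Tendsto dil atTop atTop :=
  (tendsto_pow_atTop_atTop_of_one_lt (by norm_num : (1 : ℝ) < 2)).const_mul_atTop (by norm_num)

/-- Near a point with `r > 0` the extension is a finite sum. -/
theorem exists_finite_sum (r : ℂ × ℝ → ℝ) (v : ℂ) (σ : ℝ) {η : ℝ} (hη : 0 < η) : ∃ M : ℕ,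
    ∀ (c : ℕ → ℝ) (ψ : ℝ → ℝ) (_ : IsCutoff σ ψ) (h : ℂ × ℝ → F) (q : ℂ × ℝ), η ≤ r q →
      reflExt r v c ψ h q = ∑ m ∈ Finset.range M, reflTerm r v c ψ h m q := by
  obtain ⟨M, hM⟩ := (dil_tendsto.eventually_gt_atTop (σ / 2 / η)).exists_forall_of_atTop
  refine ⟨M, fun c ψ hψ h q hq => tsum_eq_sum fun m hm => ?_⟩
  have h1 := hM m (by simpa using hm)
  rw [div_lt_iff₀ hη] at h1
  exact reflTerm_eq_zero hψ (h1.trans_le (by have := (dil_pos m).le; gcongr))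

namespace ReflectionBox

/-- The derivative of the extension in a direction in which `r` has the derivative `ρ` and `h` has
the derivative `h'`. -/
noncomputable def _root_.CousinParam.reflDeriv (r : ℂ × ℝ → ℝ) (v : ℂ) (c : ℕ → ℝ) (ψ : ℝ → ℝ)
    (h : ℂ × ℝ → F) (ρ : ℂ × ℝ → ℝ) (h' hv : ℂ × ℝ → F) (p : ℂ × ℝ) : F :=
  ρ p • reflExt r v (fun m => c m * dil m) (deriv ψ) h p + reflExt r v c ψ h' p -
    ρ p • reflExt r v (fun m => c m * dil m) ψ hv p

theorem reflDeriv_of_nonpos (hc : SeeleySeq c) {ρ : ℂ × ℝ → ℝ} {h' hv : ℂ × ℝ → F}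
    (hp : r p ≤ 0) : reflDeriv r v c ψ h ρ h' hv p = ((∑' m, c m) * ψ 0) • h' p := by
  rw [reflDeriv, reflExt_of_nonpos hc.mul_dil.summable hp, reflExt_of_nonpos hc.summable hp,
    reflExt_of_nonpos hc.mul_dil.summable hp, hc.tsum_mul_dil]
  simp

theorem eventually_x (B : ReflectionBox D N K r ar v σ) (hp : p ∈ N) :
    Tendsto (fun x => r (x, p.2)) (𝓝 p.1) (𝓝 (r p)) :=
  (B.hasFDerivAt p hp).continuousAt

/-- Product and chain rule give three contributions: from the cutoff, from h itself, and from the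
displacement, which moves in direction -v at rate `dil m` times the derivative of r. If the
displacement exceeds σ, the term vanishes near p because ψ is zero already beyond σ/2. -/
theorem hasFDerivAt_reflTerm (B : ReflectionBox D N K r ar v σ)
    (hψ : IsCutoff σ ψ) {A : ℂ × ℝ → ℂ →L[ℝ] F}
    (hhA : ∀ p ∈ D, HasFDerivAt (fun x => h (x, p.2)) (A p) p.1) (hp : p ∈ N) (hr : 0 < r p)
    (m : ℕ) : ∃ T : ℂ →L[ℝ] F, HasFDerivAt (fun x => reflTerm r v c ψ h m (x, p.2)) T p.1 ∧
      ∀ e, T e = ar p e • reflTerm r v (fun m => c m * dil m) (deriv ψ) h m p +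
        reflTerm r v c ψ (fun q => A q e) m p -
        ar p e • reflTerm r v (fun m => c m * dil m) ψ (fun q => A q v) m p := by
  have hmax : max (r p) 0 = r p := max_eq_left hr.le
  have hrx := B.hasFDerivAt p hp
  by_cases hm : dil m * r p ≤ σ
  · have hφ := B.refl_mem_domain hp hr hm
    have h1 : HasFDerivAt (fun x => dil m * r (x, p.2)) (dil m • ar p) p.1 := hrx.const_mul _
    have h2 : HasFDerivAt (fun x => c m * ψ (dil m * r (x, p.2)))
        (c m • (deriv ψ (dil m * r p) • (dil m • ar p))) p.1 :=
      ((hψ.hasDerivAt _).comp_hasFDerivAt p.1 h1).const_mul (c m)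
    have h3 : HasFDerivAt (fun x => x - (dil m * r (x, p.2)) • v)
        (ContinuousLinearMap.id ℝ ℂ - (dil m • ar p).smulRight v) p.1 :=
      (hasFDerivAt_id _).fun_sub (h1.smul_const v)
    have h4 : HasFDerivAt (fun x => h (x - (dil m * r (x, p.2)) • v, p.2))
        ((A (p.1 - (dil m * r p) • v, p.2)).comp
          (ContinuousLinearMap.id ℝ ℂ - (dil m • ar p).smulRight v)) p.1 :=
      HasFDerivAt.comp (g := fun x => h (x, p.2)) p.1 (hhA _ hφ) h3
    refine ⟨_, (h2.fun_smul h4).congr_of_eventuallyEq ?_, fun e => ?_⟩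
    · filter_upwards [(B.eventually_x hp).eventually (lt_mem_nhds hr)] with x hx
      rw [reflTerm, max_eq_left (le_of_lt hx)]
    · simp only [reflTerm, hmax]
      simp only [add_apply, smul_apply, ContinuousLinearMap.comp_apply,
        ContinuousLinearMap.smulRight_apply, sub_apply, ContinuousLinearMap.id_apply, map_sub,
        map_smul, smul_eq_mul, smul_sub, smul_smul]
      module
  · have hm' : σ / 2 < dil m * r p := (half_lt_self B.pos).trans (not_le.1 hm)
    refine ⟨0, (hasFDerivAt_const (0 : F) p.1).congr_of_eventuallyEq ?_, fun e => ?_⟩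
    · have : Tendsto (fun x => dil m * r (x, p.2)) (𝓝 p.1) (𝓝 (dil m * r p)) :=
        (B.eventually_x hp).const_mul _
      filter_upwards [this.eventually (lt_mem_nhds hm')] with x hx using reflTerm_eq_zero hψ hx
    · rw [reflTerm_eq_zero hψ.deriv hm', reflTerm_eq_zero hψ hm', reflTerm_eq_zero hψ hm']
      simp

/-- For r < 0 the extension is locally a constant multiple of h; for r > 0 it is locally a finite
sum, which is differentiated termwise. -/
theorem hasFDerivAt_reflExt (B : ReflectionBox D N K r ar v σ)
    (hc : SeeleySeq c) (hψ : IsCutoff σ ψ) {A : ℂ × ℝ → ℂ →L[ℝ] F}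
    (hhA : ∀ p ∈ D, HasFDerivAt (fun x => h (x, p.2)) (A p) p.1) (hp : p ∈ N) (hr : r p ≠ 0) :
    HasFDerivAt (fun x => reflExt r v c ψ h (x, p.2))
      (lin (reflDeriv r v c ψ h (fun q => ar q 1) (fun q => A q 1) (fun q => A q v) p)
        (reflDeriv r v c ψ h (fun q => ar q Complex.I) (fun q => A q Complex.I) (fun q => A q v) p))
      p.1 := by
  rcases lt_or_gt_of_ne hr with hr | hr
  · have hpD : p ∈ D := by
      have := B.mem_domain p hp 0 le_rfl B.pos.le (by simpa using hr)
      simpa using this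
    rw [reflDeriv_of_nonpos hc hr.le, reflDeriv_of_nonpos hc hr.le]
    have h1 := (hhA p hpD).const_smul ((∑' m, c m) * ψ 0)
    have e : lin (((∑' m, c m) * ψ 0) • A p 1) (((∑' m, c m) * ψ 0) • A p Complex.I) =
        ((∑' m, c m) * ψ 0) • A p := by
      conv_rhs => rw [eq_lin (((∑' m, c m) * ψ 0) • A p)]
      rfl
    rw [e]
    refine h1.congr_of_eventuallyEq ?_
    filter_upwards [(B.eventually_x hp).eventually (gt_mem_nhds hr)] with x hx
    exact reflExt_of_nonpos hc.summable (le_of_lt hx)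
  · obtain ⟨M, hM⟩ := exists_finite_sum (F := F) r v σ (half_pos hr)
    choose T hT hT' using hasFDerivAt_reflTerm (c := c) B hψ hhA hp hr
    have h1 := HasFDerivAt.fun_sum (u := Finset.range M) fun m _ => hT m
    have e : ∑ m ∈ Finset.range M, T m = lin
        (reflDeriv r v c ψ h (fun q => ar q 1) (fun q => A q 1) (fun q => A q v) p)
        (reflDeriv r v c ψ h (fun q => ar q Complex.I) (fun q => A q Complex.I)
          (fun q => A q v) p) := by
      have key : ∀ e, (∑ m ∈ Finset.range M, T m) e =
          reflDeriv r v c ψ h (fun q => ar q e) (fun q => A q e) (fun q => A q v) p := by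
        intro e
        have h2 : r p / 2 ≤ r p := by linarith
        rw [reflDeriv, hM _ _ hψ.deriv _ p h2, hM _ _ hψ _ p h2, hM _ _ hψ _ p h2,
          sum_apply, Finset.smul_sum, Finset.smul_sum,
          ← Finset.sum_add_distrib, ← Finset.sum_sub_distrib]
        exact Finset.sum_congr rfl fun m _ => hT' m e
      rw [eq_lin (∑ m ∈ Finset.range M, T m), key, key]
    rw [← e]
    refine h1.congr_of_eventuallyEq ?_
    filter_upwards [(B.eventually_x hp).eventually (lt_mem_nhds (half_lt_self hr))] with x hx
    exact hM _ _ hψ _ _ (le_of_lt hx)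

/-- As t varies the reflected point moves in x as well, so h is differentiated along a curve by
`hasDerivWithinAt_comp_curve`. -/
theorem hasDerivWithinAt_reflTerm (B : ReflectionBox D N K r ar v σ) (hD : IsOpenIn strip D)
    (hψ : IsCutoff σ ψ) {A : ℂ × ℝ → ℂ →L[ℝ] F} (hA : ContinuousOn A D)
    (hhA : ∀ p ∈ D, HasFDerivAt (fun x => h (x, p.2)) (A p) p.1) {h' : ℂ × ℝ → F}
    (hh' : ∀ p ∈ D, HasDerivWithinAt (fun s => h (p.1, s)) (h' p) (Icc 0 1) p.2)
    (hp : p ∈ N) (hr : 0 < r p) {r' : ℝ}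
    (hr' : HasDerivWithinAt (fun s => r (p.1, s)) r' (Icc 0 1) p.2) (m : ℕ) :
    HasDerivWithinAt (fun s => reflTerm r v c ψ h m (p.1, s))
      (r' • reflTerm r v (fun m => c m * dil m) (deriv ψ) h m p + reflTerm r v c ψ h' m p -
        r' • reflTerm r v (fun m => c m * dil m) ψ (fun q => A q v) m p) (Icc 0 1) p.2 := by
  have hmax : max (r p) 0 = r p := max_eq_left hr.le
  have hpI := B.isOpenIn.mem_Icc hp
  have hcont : Tendsto (fun s => r (p.1, s)) (𝓝[Icc 0 1] p.2) (𝓝 (r p)) := hr'.continuousWithinAt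
  by_cases hm : dil m * r p ≤ σ
  · have hφ := B.refl_mem_domain hp hr hm
    have h1 : HasDerivWithinAt (fun s => dil m * r (p.1, s)) (dil m * r') (Icc 0 1) p.2 :=
      hr'.const_mul _
    have h2 : HasDerivWithinAt (fun s => c m * ψ (dil m * r (p.1, s)))
        (c m * (deriv ψ (dil m * r p) * (dil m * r'))) (Icc 0 1) p.2 :=
      ((hψ.hasDerivAt _).comp_hasDerivWithinAt p.2 h1).const_mul (c m)
    have h3 : HasDerivWithinAt (fun s => p.1 - (dil m * r (p.1, s)) • v)
        (-((dil m * r') • v)) (Icc 0 1) p.2 := (h1.smul_const v).const_sub p.1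
    have h4 := hasDerivWithinAt_comp_curve hD hA hhA h3 hφ (hh' _ hφ)
    refine ((h2.fun_smul h4).congr_of_eventuallyEq ?_ ?_).congr_deriv ?_
    · filter_upwards [hcont.eventually (lt_mem_nhds hr)] with x hx
      rw [reflTerm, max_eq_left (le_of_lt hx)]
    · rw [reflTerm, max_eq_left (le_of_lt hr)]
    · simp only [reflTerm, hmax, map_neg, map_smul]
      module
  · have hm' : σ / 2 < dil m * r p := (half_lt_self B.pos).trans (not_le.1 hm)
    have : Tendsto (fun s => dil m * r (p.1, s)) (𝓝[Icc 0 1] p.2) (𝓝 (dil m * r p)) :=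
      hcont.const_mul _
    refine ((hasDerivWithinAt_const p.2 _ (0 : F)).congr_of_eventuallyEq ?_ ?_).congr_deriv ?_
    · filter_upwards [this.eventually (lt_mem_nhds hm')] with x hx using reflTerm_eq_zero hψ hx
    · exact reflTerm_eq_zero hψ hm'
    · rw [reflTerm_eq_zero hψ.deriv hm', reflTerm_eq_zero hψ hm', reflTerm_eq_zero hψ hm']
      simp

theorem hasDerivWithinAt_reflExt (B : ReflectionBox D N K r ar v σ) (hD : IsOpenIn strip D)
    (hc : SeeleySeq c) (hψ : IsCutoff σ ψ) {A : ℂ × ℝ → ℂ →L[ℝ] F} (hA : ContinuousOn A D)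
    (hhA : ∀ p ∈ D, HasFDerivAt (fun x => h (x, p.2)) (A p) p.1) {h' : ℂ × ℝ → F}
    (hh' : ∀ p ∈ D, HasDerivWithinAt (fun s => h (p.1, s)) (h' p) (Icc 0 1) p.2)
    (hp : p ∈ N) (hr : r p ≠ 0) {r' : ℂ × ℝ → ℝ}
    (hr' : HasDerivWithinAt (fun s => r (p.1, s)) (r' p) (Icc 0 1) p.2) :
    HasDerivWithinAt (fun s => reflExt r v c ψ h (p.1, s))
      (reflDeriv r v c ψ h r' h' (fun q => A q v) p) (Icc 0 1) p.2 := by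
  have hcont : Tendsto (fun s => r (p.1, s)) (𝓝[Icc 0 1] p.2) (𝓝 (r p)) := hr'.continuousWithinAt
  rcases lt_or_gt_of_ne hr with hr | hr
  · have hpD : p ∈ D := by
      have := B.mem_domain p hp 0 le_rfl B.pos.le (by simpa using hr)
      simpa using this
    rw [reflDeriv_of_nonpos hc hr.le]
    refine ((hh' p hpD).const_smul ((∑' m, c m) * ψ 0)).congr_of_eventuallyEq ?_
      (reflExt_of_nonpos hc.summable hr.le)
    filter_upwards [hcont.eventually (gt_mem_nhds hr)] with x hx
    exact reflExt_of_nonpos hc.summable (le_of_lt hx)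
  · obtain ⟨M, hM⟩ := exists_finite_sum (F := F) r v σ (half_pos hr)
    have h1 := HasDerivWithinAt.fun_sum (u := Finset.range M) fun m _ =>
      hasDerivWithinAt_reflTerm (c := c) B hD hψ hA hhA hh' hp hr hr' m
    have h2 : r p / 2 ≤ r p := by linarith
    refine (h1.congr_of_eventuallyEq ?_ (hM _ _ hψ _ _ h2)).congr_deriv ?_
    · filter_upwards [hcont.eventually (lt_mem_nhds (half_lt_self hr))] with x hx
      exact hM _ _ hψ _ _ (le_of_lt hx)
    · rw [reflDeriv, hM _ _ hψ.deriv _ p h2, hM _ _ hψ _ p h2, hM _ _ hψ _ p h2,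
        Finset.smul_sum, Finset.smul_sum, ← Finset.sum_add_distrib, ← Finset.sum_sub_distrib]

/-- Induction on n, for all sequences, cutoffs and functions h at once: `reflDeriv` expresses a
derivative through extensions of h and its derivatives with `c m * dil m` for c or ψ' for ψ.
Derivatives are claimed only where r ≠ 0, but their continuity and Hölder bounds hold on all of N.
-/
theorem classOn_reflExt_off [CompleteSpace F] (B : ReflectionBox D N K r ar v σ) (hα : 0 ≤ α)
    (hα1 : α ≤ 1) (hD : IsOpenIn strip D) (hr : ClassOn α N N n j r) (hc : SeeleySeq c)
    (hψ : IsCutoff σ ψ) (hh : ClassOn α D (closure D) n j h) :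
    ClassOn α (N \ {p | r p = 0}) N n j (reflExt r v c ψ h) := by
  induction n generalizing c ψ h j with
  | zero => exact B.holderOn_reflExt hα hα1 hc hψ hh
  | succ n ih =>
    have hh1 := hh.of_succ_left
    obtain ⟨h0, ⟨A, hA, hhA⟩, ht⟩ := hh
    obtain ⟨-, ⟨ar', har', har''⟩, hrt⟩ := id hr
    have hr1 := hr.of_succ_left
    have har : ∀ p ∈ N, ar' p = ar p := fun p hp => (har'' p hp).unique (B.hasFDerivAt p hp)
    have hsub : N \ {p | r p = 0} ⊆ N := sdiff_subset
    have hopen : IsOpenIn strip (N \ {p | r p = 0}) := by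
      obtain ⟨O, hO, hNO⟩ := B.isOpenIn
      obtain ⟨u, hu, hu'⟩ := (continuousOn_iff'.1 B.continuousOn) {0}ᶜ isOpen_compl_singleton
      refine ⟨u ∩ O, hu.inter hO, ?_⟩
      rw [inter_assoc, ← hNO, ← hu']
      ext q
      simp only [Set.mem_sdiff, mem_ofPred_eq, mem_inter_iff, mem_preimage, mem_compl_iff,
        mem_singleton_iff]
      tauto
    have hare : ∀ e, ClassOn α (N \ {p | r p = 0}) N n j (fun q => ar q e) := fun e =>
      ((har' e).mono hsub le_rfl).congr hopen hsub fun q hq => by simp [har q hq]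
    refine ⟨B.holderOn_reflExt hα hα1 hc hψ h0, ⟨fun p => _, fun e => ?_, fun p hp =>
      B.hasFDerivAt_reflExt hc hψ hhA hp.1 hp.2⟩, fun j' hj => ?_⟩
    · have hX : ∀ e, ClassOn α (N \ {p | r p = 0}) N n j
          (reflDeriv r v c ψ h (fun q => ar q e) (fun q => A q e) (fun q => A q v)) := fun e =>
        (((hare e).smul (ih hr1 hc.mul_dil hψ.deriv hh1)).add (ih hr1 hc hψ (hA e))).sub
          ((hare e).smul (ih hr1 hc.mul_dil hψ (hA v)))
      exact (hX 1).lin_apply (hX Complex.I) e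
    · obtain ⟨h', hh', hhd⟩ := ht j' hj
      obtain ⟨r', hr', hrd⟩ := hrt j' hj
      subst hj
      have hAc : ContinuousOn A D :=
        (continuousOn_clm_apply.2 fun e => (hA e).holderOn.1).mono subset_closure
      refine ⟨_, ?_, fun p hp => B.hasDerivWithinAt_reflExt hD hc hψ hAc hhA hhd hp.1 hp.2
        (hrd p hp.1)⟩
      have hr'' := hr'.mono hsub le_rfl
      exact ((hr''.smul (ih hr1.of_succ_right hc.mul_dil hψ.deriv hh1.of_succ_right)).add
        (ih hr1.of_succ_right hc hψ hh')).sub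
          (hr''.smul (ih hr1.of_succ_right hc.mul_dil hψ (hA v).of_succ_right))

theorem classOn_reflExt [CompleteSpace F] (B : ReflectionBox D N K r ar v σ) (hα : 0 ≤ α)
    (hα1 : α ≤ 1) (hD : IsOpenIn strip D) (hr : ClassOn α N N n j r) (hc : SeeleySeq c)
    (hψ : IsCutoff σ ψ) (hh : ClassOn α D (closure D) n j h) :
    ClassOn α N N n j (reflExt r v c ψ h) := by
  refine .of_crossing B.isOpenIn B.hasFDerivAt B.transversal (fun hn hj p hp => ?_)
    (B.classOn_reflExt_off hα hα1 hD hr hc hψ hh)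
  obtain ⟨n, rfl⟩ := Nat.exists_eq_succ_of_ne_zero hn.ne'
  obtain ⟨j, rfl⟩ := Nat.exists_eq_succ_of_ne_zero hj.ne'
  obtain ⟨r', -, hr'⟩ := hr.2.2 j rfl
  exact ⟨_, hr' p hp⟩

end ReflectionBox

end Derivatives

/-! ### Partitions of unity and the global extension -/

section Extension

open scoped ContDiff Manifold

variable {α : ℝ} {D U : Set (ℂ × ℝ)} {r : ℂ × ℝ → ℝ} {p : ℂ × ℝ}

theorem exists_partition {ι : Type*} {K : Set (ℂ × ℝ)} (hK : IsCompact K) {O : ι → Set (ℂ × ℝ)}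
    (hO : ∀ i, IsOpen (O i)) (hKO : K ⊆ ⋃ i, O i) : ∃ (s : Finset ι) (χ : ι → ℂ × ℝ → ℂ),
      (∀ i, ContDiff ℝ ∞ (χ i)) ∧ (∀ i, tsupport (χ i) ⊆ O i) ∧ (∀ p ∈ K, ∑ i ∈ s, χ i p = 1) ∧
      ∃ R : ℝ, ∀ i, ∀ x : ℂ, ∀ t : ℝ, R ≤ ‖x‖ → χ i (x, t) = 0 := by
  classical
  obtain ⟨s, hs⟩ := hK.elim_finite_subcover O hO hKO
  obtain ⟨R, hR⟩ := hK.isBounded.subset_ball 0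
  obtain ⟨f, hf⟩ := SmoothPartitionOfUnity.exists_isSubordinate 𝓘(ℝ, ℂ × ℝ) hK.isClosed
    (fun i : s => O i ∩ Metric.ball 0 R) (fun i => (hO i).inter Metric.isOpen_ball) fun p hp => by
      obtain ⟨i, hi, hpi⟩ := mem_iUnion₂.1 (hs hp)
      exact mem_iUnion.2 ⟨⟨i, hi⟩, hpi, hR hp⟩
  have hts : ∀ i : s, tsupport (fun p => (f i p : ℂ)) ⊆ tsupport (f i) := fun i =>
    closure_mono fun p hp h => hp (by simp [h])
  refine ⟨s, fun i p => if h : i ∈ s then (f ⟨i, h⟩ p : ℂ) else 0, fun i => ?_, fun i => ?_,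
    fun p hp => ?_, R, fun i x t hx => ?_⟩
  · by_cases h : i ∈ s
    · simp only [h, dite_true]
      exact Complex.ofRealCLM.contDiff.comp (f ⟨i, h⟩).contMDiff.contDiff
    · simp only [h, dite_false]
      exact contDiff_const
  · by_cases h : i ∈ s
    · simp only [h, dite_true]
      exact (hts _).trans ((hf ⟨i, h⟩).trans inter_subset_left)
    · simp only [h, dite_false]
      simp [tsupport, Function.support_fun_zero]
  · have h1 := f.sum_eq_one hp
    rw [finsum_eq_sum_of_fintype] at h1
    rw [← Finset.sum_coe_sort]
    simp only [Finset.coe_mem, dite_true, Subtype.coe_eta]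
    rw [← Complex.ofReal_sum, h1, Complex.ofReal_one]
  · by_cases h : i ∈ s
    · simp only [h, dite_true]
      have h1 : (x, t) ∉ tsupport (f ⟨i, h⟩) := fun h2 => by
        have h3 := (hf ⟨i, h⟩ h2).2
        rw [mem_ball_zero_iff] at h3
        exact absurd ((norm_fst_le (x, t)).trans_lt h3) (not_lt.2 hx)
      rw [image_eq_zero_of_notMem_tsupport h1, Complex.ofReal_zero]
    · simp [h]

theorem le_zero_of_mem_closure (hDU : closure D ⊆ U) (hr : ContinuousOn r U)
    (hD : ∀ q ∈ D, r q < 0) (hp : p ∈ closure D) : r p ≤ 0 := by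
  have : (𝓝[D] p).NeBot := mem_closure_iff_nhdsWithin_neBot.1 hp
  refine le_of_tendsto ((hr p (hDU hp)).mono (subset_closure.trans hDU)) ?_
  filter_upwards [self_mem_nhdsWithin] with q hq using (hD q hq).le

/-- Normalize v so that r has derivative 1 in direction v at p; by continuity it stays above 1/2
nearby. Integrating along v shows that moving back by s lowers r by at least s/2, which gives the
membership conditions. -/
theorem exists_reflectionBox (hU : IsOpenIn strip U) (hDU : closure D ⊆ U)
    (hr : ClassOn α U U 1 0 r) (hDr : D = {p | p ∈ U ∧ r p < 0}) (hp : p ∈ closure D)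
    (hgrad : fderiv ℝ (fun x : ℂ => r (x, p.2)) p.1 ≠ 0) :
    ∃ O K ar v σ, IsOpen O ∧ p ∈ O ∧ strip ∩ O ⊆ U ∧ ReflectionBox D (strip ∩ O) K r ar v σ := by
  obtain ⟨h0, ⟨A, hA, hrA⟩, -⟩ := hr
  have hAc : ContinuousOn A U := continuousOn_clm_apply.2 fun e => (hA e).1
  have hpU := hDU hp
  rw [(hrA p hpU).fderiv] at hgrad
  obtain ⟨v, hv⟩ : ∃ v, A p v = 1 := by
    obtain ⟨w, hw⟩ : ∃ w, A p w ≠ 0 := by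
      by_contra! h
      exact hgrad (ContinuousLinearMap.ext h)
    exact ⟨(A p w)⁻¹ • w, by rw [map_smul, smul_eq_mul, inv_mul_cancel₀ hw]⟩
  have hev : ∀ᶠ q in 𝓝[U] p, 1 / 2 < A q v ∧ ‖A q‖ < ‖A p‖ + 1 :=
    (((hA v).1 p hpU).eventually (lt_mem_nhds (by
      show 1 / 2 < A p v
      rw [hv]; norm_num))).and
      (((hAc p hpU).norm).eventually (gt_mem_nhds (by linarith)))
  obtain ⟨ρ, hρ, hbox⟩ := exists_box hU hpU hev
  have hpI := hU.mem_Icc hpU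
  -- A displacement by at most σ moves a point by at most ρ/4, so points within ρ/4 of p.1 stay
  -- within ρ/2.
  set σ := ρ / (4 * (‖v‖ + 1)) with hσ
  have hσ0 : 0 < σ := by positivity
  have hσv : σ * ‖v‖ ≤ ρ / 4 := by
    have h1 : σ * (‖v‖ + 1) = ρ / 4 := by rw [hσ]; field_simp
    linarith
  set B : Set (ℂ × ℝ) := {q | ‖q.1 - p.1‖ < ρ ∧ |q.2 - p.2| < ρ ∧ q.2 ∈ Icc (0 : ℝ) 1} with hB
  have hBU : ∀ q ∈ B, q ∈ U ∧ 1 / 2 < A q v ∧ ‖A q‖ < ‖A p‖ + 1 := fun q hq =>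
    hbox q.1 q.2 hq.1 hq.2.1 hq.2.2
  have hrB : ∀ q ∈ B, HasFDerivAt (fun x => r (x, q.2)) (A q) q.1 := fun q hq => hrA q (hBU q hq).1
  have hvB : ∀ q ∈ B, 1 / 2 ≤ A q v := fun q hq => (hBU q hq).2.1.le
  have hback : ∀ (y : ℂ) (s τ : ℝ), 0 ≤ τ → ‖y - p.1‖ + τ * ‖v‖ < ρ → |s - p.2| < ρ →
      s ∈ Icc (0 : ℝ) 1 → r (y - τ • v, s) + τ / 2 ≤ r (y, s) ∧ (y - τ • v, s) ∈ U := by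
    intro y s τ hτ hy hs hsI
    have hin : ∀ σ' ∈ Icc 0 τ, (y - τ • v + σ' • v, s) ∈ B := by
      intro σ' hσ'
      refine ⟨?_, hs, hsI⟩
      have e : y - τ • v + σ' • v - p.1 = (y - p.1) - (τ - σ') • v := by rw [sub_smul]; abel
      dsimp only
      rw [e]
      refine (norm_sub_le _ _).trans_lt (lt_of_le_of_lt ?_ hy)
      rw [norm_smul, Real.norm_of_nonneg (by linarith [hσ'.2])]
      gcongr
      linarith [hσ'.1]
    have := add_half_le_of_line hrB hvB hτ hin
    refine ⟨by simpa using this, ?_⟩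
    simpa using (hBU _ (hin 0 ⟨le_rfl, hτ⟩)).1
  have hmemD : ∀ q, q ∈ U → r q < 0 → q ∈ D := fun q h1 h2 => by rw [hDr]; exact ⟨h1, h2⟩
  -- A point with r ≤ 0 is the limit of the points y - τv with τ > 0, where r is negative.
  have hcl : ∀ q ∈ B, r q ≤ 0 → q ∈ closure D := by
    rintro ⟨y, s⟩ ⟨hy, hs, hsI⟩ hq
    have ht : Tendsto (fun τ : ℝ => (y - τ • v, s)) (𝓝[>] 0) (𝓝 (y, s)) := by
      have : Continuous fun τ : ℝ => (y - τ • v, s) := by fun_prop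
      have := this.tendsto 0
      simp only [zero_smul, sub_zero] at this
      exact this.mono_left nhdsWithin_le_nhds
    refine mem_closure_of_tendsto ht ?_
    have h1 : ∀ᶠ τ : ℝ in 𝓝 0, ‖y - p.1‖ + τ * ‖v‖ < ρ := by
      have : Continuous fun τ : ℝ => ‖y - p.1‖ + τ * ‖v‖ := by fun_prop
      exact this.continuousAt.eventually (gt_mem_nhds (by simpa using hy))
    filter_upwards [mem_nhdsWithin_of_mem_nhds h1, self_mem_nhdsWithin] with τ hτ hτ0
    have hτ0' : 0 < τ := hτ0
    obtain ⟨h2, h3⟩ := hback y s τ hτ0'.le hτ hs hsI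
    exact hmemD _ h3 (by linarith)
  set O : Set (ℂ × ℝ) := Metric.ball p.1 (ρ / 4) ×ˢ Metric.ball p.2 (ρ / 2) with hO
  have hOo : IsOpen O := Metric.isOpen_ball.prod Metric.isOpen_ball
  have hO1 : ∀ q ∈ strip ∩ O, ‖q.1 - p.1‖ < ρ / 4 ∧ |q.2 - p.2| < ρ / 2 ∧ q.2 ∈ Icc (0 : ℝ) 1 := by
    rintro q ⟨h1, h2, h3⟩
    rw [Metric.mem_ball, dist_eq_norm] at h2
    rw [Metric.mem_ball, Real.dist_eq] at h3
    exact ⟨h2, h3, h1.2⟩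
  have hOB : strip ∩ O ⊆ B := fun q hq => by
    obtain ⟨h1, h2, h3⟩ := hO1 q hq
    exact ⟨by linarith, by linarith, h3⟩
  have hOU : strip ∩ O ⊆ U := fun q hq => (hBU q (hOB hq)).1
  refine ⟨O, closure D ∩ (Metric.closedBall p.1 (ρ / 2) ×ˢ Metric.closedBall p.2 (ρ / 2)), A, v, σ,
    hOo, ⟨Metric.mem_ball_self (by positivity), Metric.mem_ball_self (by positivity)⟩, hOU, ?_⟩
  have hshift : ∀ q ∈ strip ∩ O, ∀ s, 0 ≤ s → s ≤ σ → r (q.1 - s • v, q.2) + s / 2 ≤ r q ∧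
      (q.1 - s • v, q.2) ∈ U ∧ ‖q.1 - s • v - p.1‖ < ρ / 2 := by
    intro q hq s hs hsσ
    obtain ⟨h1, h2, h3⟩ := hO1 q hq
    have h4 : s * ‖v‖ ≤ ρ / 4 := le_trans (by gcongr) hσv
    obtain ⟨h5, h6⟩ := hback q.1 q.2 s hs (by linarith) (by linarith) h3
    refine ⟨h5, h6, ?_⟩
    rw [sub_right_comm]
    refine (norm_sub_le _ _).trans_lt ?_
    rw [norm_smul, Real.norm_of_nonneg hs]
    linarith
  exact
    { isOpenIn := ⟨O, hOo, inter_comm _ _⟩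
      pos := hσ0
      continuousOn := h0.1.mono hOU
      lipschitz := by
        refine ⟨‖A p‖ + 1, by positivity, fun t x y hx hy => ?_⟩
        have hIcc := (hO1 _ hx).2
        have := (convex_ball p.1 (ρ / 4)).norm_image_sub_le_of_norm_hasFDerivWithin_le
          (f := fun y => r (y, t)) (f' := fun y => A (y, t)) (C := ‖A p‖ + 1)
          (fun z hz => (hrB (z, t) (hOB ⟨⟨mem_univ _, hIcc.2⟩, hz, hx.2.2⟩)).hasFDerivWithinAt)
          (fun z hz => (hBU (z, t) (hOB ⟨⟨mem_univ _, hIcc.2⟩, hz, hx.2.2⟩)).2.2.le) hy.2.1 hx.2.1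
        exact this
      bounded := by
        refine ⟨ρ, hρ, fun t x y hx hy => ?_⟩
        have h1 := (hO1 _ hx).1
        have h2 := (hO1 _ hy).1
        have : x - y = (x - p.1) - (y - p.1) := by ring
        rw [this]
        exact (norm_sub_le _ _).trans (by dsimp only at h1 h2; linarith)
      hasFDerivAt := fun q hq => hrB q (hOB hq)
      transversal := fun q hq => hvB q (hOB hq)
      isCompact := ((isCompact_closedBall _ _).prod (isCompact_closedBall _ _)).inter_left
        isClosed_closure
      subset := inter_subset_left
      mem_compact := by
        intro q hq s hs hsσ hqs
        obtain ⟨h1, h2, h3⟩ := hshift q hq s hs hsσ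
        obtain ⟨h4, h5, h6⟩ := hO1 q hq
        refine ⟨hcl _ ⟨by dsimp only; linarith, by dsimp only; linarith, h6⟩ (by linarith), ?_, ?_⟩
        · rw [Metric.mem_closedBall, dist_eq_norm]; exact h3.le
        · rw [Metric.mem_closedBall, Real.dist_eq]; exact h5.le
      mem_domain := by
        intro q hq s hs hsσ hqs
        obtain ⟨h1, h2, h3⟩ := hshift q hq s hs hsσ
        exact hmemD _ h2 (by linarith)
      nonpos := fun q _ hq =>
        le_zero_of_mem_closure hDU h0.1 (fun q hq => by rw [hDr] at hq; exact hq.2) hq }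

/-- The functions in `ClassOn α Ω E n j'` for all natural numbers `n ≤ k` and `j' ≤ j`. -/
def ClassUpTo {F : Type*} [NormedAddCommGroup F] [NormedSpace ℝ F] (α : ℝ) (Ω E : Set (ℂ × ℝ))
    (k j : ℕ∞) (f : ℂ × ℝ → F) : Prop :=
  ∀ n j' : ℕ, (n : ℕ∞) ≤ k → (j' : ℕ∞) ≤ j → ClassOn α Ω E n j' f

/-- A bounded open set `D` of the strip, defined by `r < 0` on `U`, with `∇ₓ r ≠ 0` on its
boundary. -/
structure SmoothFamily (α : ℝ) (k j : ℕ∞) (D U : Set (ℂ × ℝ)) (r : ℂ × ℝ → ℝ) : Prop where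
  bounded : Bornology.IsBounded D
  isOpenIn : IsOpenIn strip D
  isOpenIn' : IsOpenIn strip U
  closure_subset : closure D ⊆ U
  classUpTo : ClassUpTo α U U k j r
  classOn : ClassOn α U U 1 0 r
  eq : D = {p | p ∈ U ∧ r p < 0}
  fderiv_ne : ∀ p ∈ closure D \ D, fderiv ℝ (fun x : ℂ => r (x, p.2)) p.1 ≠ 0

theorem IsSmoothFamily.exists_smoothFamily {k j : ℕ∞} (h : IsSmoothFamily D k j α) :
    ∃ U r, SmoothFamily α k j D U r := by
  obtain ⟨hb, hD, U, r, hU, hDU, hr, hr1, hDr, hgrad⟩ := h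
  have hUU := relInterior_eq_self_of_isOpenIn hU
  have hUc : U ⊆ closure (relInterior U) := by rw [hUU]; exact subset_closure
  refine ⟨U, r, hb, hD, hU, hDU, fun n j' hn hj => ?_, ?_, hDr, hgrad⟩
  · have := hr.classOn hUc hn hj
    rwa [hUU] at this
  · have := hr1.classOn hUc (n := 1) (j' := 0) (by simp) (by simp)
    rwa [hUU] at this

variable {k j : ℕ∞}

theorem SmoothFamily.isCompact_closure (h : SmoothFamily α k j D U r) : IsCompact (closure D) :=
  h.bounded.isCompact_closure

/-- At a point of D nothing needs extending; at a boundary point reflection with Σ c_m = 1 and ψ 0 =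
1 reproduces g on the closure of D. -/
theorem SmoothFamily.exists_local_extension (h : SmoothFamily α k j D U r) (hα : 0 ≤ α)
    (hα1 : α ≤ 1) {g : ℂ × ℝ → ℂ} (hg : ClassUpTo α D (closure D) k j g) (hp : p ∈ closure D) :
    ∃ O, IsOpen O ∧ p ∈ O ∧ ∃ g', ClassUpTo α (strip ∩ O) (strip ∩ O) k j g' ∧
      ∀ q ∈ closure D ∩ O, g' q = g q := by
  by_cases hpD : p ∈ D
  · obtain ⟨O, hO, hDO⟩ := h.isOpenIn
    have hDO' : strip ∩ O = D := by rw [hDO, inter_comm]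
    refine ⟨O, hO, by rw [hDO] at hpD; exact hpD.1, g, fun n j' hn hj => ?_, fun q _ => rfl⟩
    rw [hDO']
    exact (hg n j' hn hj).mono le_rfl subset_closure
  · obtain ⟨O, K, ar, v, σ, hO, hpO, hOU, B⟩ := exists_reflectionBox h.isOpenIn' h.closure_subset
      h.classOn h.eq hp (h.fderiv_ne p ⟨hp, hpD⟩)
    obtain ⟨c, hc, hc1⟩ := exists_seeleySeq
    obtain ⟨ψ, hψ, hψ0⟩ := exists_isCutoff B.pos
    refine ⟨O, hO, hpO, reflExt r v c ψ g, fun n j' hn hj => ?_, fun q hq => ?_⟩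
    · exact B.classOn_reflExt hα hα1 h.isOpenIn ((h.classUpTo n j' hn hj).mono hOU hOU) hc hψ
        (hg n j' hn hj)
    · have hqs : q ∈ strip := h.isOpenIn'.subset (h.closure_subset hq.1)
      rw [reflExt_of_nonpos hc.summable (B.nonpos q ⟨hqs, hq.2⟩ hq.1), hc1, hψ0]
      simp

theorem isOpenIn_strip : IsOpenIn strip strip := ⟨univ, isOpen_univ, (univ_inter _).symm⟩

/-- The extension theorem. -/
theorem SmoothFamily.exists_extension (h : SmoothFamily α k j D U r) (hα : 0 ≤ α)
    (hα1 : α ≤ 1) {g : ℂ × ℝ → ℂ} (hg : ClassUpTo α D (closure D) k j g) :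
    ∃ g' : ℂ × ℝ → ℂ, ClassUpTo α strip strip k j g' ∧ EqOn g' g (closure D) ∧
      ∃ R : ℝ, ∀ x t, R ≤ ‖x‖ → g' (x, t) = 0 := by
  choose! O hO hpO g' hg' hgg' using fun p hp => h.exists_local_extension hα hα1 hg (p := p) hp
  obtain ⟨s, χ, hχ, hχO, hχ1, R, hR⟩ := exists_partition h.isCompact_closure
    (O := fun p : closure D => O p) (fun p => hO p p.2) fun p hp =>
      mem_iUnion.2 ⟨⟨p, hp⟩, hpO p hp⟩
  refine ⟨fun q => ∑ i ∈ s, χ i q * g' i q, fun n j' hn hj => ?_, fun q hq => ?_, R,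
    fun x t hx => ?_⟩
  · refine ClassOn.sum s fun i _ => ?_
    exact (ClassOn.of_contDiff hα1 hα (hχ i)).smul_of_tsupport_subset hα isOpenIn_strip le_rfl
      subset_closure (hO i i.2) (hχO i) (hg' i i.2 n j' hn hj)
  · rw [← one_mul (g q), ← hχ1 q hq, Finset.sum_mul]
    refine Finset.sum_congr rfl fun i _ => ?_
    by_cases hqi : q ∈ O i
    · rw [hgg' i i.2 q ⟨hq, hqi⟩]
    · rw [image_eq_zero_of_notMem_tsupport fun h => hqi (hχO i h), zero_mul, zero_mul]
  · simp [hR _ x t hx]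

end Extension

/-! ### Regularity of the convolution with 1/x -/

section CauchyTransform

open MeasureTheory

variable {F : Type*} [NormedAddCommGroup F] [NormedSpace ℝ F] {α : ℝ} {n j : ℕ}

/-- The convolution of `g` in the variable `x` with `1 / x`. -/
noncomputable def cauchyConv (g : ℂ × ℝ → ℂ) (p : ℂ × ℝ) : ℂ :=
  ∫ w : ℂ, w⁻¹ * g (p.1 - w, p.2)

/-- The function `1 / |w|`, cut off outside a disc. -/
noncomputable def cutKernel (T : ℝ) : ℂ → ℝ := (Metric.closedBall (0 : ℂ) T).indicator fun w => ‖w‖⁻¹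

theorem integrable_cutKernel (T : ℝ) : Integrable (cutKernel T) := by
  have h : LocallyIntegrable (fun w : ℂ => ‖w‖⁻¹) := by
    refine locallyIntegrable_of_norm_le_rpow (C := 1) (α := 1) (by simp [Complex.finrank_real_complex])
      (by simp [Complex.finrank_real_complex]) (Eventually.of_forall fun w => ?_)
      measurable_norm.inv.aestronglyMeasurable
    rw [Real.rpow_neg_one]; simp
  exact (h.integrableOn_isCompact (isCompact_closedBall _ _)).integrable_indicator
    Metric.isClosed_closedBall.measurableSet

theorem norm_inv_smul_le {φ : F} {w : ℂ} {M T : ℝ} [NormedSpace ℂ F] (hM : ‖φ‖ ≤ M)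
    (h0 : T < ‖w‖ → φ = 0) : ‖w⁻¹ • φ‖ ≤ M * cutKernel T w := by
  by_cases h : w ∈ Metric.closedBall (0 : ℂ) T
  · rw [cutKernel, indicator_of_mem h, norm_smul, norm_inv, mul_comm]
    gcongr
  · rw [cutKernel, indicator_of_notMem h, h0 (by simpa using h)]
    simp

/-- The hypothesis that `g` vanishes for `R ≤ |x|`. -/
def VanishesBeyond (R : ℝ) (g : ℂ × ℝ → F) : Prop :=
  ∀ x : ℂ, ∀ t ∈ Icc (0 : ℝ) 1, R ≤ ‖x‖ → g (x, t) = 0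

theorem VanishesBeyond.exists_bound {R : ℝ} {g : ℂ × ℝ → F} (hR : VanishesBeyond R g)
    (hg : ContinuousOn g strip) : ∃ M : ℝ, 0 ≤ M ∧ ∀ x : ℂ, ∀ t ∈ Icc (0 : ℝ) 1, ‖g (x, t)‖ ≤ M := by
  obtain ⟨M, hM⟩ := ((isCompact_closedBall (0 : ℂ) R).prod (isCompact_Icc (a := (0 : ℝ)) (b := 1))
    ).exists_bound_of_continuousOn (hg.mono fun p hp => ⟨mem_univ _, hp.2⟩)
  refine ⟨max M 0, le_max_right _ _, fun x t ht => ?_⟩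
  by_cases h : R ≤ ‖x‖
  · rw [hR x t ht h]; simp
  · exact (hM (x, t) ⟨by simpa using (not_le.1 h).le, ht⟩).trans (le_max_left _ _)

theorem continuous_slice {g : ℂ × ℝ → F} (hg : ContinuousOn g strip) {t : ℝ}
    (ht : t ∈ Icc (0 : ℝ) 1) : Continuous fun x : ℂ => g (x, t) :=
  hg.comp_continuous (by fun_prop) fun _ => ⟨mem_univ _, ht⟩

theorem aestronglyMeasurable_kernel [NormedSpace ℂ F] {g : ℂ × ℝ → F} (hg : ContinuousOn g strip)
    {t : ℝ} (ht : t ∈ Icc (0 : ℝ) 1) (z : ℂ) :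
    AEStronglyMeasurable fun w : ℂ => w⁻¹ • g (z - w, t) :=
  (measurable_inv.aestronglyMeasurable (μ := volume)).smul
    ((continuous_slice hg ht).comp (by fun_prop : Continuous fun w : ℂ => z - w)).aestronglyMeasurable

theorem VanishesBeyond.kernel_bound [NormedSpace ℂ F] {R : ℝ} {g : ℂ × ℝ → F}
    (hR : VanishesBeyond R g) {M S : ℝ} (hM : ∀ x : ℂ, ∀ t ∈ Icc (0 : ℝ) 1, ‖g (x, t)‖ ≤ M) {z : ℂ}
    (hz : ‖z‖ ≤ S) {t : ℝ} (ht : t ∈ Icc (0 : ℝ) 1) (w : ℂ) :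
    ‖w⁻¹ • g (z - w, t)‖ ≤ M * cutKernel (R + S) w := by
  refine norm_inv_smul_le (hM _ _ ht) fun hw => hR _ _ ht ?_
  have := norm_sub_norm_le w z
  rw [norm_sub_rev] at this
  linarith

/-- The kernel stays fixed and g is translated, so continuity and the Hölder estimate for g pass
under the integral, with the integrable cut-off kernel as dominating function. -/
theorem holderOn_cauchyConv {R : ℝ} {g : ℂ × ℝ → ℂ} (hg : HolderOn α strip g)
    (hR : VanishesBeyond R g) : HolderOn α strip (cauchyConv g) := by
  obtain ⟨M, hM0, hM⟩ := hR.exists_bound hg.1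
  have hint : ∀ p ∈ strip, Integrable fun w : ℂ => w⁻¹ * g (p.1 - w, p.2) := fun p hp =>
    Integrable.mono' ((integrable_cutKernel (R + ‖p.1‖)).const_mul M)
      (aestronglyMeasurable_kernel hg.1 hp.2 p.1)
      (Eventually.of_forall fun w => hR.kernel_bound hM le_rfl hp.2 w)
  refine ⟨fun p hp => ?_, fun K hK hKc => ?_⟩
  · refine continuousWithinAt_of_dominated (bound := fun w => M * cutKernel (R + (‖p.1‖ + 1)) w)
      ?_ ?_ ((integrable_cutKernel _).const_mul M) (Eventually.of_forall fun w => ?_)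
    · filter_upwards [self_mem_nhdsWithin] with q hq
      exact aestronglyMeasurable_kernel hg.1 hq.2 q.1
    · have h1 : ∀ᶠ q : ℂ × ℝ in 𝓝[strip] p, ‖q.1‖ < ‖p.1‖ + 1 :=
        mem_nhdsWithin_of_mem_nhds ((by fun_prop : Continuous fun q : ℂ × ℝ => ‖q.1‖
          ).continuousAt.eventually (gt_mem_nhds (by linarith)))
      filter_upwards [self_mem_nhdsWithin, h1] with q hq hq1
      exact Eventually.of_forall fun w => hR.kernel_bound hM hq1.le hq.2 w
    · refine continuousWithinAt_const.mul ?_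
      exact (hg.1 (p.1 - w, p.2) ⟨mem_univ _, hp.2⟩).comp
        (f := fun q : ℂ × ℝ => (q.1 - w, q.2)) (by fun_prop) fun q hq => ⟨mem_univ _, hq.2⟩
  · obtain ⟨S, hS⟩ := hKc.isBounded.exists_norm_le
    obtain ⟨C, M', hC0, -, -, hC⟩ := hg.exists_bound
      (K := Metric.closedBall (0 : ℂ) (S + (R + S)) ×ˢ Icc (0 : ℝ) 1)
      (fun p hp => ⟨mem_univ _, hp.2⟩) ((isCompact_closedBall _ _).prod isCompact_Icc)
    refine ⟨C * ∫ w, cutKernel (R + S) w, fun t x y hx hy => ?_⟩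
    have ht := (hK hx).2
    have hxS : ‖x‖ ≤ S := (norm_fst_le (x, t)).trans (hS _ hx)
    have hyS : ‖y‖ ≤ S := (norm_fst_le (y, t)).trans (hS _ hy)
    rw [cauchyConv, cauchyConv, ← integral_sub (hint _ (hK hx)) (hint _ (hK hy)), mul_right_comm,
      ← integral_const_mul]
    refine norm_integral_le_of_norm_le ((integrable_cutKernel _).const_mul _)
      (Eventually.of_forall fun w => ?_)
    rw [← mul_sub]
    -- For larger w both translated arguments lie where g vanishes.
    by_cases hw : ‖w‖ ≤ R + S
    · refine norm_inv_smul_le ?_ fun h => absurd h (not_lt.2 hw)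
      have := hC t (x - w) (y - w) ⟨by
        simpa using (norm_sub_le x w).trans (add_le_add hxS hw), ht⟩ ⟨by
        simpa using (norm_sub_le y w).trans (add_le_add hyS hw), ht⟩
      simpa using this
    · have h1 := hR.kernel_bound hM hxS ht w
      have h2 := hR.kernel_bound hM hyS ht w
      have h0 : cutKernel (R + S) w = 0 := indicator_of_notMem (by simpa using hw) _
      rw [h0, mul_zero] at h1 h2 ⊢
      rw [mul_sub]
      refine (norm_sub_le _ _).trans ?_
      dsimp only [smul_eq_mul] at h1 h2
      linarith

theorem hasFDerivAt_cauchyConv {R : ℝ} {g : ℂ × ℝ → ℂ} (hg : ContinuousOn g strip)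
    (hR : VanishesBeyond R g) {A : ℂ × ℝ → ℂ →L[ℝ] ℂ} (hA : ContinuousOn A strip)
    (hRA : VanishesBeyond R A) (hgA : ∀ p ∈ strip, HasFDerivAt (fun x => g (x, p.2)) (A p) p.1)
    {p : ℂ × ℝ} (hp : p ∈ strip) : HasFDerivAt (fun x => cauchyConv g (x, p.2))
      (∫ w : ℂ, w⁻¹ • A (p.1 - w, p.2)) p.1 ∧
      ∀ e, (∫ w : ℂ, w⁻¹ • A (p.1 - w, p.2)) e = cauchyConv (fun q => A q e) p := by
  obtain ⟨M, hM0, hM⟩ := hR.exists_bound hg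
  obtain ⟨M', hM0', hM'⟩ := hRA.exists_bound hA
  have hint : Integrable fun w : ℂ => w⁻¹ • A (p.1 - w, p.2) :=
    Integrable.mono' ((integrable_cutKernel (R + ‖p.1‖)).const_mul M')
      (aestronglyMeasurable_kernel hA hp.2 p.1)
      (Eventually.of_forall fun w => hRA.kernel_bound hM' le_rfl hp.2 w)
  refine ⟨?_, fun e => ?_⟩
  · refine hasFDerivAt_integral_of_dominated_of_fderiv_le (𝕜 := ℝ) (Metric.ball_mem_nhds p.1 one_pos)
      (F := fun x w => w⁻¹ * g (x - w, p.2)) (F' := fun x w => w⁻¹ • A (x - w, p.2))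
      (bound := fun w => M' * cutKernel (R + (‖p.1‖ + 1)) w)
      (Eventually.of_forall fun x => aestronglyMeasurable_kernel hg hp.2 x) ?_
      hint.aestronglyMeasurable ?_ ((integrable_cutKernel _).const_mul _) ?_
    · exact Integrable.mono' ((integrable_cutKernel (R + ‖p.1‖)).const_mul M)
        (aestronglyMeasurable_kernel hg hp.2 p.1)
        (Eventually.of_forall fun w => hR.kernel_bound hM le_rfl hp.2 w)
    · refine Eventually.of_forall fun w x hx => hRA.kernel_bound hM' ?_ hp.2 w
      rw [Metric.mem_ball, dist_eq_norm] at hx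
      have := norm_sub_norm_le x p.1
      linarith
    · refine Eventually.of_forall fun w x _ => ?_
      have h1 : HasFDerivAt (fun y : ℂ => y - w) (ContinuousLinearMap.id ℝ ℂ) x :=
        (hasFDerivAt_id x).sub_const w
      have h2 := HasFDerivAt.comp (g := fun x => g (x, p.2)) x
        (hgA (x - w, p.2) ⟨mem_univ _, hp.2⟩) h1
      exact h2.const_mul w⁻¹
  · rw [ContinuousLinearMap.integral_apply hint]
    rfl

/-- The mean value inequality bounds the difference quotients in t by the supremum of |g'|, so
dominated convergence applies, also for the one-sided derivatives at 0 and 1. -/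
theorem hasDerivWithinAt_cauchyConv {R : ℝ} {g g' : ℂ × ℝ → ℂ} (hg : ContinuousOn g strip)
    (hR : VanishesBeyond R g) (hg' : ContinuousOn g' strip)
    (hR' : VanishesBeyond R g')
    (hgg' : ∀ p ∈ strip, HasDerivWithinAt (fun s => g (p.1, s)) (g' p) (Icc 0 1) p.2)
    {p : ℂ × ℝ} (hp : p ∈ strip) :
    HasDerivWithinAt (fun s => cauchyConv g (p.1, s)) (cauchyConv g' p) (Icc 0 1) p.2 := by
  obtain ⟨M, hM0, hM⟩ := hR.exists_bound hg
  obtain ⟨M', hM0', hM'⟩ := hR'.exists_bound hg'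
  have hint : ∀ t ∈ Icc (0 : ℝ) 1, Integrable fun w : ℂ => w⁻¹ * g (p.1 - w, t) := fun t ht =>
    Integrable.mono' ((integrable_cutKernel (R + ‖p.1‖)).const_mul M)
      (aestronglyMeasurable_kernel hg ht p.1)
      (Eventually.of_forall fun w => hR.kernel_bound hM le_rfl ht w)
  have hd : ∀ w : ℂ, ∀ t ∈ Icc (0 : ℝ) 1, HasDerivWithinAt (fun s => w⁻¹ * g (p.1 - w, s))
      (w⁻¹ * g' (p.1 - w, t)) (Icc 0 1) t := fun w t ht =>
    (hgg' (p.1 - w, t) ⟨mem_univ _, ht⟩).const_mul _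
  rw [hasDerivWithinAt_iff_tendsto_slope]
  have key : Tendsto (fun s => ∫ w : ℂ, slope (fun s => w⁻¹ * g (p.1 - w, s)) p.2 s)
      (𝓝[Icc 0 1 \ {p.2}] p.2) (𝓝 (∫ w : ℂ, w⁻¹ * g' (p.1 - w, p.2))) := by
    refine tendsto_integral_filter_of_dominated_convergence
      (fun w => M' * cutKernel (R + ‖p.1‖) w) ?_ ?_ ((integrable_cutKernel _).const_mul _) ?_
    · filter_upwards [self_mem_nhdsWithin] with s hs
      exact (((hint s hs.1).sub (hint p.2 hp.2)).aestronglyMeasurable).const_smul _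
    · filter_upwards [self_mem_nhdsWithin] with s hs
      refine Eventually.of_forall fun w => ?_
      have := (convex_Icc (0 : ℝ) 1).norm_image_sub_le_of_norm_hasDerivWithin_le (hd w)
        (fun t ht => hR'.kernel_bound hM' le_rfl ht w) hp.2 hs.1
      have hs0 : 0 < ‖s - p.2‖ := norm_pos_iff.2 (sub_ne_zero.2 hs.2)
      rw [slope_def_module, norm_smul, norm_inv, inv_mul_le_iff₀ hs0]
      linarith
    · exact Eventually.of_forall fun w => hasDerivWithinAt_iff_tendsto_slope.1 (hd w p.2 hp.2)
  refine key.congr' ?_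
  filter_upwards [self_mem_nhdsWithin] with s hs
  simp only [slope_def_module, cauchyConv]
  rw [integral_smul, integral_sub (hint s hs.1) (hint p.2 hp.2)]

theorem classOn_cauchyConv {g : ℂ × ℝ → ℂ} (hg : ClassOn α strip strip n j g) {R : ℝ}
    (hR : VanishesBeyond R g) : ClassOn α strip strip n j (cauchyConv g) := by
  induction n generalizing g j R with
  | zero => exact holderOn_cauchyConv hg hR
  | succ n ih =>
    obtain ⟨h0, ⟨A, hA, hgA⟩, ht⟩ := hg
    -- The x-derivative of g vanishes where g is zero on a whole neighbourhood, hence the enlarged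
    -- radius.
    have hR1 : VanishesBeyond (R + 1) g := fun x t ht hx => hR x t ht (by linarith)
    have hAc : ContinuousOn A strip := continuousOn_clm_apply.2 fun e => (hA e).holderOn.1
    have hRA : VanishesBeyond (R + 1) A := by
      intro x t ht hx
      refine (hgA (x, t) ⟨mem_univ _, ht⟩).unique
        ((hasFDerivAt_const (0 : ℂ) x).congr_of_eventuallyEq ?_)
      filter_upwards [continuous_norm.continuousAt.eventually
        (lt_mem_nhds (show R < ‖x‖ by linarith))] with y hy using hR y t ht (le_of_lt hy)
    refine ⟨holderOn_cauchyConv h0 hR, ⟨_, fun e => ?_, fun p hp =>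
      (hasFDerivAt_cauchyConv h0.1 hR1 hAc hRA hgA hp).1⟩, fun j' hj => ?_⟩
    · refine (ih (hA e) (R := R + 1) fun x t ht hx => by rw [hRA x t ht hx]; rfl).congr
        isOpenIn_strip le_rfl fun p hp => (hasFDerivAt_cauchyConv h0.1 hR1 hAc hRA hgA hp).2 e
    · obtain ⟨g', hg', hgg'⟩ := ht j' hj
      have hR' : VanishesBeyond R g' := by
        intro x t ht hx
        refine (uniqueDiffOn_Icc zero_lt_one t ht).eq_deriv _ (hgg' (x, t) ⟨mem_univ _, ht⟩)
          ((hasDerivWithinAt_const t _ (0 : ℂ)).congr (fun s hs => hR x s hs hx) (hR x t ht hx))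
      exact ⟨_, ih hg' hR', fun p hp => hasDerivWithinAt_cauchyConv h0.1 hR hg'.holderOn.1 hR' hgg' hp⟩

end CauchyTransform

/-! ### The Cauchy–Pompeiu formula in polar coordinates -/

section Pompeiu

open MeasureTheory

/-- The Cauchy–Pompeiu formula for a compactly supported function. -/
theorem integral_inv_mul_dbar {φ : ℂ → ℂ} (hφ : ContDiff ℝ 1 φ) {R : ℝ}
    (hR : ∀ x, R ≤ ‖x‖ → φ x = 0) (z : ℂ) :
    ∫ w : ℂ, w⁻¹ * (fderiv ℝ φ (z - w) 1 + Complex.I * fderiv ℝ φ (z - w) Complex.I) =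
      2 * Real.pi * φ z := by
  have hd : ∀ x, HasFDerivAt φ (fderiv ℝ φ x) x := fun x =>
    (hφ.differentiable one_ne_zero).differentiableAt.hasFDerivAt
  have hdc : Continuous (fderiv ℝ φ) := hφ.continuous_fderiv one_ne_zero
  have hd0 : ∀ x, R < ‖x‖ → fderiv ℝ φ x = 0 := by
    intro x hx
    refine (hd x).unique ((hasFDerivAt_const (0 : ℂ) x).congr_of_eventuallyEq ?_)
    filter_upwards [continuous_norm.continuousAt.eventually (lt_mem_nhds hx)] with y hy
      using hR y (le_of_lt hy)
  set e : ℝ → ℂ := fun θ => Real.cos θ + Real.sin θ * Complex.I with he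
  have hec : Continuous e := by fun_prop
  have he1 : ∀ θ, ‖e θ‖ = 1 := fun θ => by
    rw [he]; dsimp only
    rw [Complex.ofReal_cos, Complex.ofReal_sin, ← Complex.exp_mul_I, Complex.norm_exp_ofReal_mul_I]
  have heinv : ∀ θ, (e θ)⁻¹ = Real.cos θ - Real.sin θ * Complex.I := by
    intro θ
    refine inv_eq_of_mul_eq_one_right ?_
    have h : ((Real.cos θ ^ 2 + Real.sin θ ^ 2 : ℝ) : ℂ) = 1 := by
      rw [Real.cos_sq_add_sin_sq, Complex.ofReal_one]
    rw [he]; dsimp only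
    rw [← h, Complex.ofReal_add, Complex.ofReal_pow, Complex.ofReal_pow]
    linear_combination -(Real.sin θ : ℂ) ^ 2 * Complex.I_sq
  set T : ℝ := ‖z‖ + |R| + 1 with hT
  have hT0 : 0 < T := by positivity
  have hfar : ∀ r θ : ℝ, T < r → R < ‖z - r * e θ‖ := by
    intro r θ hr
    have h1 : ‖(r : ℂ) * e θ‖ = r := by
      rw [norm_mul, he1, mul_one, Complex.norm_real, Real.norm_of_nonneg (hT0.trans hr).le]
    have h2 := norm_sub_norm_le ((r : ℂ) * e θ) z
    rw [norm_sub_rev, h1] at h2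
    linarith [le_abs_self R]
  -- The Jacobian cancels the modulus of 1/w, and the integrand becomes G₁ + I G₂: G₁ is the
  -- r-derivative of -φ(z - r e(θ)) and G₂ its θ-derivative divided by r. The first integrates to φ
  -- z along each ray, the second to 0 over each circle.
  set G₁ : ℝ × ℝ → ℂ := fun q => fderiv ℝ φ (z - q.1 * e q.2) (e q.2) with hG₁
  set G₂ : ℝ × ℝ → ℂ := fun q => fderiv ℝ φ (z - q.1 * e q.2) (Complex.I * e q.2) with hG₂
  have hG₁c : Continuous G₁ := by
    refine Continuous.clm_apply (hdc.comp ?_) (hec.comp continuous_snd)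
    exact continuous_const.sub ((Complex.continuous_ofReal.comp continuous_fst).mul
      (hec.comp continuous_snd))
  have hG₂c : Continuous G₂ := by
    refine Continuous.clm_apply (hdc.comp ?_) (continuous_const.mul (hec.comp continuous_snd))
    exact continuous_const.sub ((Complex.continuous_ofReal.comp continuous_fst).mul
      (hec.comp continuous_snd))
  have hG₁0 : ∀ r θ : ℝ, T < r → G₁ (r, θ) = 0 := fun r θ h => by
    rw [hG₁]; dsimp only; rw [hd0 _ (hfar r θ h)]; rfl
  have hG₂0 : ∀ r θ : ℝ, T < r → G₂ (r, θ) = 0 := fun r θ h => by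
    rw [hG₂]; dsimp only; rw [hd0 _ (hfar r θ h)]; rfl
  have hint : ∀ G : ℝ × ℝ → ℂ, Continuous G → (∀ r θ : ℝ, T < r → G (r, θ) = 0) →
      IntegrableOn G (Ioi (0 : ℝ) ×ˢ Ioo (-Real.pi) Real.pi) (volume.prod volume) := by
    intro G hG hG0
    have h1 : IntegrableOn G (Icc (0 : ℝ) T ×ˢ Icc (-Real.pi) Real.pi) (volume.prod volume) :=
      hG.continuousOn.integrableOn_compact (isCompact_Icc.prod isCompact_Icc)
    have h2 : IntegrableOn G (Ioc (0 : ℝ) T ×ˢ Ioo (-Real.pi) Real.pi) (volume.prod volume) :=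
      h1.mono_set (prod_mono Ioc_subset_Icc_self Ioo_subset_Icc_self)
    refine h2.of_forall_sdiff_eq_zero (measurableSet_Ioi.prod measurableSet_Ioo) ?_
    rintro ⟨r, θ⟩ ⟨⟨hr, hθ⟩, hn⟩
    refine hG0 r θ ?_
    by_contra! hle
    exact hn ⟨⟨hr, hle⟩, hθ⟩
  have hI₁ := hint G₁ hG₁c hG₁0
  have hI₂ := hint G₂ hG₂c hG₂0
  -- the radial part
  have hrad : ∀ θ : ℝ, ∫ r in Ioi (0 : ℝ), G₁ (r, θ) = φ z := by
    intro θ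
    have hder : ∀ r : ℝ, HasDerivAt (fun r : ℝ => -φ (z - r * e θ)) (G₁ (r, θ)) r := by
      intro r
      have h1 : HasDerivAt (fun r : ℝ => z - r * e θ) (-(e θ)) r := by
        simpa using ((hasDerivAt_id r).ofReal_comp.mul_const (e θ)).const_sub z
      have h2 := ((hd (z - r * e θ)).comp_hasDerivAt r h1).fun_neg
      refine h2.congr_deriv ?_
      rw [map_neg, neg_neg]
    have hI : IntegrableOn (fun r => G₁ (r, θ)) (Ioi 0) := by
      have hc : Continuous fun r : ℝ => G₁ (r, θ) := hG₁c.comp (by fun_prop)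
      have h2 : IntegrableOn (fun r => G₁ (r, θ)) (Ioc 0 T) :=
        (hc.continuousOn.integrableOn_compact isCompact_Icc).mono_set Ioc_subset_Icc_self
      refine h2.of_forall_sdiff_eq_zero measurableSet_Ioi ?_
      rintro r ⟨hr, hn⟩
      refine hG₁0 r θ ?_
      by_contra! hle
      exact hn ⟨hr, hle⟩
    have h := integral_Ioi_of_hasDerivAt_of_tendsto (a := 0) (m := 0)
      (hder 0).continuousAt.continuousWithinAt (fun r _ => hder r) hI ?_
    · rw [h]; simp
    · refine tendsto_const_nhds.congr' ?_
      filter_upwards [eventually_gt_atTop T] with r hr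
      rw [hR _ (hfar r θ hr).le, neg_zero]
  -- the angular part
  have hang : ∀ r ∈ Ioi (0 : ℝ), ∫ θ in Ioo (-Real.pi) Real.pi, G₂ (r, θ) = 0 := by
    intro r hr
    have hr0 : (r : ℂ) ≠ 0 := by
      have : r ≠ 0 := ne_of_gt hr
      exact_mod_cast this
    have hder : ∀ θ : ℝ, HasDerivAt (fun θ : ℝ => -(r : ℂ)⁻¹ * φ (z - r * e θ)) (G₂ (r, θ)) θ := by
      intro θ
      have h0 : HasDerivAt e (Complex.I * e θ) θ := by
        have h1 := (Real.hasDerivAt_cos θ).ofReal_comp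
        have h2 := ((Real.hasDerivAt_sin θ).ofReal_comp).mul_const Complex.I
        refine (h1.fun_add h2).congr_deriv ?_
        rw [he]; dsimp only
        push_cast
        ring_nf
        rw [Complex.I_sq]; ring
      have h1 : HasDerivAt (fun θ : ℝ => z - r * e θ) (-((r : ℂ) * (Complex.I * e θ))) θ :=
        (h0.const_mul (r : ℂ)).const_sub z
      have h2 := ((hd (z - r * e θ)).comp_hasDerivAt θ h1).const_mul (-(r : ℂ)⁻¹)
      refine h2.congr_deriv ?_
      have h3 : -((r : ℂ) * (Complex.I * e θ)) = (-r) • (Complex.I * e θ) := by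
        rw [Complex.real_smul]; push_cast; ring
      rw [h3, map_smul, hG₂, Complex.real_smul]
      push_cast
      field_simp
    have hc : Continuous fun θ : ℝ => G₂ (r, θ) := hG₂c.comp (by fun_prop)
    rw [← integral_Ioc_eq_integral_Ioo, ← intervalIntegral.integral_of_le (by linarith [Real.pi_pos]),
      intervalIntegral.integral_eq_sub_of_hasDerivAt (fun θ _ => hder θ) (hc.intervalIntegrable _ _)]
    have : e Real.pi = e (-Real.pi) := by simp [he]
    rw [this, sub_self]
  have hpolar := Complex.integral_comp_polarCoord_symm (fun w : ℂ => w⁻¹ *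
    (fderiv ℝ φ (z - w) 1 + Complex.I * fderiv ℝ φ (z - w) Complex.I))
  rw [← hpolar]
  have htarget : polarCoord.target = Ioi (0 : ℝ) ×ˢ Ioo (-Real.pi) Real.pi := rfl
  have hcongr : ∀ q ∈ Ioi (0 : ℝ) ×ˢ Ioo (-Real.pi) Real.pi,
      q.1 • ((Complex.polarCoord.symm q)⁻¹ * (fderiv ℝ φ (z - Complex.polarCoord.symm q) 1 +
        Complex.I * fderiv ℝ φ (z - Complex.polarCoord.symm q) Complex.I)) =
      G₁ q + Complex.I * G₂ q := by
    rintro ⟨r, θ⟩ ⟨hr, -⟩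
    have hr0 : (r : ℂ) ≠ 0 := by
      have : r ≠ 0 := ne_of_gt hr
      exact_mod_cast this
    have hq : Complex.polarCoord.symm (r, θ) = r * e θ := by simp [he]
    rw [hq, Complex.real_smul, mul_inv, hG₁, hG₂]
    dsimp only
    set L := fderiv ℝ φ (z - r * e θ) with hL
    rw [eq_lin L, lin_apply, lin_apply, lin_apply, lin_apply, heinv]
    have e1 : (e θ).re = Real.cos θ := by
      simp only [he, Complex.add_re, Complex.ofReal_re, Complex.mul_re, Complex.I_re, Complex.I_im,
        Complex.ofReal_im]
      ring
    have e2 : (e θ).im = Real.sin θ := by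
      simp only [he, Complex.add_im, Complex.ofReal_re, Complex.mul_im, Complex.I_re, Complex.I_im,
        Complex.ofReal_im]
      ring
    simp only [Complex.mul_re, Complex.mul_im, Complex.I_re, Complex.I_im, e1, e2, Complex.one_re,
      Complex.one_im, Complex.real_smul]
    push_cast
    field_simp
    ring_nf
    rw [Complex.I_sq]
    ring
  rw [htarget, setIntegral_congr_fun (measurableSet_Ioi.prod measurableSet_Ioo) hcongr,
    Measure.volume_eq_prod, integral_add hI₁ (hI₂.const_mul _), integral_const_mul,
    setIntegral_prod _ hI₂, setIntegral_congr_fun measurableSet_Ioi hang]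
  -- For the radial part the order of integration is exchanged, so that r is integrated first; the
  -- remaining angular interval has length 2π.
  rw [← setIntegral_prod_swap, setIntegral_prod (fun q => G₁ q.swap) hI₁.swap]
  simp only [Prod.swap_prod_mk, hrad]
  rw [integral_zero, setIntegral_const, Real.volume_real_Ioo_of_le (by linarith [Real.pi_pos]), sub_neg_eq_add,
    Complex.real_smul]
  push_cast
  ring

end Pompeiu

/-! ### Solving the ∂̄-equation -/

section Dbar

open MeasureTheory

/-- The function `φ` is real differentiable at `z`, with `2 ∂φ/∂z̄ = c`. -/
def HasDbarAt (φ : ℂ → ℂ) (c z : ℂ) : Prop :=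
  ∃ L : ℂ →L[ℝ] ℂ, HasFDerivAt φ L z ∧ L 1 + Complex.I * L Complex.I = c

section HasDbarAt

variable {φ ψ : ℂ → ℂ} {c d z : ℂ}

theorem HasDbarAt.add (hφ : HasDbarAt φ c z) (hψ : HasDbarAt ψ d z) :
    HasDbarAt (fun x => φ x + ψ x) (c + d) z := by
  obtain ⟨L, hL, rfl⟩ := hφ
  obtain ⟨M, hM, rfl⟩ := hψ
  exact ⟨L + M, hL.add hM, by simp only [add_apply]; ring⟩

theorem HasDbarAt.const_mul (hφ : HasDbarAt φ c z) (a : ℂ) :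
    HasDbarAt (fun x => a * φ x) (a * c) z := by
  obtain ⟨L, hL, rfl⟩ := hφ
  exact ⟨a • L, hL.const_mul a, by simp only [smul_apply, smul_eq_mul]; ring⟩

theorem HasDbarAt.sub (hφ : HasDbarAt φ c z) (hψ : HasDbarAt ψ d z) :
    HasDbarAt (fun x => φ x - ψ x) (c - d) z := by
  simpa [sub_eq_add_neg] using hφ.add (hψ.const_mul (-1))

theorem HasDbarAt.congr_of_eventuallyEq (hφ : HasDbarAt φ c z) (h : ψ =ᶠ[𝓝 z] φ) :
    HasDbarAt ψ c z := by
  obtain ⟨L, hL, hc⟩ := hφ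
  exact ⟨L, hL.congr_of_eventuallyEq h, hc⟩

theorem hasDbarAt_const (a z : ℂ) : HasDbarAt (fun _ => a) 0 z :=
  ⟨0, hasFDerivAt_const a z, by simp⟩

theorem HasDbarAt.sum {ι : Type*} (s : Finset ι) {φ : ι → ℂ → ℂ} {c : ι → ℂ}
    (h : ∀ i ∈ s, HasDbarAt (φ i) (c i) z) :
    HasDbarAt (fun x => ∑ i ∈ s, φ i x) (∑ i ∈ s, c i) z := by
  classical
  induction s using Finset.induction_on with
  | empty => simpa using hasDbarAt_const 0 z
  | insert a s ha ih =>
    simp only [Finset.sum_insert ha]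
    exact (h a (Finset.mem_insert_self _ _)).add
      (ih fun i hi => h i (Finset.mem_insert_of_mem hi))

theorem _root_.DifferentiableAt.hasDbarAt (h : DifferentiableAt ℂ φ z) : HasDbarAt φ 0 z := by
  refine ⟨_, h.hasFDerivAt.restrictScalars ℝ, ?_⟩
  have hM : fderiv ℂ φ z Complex.I = Complex.I * fderiv ℂ φ z 1 := by
    rw [← smul_eq_mul, ← map_smul, smul_eq_mul, mul_one]
  rw [ContinuousLinearMap.coe_restrictScalars', hM]
  linear_combination fderiv ℂ φ z 1 * Complex.I_sq

theorem HasDbarAt.mul_differentiableAt (hφ : HasDbarAt φ c z) (hψ : DifferentiableAt ℂ ψ z) :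
    HasDbarAt (fun x => φ x * ψ x) (c * ψ z) z := by
  obtain ⟨L, hL, rfl⟩ := hφ
  obtain ⟨M, hM, hM0⟩ := hψ.hasDbarAt
  refine ⟨_, hL.fun_mul hM, ?_⟩
  simp only [add_apply, smul_apply, smul_eq_mul]
  linear_combination φ z * hM0

theorem HasDbarAt.differentiableAt (h : HasDbarAt φ 0 z) : DifferentiableAt ℂ φ z := by
  obtain ⟨L, hL, hL0⟩ := h
  refine differentiableAt_complex_iff_differentiableAt_real.2 ⟨hL.differentiableAt, ?_⟩
  rw [hL.fderiv, smul_eq_mul]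
  linear_combination -Complex.I * hL0 + L Complex.I * Complex.I_sq

end HasDbarAt

theorem integrable_inv_smul {F : Type*} [NormedAddCommGroup F] [NormedSpace ℝ F] [NormedSpace ℂ F]
    {φ : ℂ → F} (hφ : Continuous φ) {R : ℝ} (hR : ∀ x, R ≤ ‖x‖ → φ x = 0) (z : ℂ) :
    Integrable fun w : ℂ => w⁻¹ • φ (z - w) := by
  have h0 : (0 : ℝ) ∈ Icc (0 : ℝ) 1 := ⟨le_rfl, zero_le_one⟩
  have hg : ContinuousOn (fun q : ℂ × ℝ => φ q.1) strip := (hφ.comp continuous_fst).continuousOn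
  have hgR : VanishesBeyond R fun q : ℂ × ℝ => φ q.1 := fun x _ _ hx => hR x hx
  obtain ⟨M, -, hM⟩ := hgR.exists_bound hg
  exact Integrable.mono' ((integrable_cutKernel (R + ‖z‖)).const_mul M)
    (aestronglyMeasurable_kernel hg h0 z)
    (Eventually.of_forall fun w => hgR.kernel_bound hM le_rfl h0 w)

theorem hasDbarAt_integral_of_contDiff {φ : ℂ → ℂ} (hφ : ContDiff ℝ 1 φ) {R : ℝ}
    (hR : ∀ x, R ≤ ‖x‖ → φ x = 0) (z : ℂ) :
    HasDbarAt (fun z => ∫ w : ℂ, w⁻¹ * φ (z - w)) (2 * Real.pi * φ z) z := by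
  have hp : ((z, 0) : ℂ × ℝ) ∈ strip := ⟨mem_univ _, le_rfl, zero_le_one⟩
  have hdc : Continuous (fderiv ℝ φ) := hφ.continuous_fderiv one_ne_zero
  have hd : ∀ x, HasFDerivAt φ (fderiv ℝ φ x) x := fun x =>
    (hφ.differentiable one_ne_zero).differentiableAt.hasFDerivAt
  have hd0 : ∀ x, R + 1 ≤ ‖x‖ → fderiv ℝ φ x = 0 := by
    intro x hx
    refine (hd x).unique ((hasFDerivAt_const (0 : ℂ) x).congr_of_eventuallyEq ?_)
    filter_upwards [continuous_norm.continuousAt.eventually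
      (lt_mem_nhds (show R < ‖x‖ by linarith))] with y hy using hR y (le_of_lt hy)
  obtain ⟨h1, h2⟩ := hasFDerivAt_cauchyConv (g := fun q => φ q.1) (R := R + 1)
    (A := fun q => fderiv ℝ φ q.1) (hφ.continuous.comp continuous_fst).continuousOn
    (fun x _ _ hx => hR x (by linarith)) (hdc.comp continuous_fst).continuousOn
    (fun x _ _ hx => hd0 x hx) (fun q _ => hd q.1) hp
  refine ⟨_, h1, ?_⟩
  have hi : ∀ e : ℂ, Integrable fun w : ℂ => w⁻¹ * fderiv ℝ φ (z - w) e := fun e =>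
    integrable_inv_smul (φ := fun x => fderiv ℝ φ x e) (hdc.clm_apply continuous_const)
      (fun x hx => by rw [hd0 x hx]; rfl) z
  rw [h2, h2, ← integral_inv_mul_dbar hφ hR z, cauchyConv, cauchyConv, ← integral_const_mul,
    ← integral_add (hi 1) ((hi Complex.I).const_mul _)]
  refine integral_congr_ae (Eventually.of_forall fun w => ?_)
  dsimp only
  ring

/-- After the substitution ζ = z - w the variable z occurs only in the kernel 1/(z - ζ), which is
holomorphic in z and bounded, with its derivative, when z stays away from the support of φ. -/
theorem differentiableAt_integral_of_eq_zero {φ : ℂ → ℂ} (hφ : Continuous φ) {R : ℝ}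
    (hR : ∀ x, R ≤ ‖x‖ → φ x = 0) {z : ℂ} {δ : ℝ} (hδ : 0 < δ)
    (h0 : ∀ x ∈ Metric.ball z δ, φ x = 0) :
    DifferentiableAt ℂ (fun z => ∫ w : ℂ, w⁻¹ * φ (z - w)) z := by
  have hsub : ∀ z : ℂ, ∫ w : ℂ, w⁻¹ * φ (z - w) = ∫ ζ : ℂ, (z - ζ)⁻¹ * φ ζ := fun z => by
    rw [← integral_sub_left_eq_self _ volume z]
    simp
  simp only [hsub]
  have hcs : HasCompactSupport φ := HasCompactSupport.intro (isCompact_closedBall (0 : ℂ) R)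
    fun x hx => hR x (by simpa using (not_le.1 (by simpa using hx)).le)
  have hm : ∀ x : ℂ, AEStronglyMeasurable fun ζ : ℂ => (x - ζ)⁻¹ * φ ζ := fun x =>
    ((measurable_const.sub measurable_id).inv.aestronglyMeasurable).mul hφ.aestronglyMeasurable
  have key := hasDerivAt_integral_of_dominated_loc_of_deriv_le (μ := volume) (𝕜 := ℂ)
    (F := fun x ζ => (x - ζ)⁻¹ * φ ζ) (F' := fun x ζ => -1 / (x - ζ) ^ 2 * φ ζ)
    (bound := fun ζ => 1 / (δ / 2) ^ 2 * ‖φ ζ‖) (x₀ := z) (s := Metric.ball z (δ / 2))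
    (Metric.ball_mem_nhds z (half_pos hδ)) (Eventually.of_forall hm) ?_ ?_ ?_
    ((hφ.integrable_of_hasCompactSupport hcs).norm.const_mul _) ?_
  · exact key.2.differentiableAt
  · have := (integrable_inv_smul hφ hR z).comp_sub_left z
    simpa using this
  · refine AEStronglyMeasurable.mul ?_ hφ.aestronglyMeasurable
    exact (measurable_const.div ((measurable_const.sub measurable_id).pow_const 2)
      ).aestronglyMeasurable
  · refine Eventually.of_forall fun ζ x hx => ?_
    by_cases hζ : φ ζ = 0
    · simp [hζ]
    · have h1 : δ ≤ ‖ζ - z‖ := by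
        by_contra! h
        exact hζ (h0 ζ (by simpa [dist_eq_norm] using h))
      rw [Metric.mem_ball, dist_eq_norm] at hx
      have h2 : δ / 2 ≤ ‖x - ζ‖ := by
        have := norm_sub_le_norm_sub_add_norm_sub ζ x z
        rw [norm_sub_rev ζ x] at this
        linarith
      rw [norm_mul, norm_div, norm_neg, norm_one, norm_pow]
      gcongr
  · refine Eventually.of_forall fun ζ x hx => ?_
    by_cases hζ : φ ζ = 0
    · simpa [hζ] using hasDerivAt_const x (0 : ℂ)
    · have hne : x - ζ ≠ 0 := by
        intro h
        rw [sub_eq_zero] at h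
        exact hζ (h0 ζ (h ▸ Metric.ball_subset_ball (by linarith) hx))
      exact (((hasDerivAt_id x).sub_const ζ).fun_inv hne).mul_const (φ ζ)

/-- The solution of the equation `∂̄u = g` by convolution. -/
theorem hasDbarAt_integral {φ : ℂ → ℂ} (hφ : Continuous φ) {R : ℝ}
    (hR : ∀ x, R ≤ ‖x‖ → φ x = 0) {z : ℂ} (hz : ContDiffAt ℝ 1 φ z) :
    HasDbarAt (fun z => ∫ w : ℂ, w⁻¹ * φ (z - w)) (2 * Real.pi * φ z) z := by
  obtain ⟨ε, hε, hball⟩ := Metric.eventually_nhds_iff_ball.1 (hz.eventually (by simp))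
  -- Split φ = χφ + (1 - χ)φ: the first summand is C¹ everywhere, the second vanishes near z and
  -- contributes a holomorphic function.
  let χ : ContDiffBump z := ⟨ε / 3, ε / 2, by positivity, by linarith⟩
  have hχ : ContDiff ℝ 1 fun x => ((χ x : ℝ) : ℂ) :=
    Complex.ofRealCLM.contDiff.comp χ.contDiff
  have hφ₁ : ContDiff ℝ 1 fun x => ((χ x : ℝ) : ℂ) * φ x := by
    refine contDiff_iff_contDiffAt.2 fun x => ?_
    by_cases hx : x ∈ tsupport fun x => ((χ x : ℝ) : ℂ) * φ x
    swap
    · exact contDiffAt_const.congr_of_eventuallyEq (notMem_tsupport_iff_eventuallyEq.1 hx)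
    refine hχ.contDiffAt.mul (hball x ?_)
    have h1 : tsupport (fun x => ((χ x : ℝ) : ℂ) * φ x) ⊆ tsupport χ := by
      refine closure_mono fun y hy h => hy ?_
      dsimp only
      rw [h]; simp
    have h2 := h1 hx
    rw [χ.tsupport_eq, Metric.mem_closedBall] at h2
    rw [Metric.mem_ball]
    exact h2.trans_lt (by show ε / 2 < ε; linarith)
  have hφ₂ : Continuous fun x => (1 - ((χ x : ℝ) : ℂ)) * φ x :=
    (continuous_const.sub hχ.continuous).mul hφ
  have hR₁ : ∀ x, R ≤ ‖x‖ → ((χ x : ℝ) : ℂ) * φ x = 0 := fun x hx => by rw [hR x hx, mul_zero]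
  have hR₂ : ∀ x, R ≤ ‖x‖ → (1 - ((χ x : ℝ) : ℂ)) * φ x = 0 := fun x hx => by
    rw [hR x hx, mul_zero]
  have hχ1 : ∀ x ∈ Metric.ball z (ε / 3), χ x = 1 := fun x hx =>
    χ.one_of_mem_closedBall (Metric.ball_subset_closedBall hx)
  have hd := differentiableAt_integral_of_eq_zero hφ₂ hR₂ (z := z) (δ := ε / 3) (by positivity)
    fun x hx => by rw [hχ1 x hx]; simp
  have hsum := (hasDbarAt_integral_of_contDiff hφ₁ hR₁ z).add hd.hasDbarAt
  rw [hχ1 z (Metric.mem_ball_self (by positivity)), Complex.ofReal_one, one_mul, add_zero] at hsum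
  refine hsum.congr_of_eventuallyEq (Eventually.of_forall fun x => ?_)
  refine Eq.trans ?_ (integral_add (integrable_inv_smul hφ₁.continuous hR₁ x)
    (integrable_inv_smul hφ₂ hR₂ x))
  refine integral_congr_ae (Eventually.of_forall fun w => ?_)
  dsimp only [smul_eq_mul]
  ring

end Dbar

/-! ### The first Cousin problem -/

section Additive

open scoped ContDiff

variable {α : ℝ} {k j : ℕ∞} {D U O : Set (ℂ × ℝ)} {r : ℂ × ℝ → ℝ} {p : ℂ × ℝ} {t : ℝ}

/-- A boundary point around which the slice of the closure contains a disc would be a local maximum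
of r in x, with value 0, against ∇ₓ r ≠ 0. Hence the interiors of the closed sets are the expected
open ones. -/
theorem SmoothFamily.mem_of_eventually (h : SmoothFamily α k j D U r)
    (hp : ∀ᶠ x in 𝓝 p.1, (x, p.2) ∈ closure D) : p ∈ D := by
  by_contra hpD
  have hpc : p ∈ closure D := hp.self_of_nhds
  have hle : ∀ q ∈ closure D, r q ≤ 0 := fun q hq =>
    le_zero_of_mem_closure h.closure_subset h.classOn.holderOn.1
      (fun q hq => by rw [h.eq] at hq; exact hq.2) hq
  have h0 : r p = 0 := le_antisymm (hle p hpc) <| not_lt.1 fun hlt => hpD <| by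
    rw [h.eq]; exact ⟨h.closure_subset hpc, hlt⟩
  have hmax : IsLocalMax (fun x : ℂ => r (x, p.2)) p.1 := by
    filter_upwards [hp] with x hx
    exact (hle _ hx).trans h0.ge
  exact h.fderiv_ne p ⟨hpc, hpD⟩ hmax.fderiv_eq_zero

theorem SmoothFamily.interior_slice (h : SmoothFamily α k j D U r) (hO : IsOpen O) (t : ℝ) :
    interior (slice (closure D ∩ O) t) = slice (D ∩ O) t := by
  refine Subset.antisymm (fun x hx => ?_) ?_
  · refine ⟨h.mem_of_eventually (p := (x, t)) ?_, (interior_subset hx).2⟩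
    filter_upwards [isOpen_interior.mem_nhds hx] with y hy using (interior_subset hy).1
  · exact interior_maximal (fun x hx => ⟨subset_closure hx.1, hx.2⟩)
      ((h.isOpenIn.inter_isOpen hO).isOpen_slice t)

theorem SmoothFamily.relInterior_eq (h : SmoothFamily α k j D U r) (hO : IsOpen O) :
    relInterior (closure D ∩ O) = D ∩ O := by
  refine Subset.antisymm (fun p hp => ?_) ?_
  · refine ⟨h.mem_of_eventually ?_, (relInterior_subset _ hp).2⟩
    filter_upwards [(isOpenIn_relInterior _).eventually_x hp] with y hy
      using (relInterior_subset _ hy).1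
  · rw [← relInterior_eq_self_of_isOpenIn (h.isOpenIn.inter_isOpen hO)]
    exact fun p hp => ⟨hp.1, mem_of_superset hp.2 fun q hq => ⟨subset_closure hq.1, hq.2⟩⟩

theorem closure_inter_subset (hO : IsOpen O) : closure D ∩ O ⊆ closure (D ∩ O) := by
  rw [inter_comm, inter_comm D]
  exact hO.inter_closure

theorem ClassUpTo.of_local (h : SmoothFamily α k j D U r) (hα : 0 ≤ α) (hO : IsOpen O)
    {f : ℂ × ℝ → ℂ} (hf : ∀ p ∈ closure D ∩ O, ∃ V, IsOpen V ∧ p ∈ V ∧ ∃ g,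
      ClassUpTo α (D ∩ V) (closure D ∩ V) k j g ∧ EqOn f g (closure D ∩ O ∩ V)) :
    ClassUpTo α (D ∩ O) (closure D ∩ O) k j f := by
  intro n j' hn hj
  refine ClassOn.of_local hα (h.isOpenIn.inter_isOpen hO) (inter_subset_inter_left _ subset_closure)
    (closure_inter_subset hO) fun p hp => ?_
  obtain ⟨V, hV, hpV, g, hg, hfg⟩ := hf p hp
  exact ⟨V, hV, hpV, ((hg n j' hn hj).mono (inter_subset_inter_left _ inter_subset_left)
    (inter_subset_inter_left _ inter_subset_left)).congr
    ((h.isOpenIn.inter_isOpen hO).inter_isOpen hV)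
    (inter_subset_inter_left _ (inter_subset_inter_left _ subset_closure)) hfg⟩

/-- The derivative `2 ∂χ/∂z̄`. -/
noncomputable def dbar (χ : ℂ × ℝ → ℂ) (p : ℂ × ℝ) : ℂ :=
  fderiv ℝ χ p (1, 0) + Complex.I * fderiv ℝ χ p (Complex.I, 0)

theorem contDiff_dbar {χ : ℂ × ℝ → ℂ} (hχ : ContDiff ℝ ∞ χ) : ContDiff ℝ ∞ (dbar χ) := by
  have hd : ContDiff ℝ ∞ (fderiv ℝ χ) := hχ.fderiv_right (by norm_cast)
  exact (hd.clm_apply contDiff_const).add (contDiff_const.mul (hd.clm_apply contDiff_const))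

theorem tsupport_dbar_subset (χ : ℂ × ℝ → ℂ) : tsupport (dbar χ) ⊆ tsupport χ := by
  have hsub : Function.support (dbar χ) ⊆ Function.support (fderiv ℝ χ) := fun p hp h0 => hp ?_
  · exact (closure_mono hsub).trans (tsupport_fderiv_subset ℝ)
  simp only [dbar]
  rw [h0]
  simp

theorem hasDbarAt_dbar {χ : ℂ × ℝ → ℂ} (hχ : ContDiff ℝ ∞ χ) (p : ℂ × ℝ) :
    HasDbarAt (fun x => χ (x, p.2)) (dbar χ p) p.1 := by
  have h1 : HasFDerivAt χ (fderiv ℝ χ p) (p.1, p.2) :=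
    (hχ.differentiable (by simp)).differentiableAt.hasFDerivAt
  exact ⟨_, h1.comp p.1 (hasFDerivAt_prodMk_left p.1 p.2), by simp [dbar]⟩

theorem HasDbarAt.unique {φ : ℂ → ℂ} {c d z : ℂ} (h : HasDbarAt φ c z) (h' : HasDbarAt φ d z) :
    c = d := by
  obtain ⟨L, hL, rfl⟩ := h
  obtain ⟨M, hM, rfl⟩ := h'
  rw [hL.unique hM]

/-- The first Cousin problem. -/
theorem SmoothFamily.exists_additive (h : SmoothFamily α k j D U r) (hα : 0 ≤ α) (hα1 : α ≤ 1)
    {A : Type*} {O : A → Set (ℂ × ℝ)} (hO : ∀ a, IsOpen (O a)) (hcover : closure D ⊆ ⋃ a, O a)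
    {f : A → A → ℂ × ℝ → ℂ}
    (hf : ∀ a b, ClassUpTo α (D ∩ O a ∩ O b) (closure D ∩ O a ∩ O b) k j (f a b))
    (hhol : ∀ a b, ∀ p ∈ D ∩ O a ∩ O b, DifferentiableAt ℂ (fun x => f a b (x, p.2)) p.1)
    (hcoc : ∀ a b c, ∀ p ∈ closure D, p ∈ O a → p ∈ O b → p ∈ O c →
      f a b p + f b c p = f a c p) :
    ∃ u : A → ℂ × ℝ → ℂ, (∀ a, ClassUpTo α (D ∩ O a) (closure D ∩ O a) k j (u a)) ∧
      (∀ a, ∀ p ∈ D ∩ O a, DifferentiableAt ℂ (fun x => u a (x, p.2)) p.1) ∧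
      ∀ a b, ∀ p ∈ closure D, p ∈ O a → p ∈ O b → u a p - u b p = f a b p := by
  obtain ⟨s, χ, hχ, hχO, hχ1, -⟩ := exists_partition h.isCompact_closure hO hcover
  rcases isEmpty_or_nonempty A with hA | hA
  · exact ⟨fun _ => 0, isEmptyElim, isEmptyElim, isEmptyElim⟩
  have hex : ∀ p ∈ closure D, ∃ a, p ∈ O a := fun p hp => mem_iUnion.1 (hcover hp)
  choose! a ha using hex
  have hDo : ∀ a, IsOpenIn strip (D ∩ O a) := fun a => h.isOpenIn.inter_isOpen (hO a)
  have hclass : ∀ (χ : A → ℂ × ℝ → ℂ), (∀ i, ContDiff ℝ ∞ (χ i)) → (∀ i, tsupport (χ i) ⊆ O i) →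
      ∀ a, ClassUpTo α (D ∩ O a) (closure D ∩ O a) k j fun p => ∑ i ∈ s, χ i p * f a i p :=
    fun χ hχ hχO a n j' hn hj => ClassOn.sum s fun i _ =>
      (ClassOn.of_contDiff hα1 hα (hχ i)).smul_of_tsupport_subset hα (hDo a)
        (inter_subset_inter_left _ subset_closure) (closure_inter_subset (hO a)) (hO i) (hχO i)
        (hf a i n j' hn hj)
  have hbO : ∀ i, tsupport (dbar (χ i)) ⊆ O i := fun i => (tsupport_dbar_subset _).trans (hχO i)
  -- The χ_i sum to 1 only on the closure of D, so the identity is obtained on D by differentiation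
  -- and then extended by continuity.
  have hb0 : ∀ p ∈ closure D, ∑ i ∈ s, dbar (χ i) p = 0 := by
    have hc : Continuous fun p => ∑ i ∈ s, dbar (χ i) p :=
      continuous_finsetSum _ fun i _ => (contDiff_dbar (hχ i)).continuous
    refine closure_minimal (fun p hp => ?_) (isClosed_singleton.preimage hc)
    refine (HasDbarAt.sum s fun i _ => hasDbarAt_dbar (hχ i) p).unique
      ((hasDbarAt_const 1 p.1).congr_of_eventuallyEq ?_)
    filter_upwards [h.isOpenIn.eventually_x hp] with x hx using hχ1 _ (subset_closure hx)
  have hzero : ∀ {χ : ℂ × ℝ → ℂ} {i p}, tsupport χ ⊆ O i → p ∉ O i → χ p = 0 := fun h hp =>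
    image_eq_zero_of_notMem_tsupport fun h' => hp (h h')
  -- the right-hand side of the `∂̄`-equation
  set g : ℂ × ℝ → ℂ := fun p => ∑ i ∈ s, dbar (χ i) p * f (a p) i p with hg
  -- Changing the index from `a p` to b alters each f by the same summand `f (a p) b`, by the
  -- cocycle relation, and Σ ∂̄χ_i = 0 removes it.
  have hga : ∀ b, ∀ p ∈ closure D ∩ O b, g p = ∑ i ∈ s, dbar (χ i) p * f b i p := by
    intro b p hp
    have h1 : ∑ i ∈ s, dbar (χ i) p * f (a p) b p = 0 := by
      rw [← Finset.sum_mul, hb0 p hp.1, zero_mul]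
    rw [hg, ← sub_eq_zero, ← h1, ← Finset.sum_sub_distrib]
    refine Finset.sum_congr rfl fun i _ => ?_
    by_cases hi : p ∈ O i
    · rw [← hcoc (a p) b i p hp.1 (ha p hp.1) hp.2 hi]; ring
    · rw [hzero (hbO i) hi]; ring
  have hgc : ClassUpTo α D (closure D) k j g := by
    have := ClassUpTo.of_local h hα isOpen_univ (f := g) fun p hp =>
      ⟨O (a p), hO _, ha p hp.1, _, hclass _ (fun i => contDiff_dbar (hχ i)) hbO (a p),
        fun q hq => hga _ q ⟨hq.1.1, hq.2⟩⟩
    simpa using this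
  obtain ⟨g', hg', hgg', R, hR⟩ := h.exists_extension hα hα1 hgc
  -- The operator `dbar` is 2 ∂/∂z̄ and takes the convolution with 1/x to 2π times the function,
  -- whence the factor 1/(2π).
  refine ⟨fun b p => ∑ i ∈ s, χ i p * f b i p - (2 * Real.pi : ℂ)⁻¹ * cauchyConv g' p,
    fun b n j' hn hj => ?_, fun b p hp => ?_, fun b c p hp hb hc => ?_⟩
  · refine (hclass χ hχ hχO b n j' hn hj).sub ((ClassOn.const _).mul ?_)
    exact (classOn_cauchyConv (hg' n j' hn hj) (R := R) fun x t _ hx => hR x t hx).mono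
      (hDo b).subset (inter_subset_left.trans (h.closure_subset.trans h.isOpenIn'.subset))
  · refine HasDbarAt.differentiableAt ?_
    have h1 : HasDbarAt (fun x => ∑ i ∈ s, χ i (x, p.2) * f b i (x, p.2))
        (∑ i ∈ s, dbar (χ i) p * f b i p) p.1 := by
      refine HasDbarAt.sum s fun i _ => ?_
      by_cases hi : p ∈ tsupport (χ i)
      · exact (hasDbarAt_dbar (hχ i) p).mul_differentiableAt (hhol b i p ⟨hp, hχO i hi⟩)
      · rw [image_eq_zero_of_notMem_tsupport fun h => hi (tsupport_dbar_subset _ h), zero_mul]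
        refine (hasDbarAt_const 0 p.1).congr_of_eventuallyEq ?_
        have h2 := (by fun_prop : Continuous fun x : ℂ => (x, p.2)).continuousAt.eventually
          (notMem_tsupport_iff_eventuallyEq.1 hi)
        filter_upwards [h2] with x hx
        rw [hx, Pi.zero_apply, zero_mul]
    -- Inside D smoothness in x comes from the holomorphy of the f, not from k, which may be 0.
    have hcd : ContDiffAt ℝ 1 (fun x => g' (x, p.2)) p.1 := by
      have h2 : ContDiffAt ℝ 1 (fun x => ∑ i ∈ s, dbar (χ i) (x, p.2) * f b i (x, p.2)) p.1 := by
        refine ContDiffAt.sum fun i _ => ?_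
        by_cases hi : p ∈ tsupport (χ i)
        · refine ContDiffAt.mul ?_ ?_
          · exact (((contDiff_dbar (hχ i)).of_le (by norm_cast)).comp
              (contDiff_prodMk_left p.2)).contDiffAt
          · have h3 : AnalyticAt ℂ (fun x => f b i (x, p.2)) p.1 := by
              refine Complex.analyticAt_iff_eventually_differentiableAt.2 ?_
              filter_upwards [((hDo b).inter_isOpen (hO i)).eventually_x ⟨hp, hχO i hi⟩] with x hx
                using hhol b i _ hx
            exact h3.contDiffAt.restrict_scalars ℝ
        · refine (contDiffAt_const (c := 0)).congr_of_eventuallyEq ?_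
          have h2 := (by fun_prop : Continuous fun x : ℂ => (x, p.2)).continuousAt.eventually
            (notMem_tsupport_iff_eventuallyEq.1 fun h => hi (tsupport_dbar_subset _ h))
          filter_upwards [h2] with x hx
          rw [hx, Pi.zero_apply, zero_mul]
      refine h2.congr_of_eventuallyEq ?_
      filter_upwards [(hDo b).eventually_x hp] with x hx
      rw [hgg' (subset_closure hx.1), hga b _ ⟨subset_closure hx.1, hx.2⟩]
    have ht := h.isOpenIn.mem_Icc hp.1
    have h2 := (hasDbarAt_integral (continuous_slice (hg' 0 0 (by simp) (by simp)).holderOn.1 ht)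
      (fun x hx => hR x p.2 hx) hcd).const_mul (2 * Real.pi : ℂ)⁻¹
    have h3 := h1.sub h2
    rw [← hga b p ⟨subset_closure hp.1, hp.2⟩, hgg' (subset_closure hp.1), ← mul_assoc,
      inv_mul_cancel₀ (by simp [Real.pi_ne_zero]), one_mul, sub_self] at h3
    exact h3
  · rw [sub_sub_sub_cancel_right, ← Finset.sum_sub_distrib, ← one_mul (f b c p), ← hχ1 p hp,
      Finset.sum_mul]
    refine Finset.sum_congr rfl fun i _ => ?_
    by_cases hi : p ∈ O i
    · rw [← hcoc b c i p hp hb hc hi]; ring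
    · rw [hzero (hχO i) hi]; ring

end Additive

/-! ### The second Cousin problem -/

section Multiplicative

variable {α : ℝ} {k j : ℕ∞} {D U O E : Set (ℂ × ℝ)} {r : ℂ × ℝ → ℝ} {p : ℂ × ℝ}

/-- Near p a continuous logarithm varies by less than 1, hence by less than π/2 in imaginary part,
so up to a constant it is the principal logarithm of φ / φ p. It thus inherits holomorphy and class
from φ. -/
theorem exists_eq_log_add {l φ : ℂ × ℝ → ℂ} (hl : ContinuousOn l E)
    (hexp : ∀ q ∈ E, Complex.exp (l q) = φ q) (hp : p ∈ E) : ∃ W, IsOpen W ∧ p ∈ W ∧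
      ∀ q ∈ E ∩ W, φ q / φ p ∈ Complex.slitPlane ∧ l q = Complex.log (φ q / φ p) + l p := by
  have hev : ∀ᶠ q in 𝓝[E] p, ‖l q - l p‖ < 1 :=
    ((hl p hp).sub continuousWithinAt_const).norm.eventually (gt_mem_nhds (by simp))
  obtain ⟨W, hW, hpW, hWE⟩ := mem_nhdsWithin.1 hev
  refine ⟨W, hW, hpW, fun q hq => ?_⟩
  have h1 : |(l q - l p).im| < 1 := (Complex.abs_im_le_norm _).trans_lt (hWE ⟨hq.2, hq.1⟩)
  obtain ⟨h2, h3⟩ := abs_lt.1 h1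
  have hpi := Real.pi_gt_three
  rw [← hexp q hq.1, ← hexp p hp, ← Complex.exp_sub]
  refine ⟨Or.inl ?_, ?_⟩
  · rw [Complex.exp_re]
    exact mul_pos (Real.exp_pos _) (Real.cos_pos_of_mem_Ioo ⟨by linarith, by linarith⟩)
  · rw [Complex.log_exp (by linarith) (by linarith), sub_add_cancel]

/-- The second Cousin problem. -/
theorem SmoothFamily.exists_multiplicative (h : SmoothFamily α k j D U r) (hα : 0 ≤ α)
    (hα1 : α ≤ 1) {A : Type*} {O : A → Set (ℂ × ℝ)} (hO : ∀ a, IsOpen (O a))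
    (hcover : closure D ⊆ ⋃ a, O a) {f : A → A → ℂ × ℝ → ℂ}
    (hf : ∀ a b, ClassUpTo α (D ∩ O a ∩ O b) (closure D ∩ O a ∩ O b) k j (f a b))
    (hhol : ∀ a b, ∀ p ∈ D ∩ O a ∩ O b, DifferentiableAt ℂ (fun x => f a b (x, p.2)) p.1)
    {g : A → ℂ × ℝ → ℂ} (hg : ∀ a, ContinuousOn (g a) (closure D ∩ O a))
    (hg0 : ∀ a, ∀ p ∈ closure D ∩ O a, g a p ≠ 0)
    (hgf : ∀ a b, ∀ p ∈ closure D, p ∈ O a → p ∈ O b → g a p * (g b p)⁻¹ = f a b p) :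
    ∃ u : A → ℂ × ℝ → ℂ, (∀ a, ClassUpTo α (D ∩ O a) (closure D ∩ O a) k j (u a)) ∧
      (∀ a, ∀ p ∈ D ∩ O a, DifferentiableAt ℂ (fun x => u a (x, p.2)) p.1) ∧
      (∀ a, ∀ p ∈ closure D ∩ O a, u a p ≠ 0) ∧
      ∀ a b, ∀ p ∈ closure D, p ∈ O a → p ∈ O b → u a p * (u b p)⁻¹ = f a b p := by
  -- continuous logarithms of the `g a` on a finer covering
  have hlog : ∀ p : closure D, ∃ a V, IsOpen V ∧ ↑p ∈ V ∧ V ⊆ O a ∧ ∃ l : ℂ × ℝ → ℂ,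
      ContinuousOn l (closure D ∩ V) ∧ ∀ q ∈ closure D ∩ V, Complex.exp (l q) = g a q := by
    rintro ⟨p, hp⟩
    obtain ⟨a, ha⟩ := mem_iUnion.1 (hcover hp)
    have hp0 := hg0 a p ⟨hp, ha⟩
    have hc : ContinuousOn (fun q => g a q / g a p) (closure D ∩ O a) := (hg a).div_const _
    have hev : ∀ᶠ q in 𝓝[closure D ∩ O a] p, g a q / g a p ∈ Complex.slitPlane :=
      (hc p ⟨hp, ha⟩).eventually (Complex.isOpen_slitPlane.mem_nhds (by
        dsimp only; rw [div_self hp0]; exact Complex.one_mem_slitPlane))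
    obtain ⟨W, hW, hpW, hWs⟩ := mem_nhdsWithin.1 hev
    refine ⟨a, W ∩ O a, hW.inter (hO a), ⟨hpW, ha⟩, inter_subset_right,
      fun q => Complex.log (g a q / g a p) + Complex.log (g a p), ?_, fun q hq => ?_⟩
    · exact ((hc.mono fun q hq => ⟨hq.1, hq.2.2⟩).clog
        fun q hq => hWs ⟨hq.2.1, hq.1, hq.2.2⟩).add continuousOn_const
    · rw [Complex.exp_add, Complex.exp_log (div_ne_zero (hg0 a q ⟨hq.1, hq.2.2⟩) hp0),
        Complex.exp_log hp0, div_mul_cancel₀ _ hp0]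
  choose a V hV hpV hVO l hlc hl using hlog
  have hD : ∀ {q}, q ∈ D → q ∈ closure D := fun hq => subset_closure hq
  have hexp : ∀ p p' : closure D, ∀ q ∈ closure D ∩ V p ∩ V p',
      Complex.exp (l p q - l p' q) = f (a p) (a p') q := fun p p' q hq => by
    rw [Complex.exp_sub, hl p q hq.1, hl p' q ⟨hq.1.1, hq.2⟩, div_eq_mul_inv,
      hgf _ _ q hq.1.1 (hVO p hq.1.2) (hVO p' hq.2)]
  have hlc' : ∀ p p' : closure D,
      ContinuousOn (fun q => l p q - l p' q) (closure D ∩ V p ∩ V p') := fun p p' =>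
    ((hlc p).mono inter_subset_left).sub
      ((hlc p').mono (inter_subset_inter_left _ inter_subset_left))
  have hcl : ∀ p p' : closure D, ClassUpTo α (D ∩ V p ∩ V p') (closure D ∩ V p ∩ V p') k j
      fun q => l p q - l p' q := by
    intro p p'
    rw [inter_assoc, inter_assoc]
    refine ClassUpTo.of_local h hα ((hV p).inter (hV p')) fun q hq => ?_
    rw [← inter_assoc] at hq
    obtain ⟨W, hW, hqW, hWl⟩ := exists_eq_log_add (hlc' p p') (hexp p p') hq
    refine ⟨V p ∩ V p' ∩ W, ((hV p).inter (hV p')).inter hW, ⟨⟨hq.1.2, hq.2⟩, hqW⟩,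
      fun z => Complex.log (f (a p) (a p') z / f (a p) (a p') q) + (l p q - l p' q),
      fun n j' hn hj => ?_, fun z hz => (hWl z ⟨⟨⟨hz.1.1, hz.1.2.1⟩, hz.1.2.2⟩, hz.2.2⟩).2⟩
    have hsub : ∀ S : Set (ℂ × ℝ), S ∩ (V p ∩ V p' ∩ W) ⊆ S ∩ O (a p) ∩ O (a p') := fun S z hz =>
      ⟨⟨hz.1, hVO p hz.2.1.1⟩, hVO p' hz.2.1.2⟩
    have h1 := ((hf (a p) (a p') n j' hn hj).mono (hsub D) (hsub _)).mul
      (ClassOn.const (f (a p) (a p') q)⁻¹)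
    refine (h1.comp_differentiableOn hα (inter_subset_inter_left _ subset_closure)
      Complex.isOpen_slitPlane (Φ := Complex.log)
      (fun z hz => (Complex.differentiableAt_log hz).differentiableWithinAt) fun z hz => ?_).add
      (ClassOn.const _)
    exact (hWl z ⟨⟨⟨hz.1, hz.2.1.1⟩, hz.2.1.2⟩, hz.2.2⟩).1
  have hch : ∀ p p' : closure D, ∀ q ∈ D ∩ V p ∩ V p',
      DifferentiableAt ℂ (fun x => l p (x, q.2) - l p' (x, q.2)) q.1 := by
    intro p p' q hq
    have hq' : q ∈ closure D ∩ V p ∩ V p' := ⟨⟨hD hq.1.1, hq.1.2⟩, hq.2⟩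
    obtain ⟨W, hW, hqW, hWl⟩ := exists_eq_log_add (hlc' p p') (hexp p p') hq'
    have h1 := (hhol (a p) (a p') q ⟨⟨hq.1.1, hVO p hq.1.2⟩, hVO p' hq.2⟩).div_const
      (f (a p) (a p') q)
    refine ((h1.clog (hWl q ⟨hq', hqW⟩).1).add_const (l p q - l p' q)).congr_of_eventuallyEq ?_
    filter_upwards [(((h.isOpenIn.inter_isOpen (hV p)).inter_isOpen (hV p')).inter_isOpen
      hW).eventually_x ⟨hq, hqW⟩] with x hx
    exact (hWl _ ⟨⟨⟨hD hx.1.1.1, hx.1.1.2⟩, hx.1.2⟩, hx.2⟩).2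
  obtain ⟨u, hu, huhol, hul⟩ := h.exists_additive hα hα1 hV
    (fun p hp => mem_iUnion.2 ⟨⟨p, hp⟩, hpV _⟩) (f := fun p p' q => l p q - l p' q) hcl hch
    fun p p' p'' q _ _ _ _ => by ring
  -- From u_p - u_{p'} = l_p - l_{p'} the function u_p - l_p does not depend on p, so its
  -- exponential is globally defined.
  obtain ⟨w, hw⟩ : ∃ w : ℂ × ℝ → ℂ, ∀ p : closure D, ∀ q ∈ closure D ∩ V p,
      w q = Complex.exp (u p q - l p q) := by
    classical
    refine ⟨fun q => if hq : q ∈ closure D then Complex.exp (u ⟨q, hq⟩ q - l ⟨q, hq⟩ q) else 0,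
      fun p q hq => ?_⟩
    dsimp only
    rw [dif_pos hq.1]
    congr 1
    linear_combination hul ⟨q, hq.1⟩ p q hq.1 (hpV _) hq.2
  -- The factors g and w are merely continuous; this identity exhibits the regularity and holomorphy
  -- of their product.
  have hgw : ∀ b, ∀ p : closure D, ∀ q ∈ closure D ∩ O b ∩ V p,
      g b q * w q = f b (a p) q * Complex.exp (u p q) := by
    intro b p q hq
    have hq' : q ∈ closure D ∩ V p := ⟨hq.1.1, hq.2⟩
    rw [hw p q hq', Complex.exp_sub, hl p q hq', ← hgf b (a p) q hq.1.1 hq.1.2 (hVO p hq.2)]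
    ring
  have hw0 : ∀ q ∈ closure D, w q ≠ 0 := fun q hq => by
    rw [hw ⟨q, hq⟩ q ⟨hq, hpV _⟩]
    exact Complex.exp_ne_zero _
  refine ⟨fun b q => g b q * w q, fun b => ?_, fun b q hq => ?_,
    fun b q hq => mul_ne_zero (hg0 b q hq) (hw0 q hq.1), fun b c q hq hb hc => ?_⟩
  · refine ClassUpTo.of_local h hα (hO b) fun q hq => ?_
    let p : closure D := ⟨q, hq.1⟩
    refine ⟨O b ∩ V p, (hO b).inter (hV p), ⟨hq.2, hpV p⟩,
      fun q => f b (a p) q * Complex.exp (u p q), fun n j' hn hj => ?_,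
      fun q hq => hgw b p q ⟨hq.1, hq.2.2⟩⟩
    have hsub : ∀ S : Set (ℂ × ℝ), S ∩ (O b ∩ V p) ⊆ S ∩ O b ∩ O (a p) := fun S q hq =>
      ⟨⟨hq.1, hq.2.1⟩, hVO p hq.2.2⟩
    have hsub' : ∀ S : Set (ℂ × ℝ), S ∩ (O b ∩ V p) ⊆ S ∩ V p := fun S q hq => ⟨hq.1, hq.2.2⟩
    refine ((hf b (a p) n j' hn hj).mono (hsub D) (hsub _)).mul ?_
    exact ((hu p n j' hn hj).mono (hsub' D) (hsub' _)).comp_differentiableOn hα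
      (inter_subset_inter_left _ subset_closure) isOpen_univ
      Complex.differentiable_exp.differentiableOn (mapsTo_univ _ _)
  · let p : closure D := ⟨q, hD hq.1⟩
    refine ((hhol b (a p) q ⟨hq, hVO p (hpV p)⟩).mul
      (huhol p q ⟨hq.1, hpV p⟩).cexp).congr_of_eventuallyEq ?_
    filter_upwards [((h.isOpenIn.inter_isOpen (hO b)).inter_isOpen (hV p)).eventually_x
      ⟨hq, hpV p⟩] with x hx
    exact hgw b p _ ⟨⟨hD hx.1.1, hx.1.2⟩, hx.2⟩
  · have := hw0 q hq
    rw [← hgf b c q hq hb hc, mul_inv]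
    field_simp

end Multiplicative

end CousinParam


/-! ### Assembly: relatively open coverings replaced by open sets -/

theorem mainTheorem11 (α : ℝ) (hα0 : 0 < α) (hα1 : α < 1) (k j : ℕ∞) (hjk : j ≤ k)
    (D : Set (ℂ × ℝ)) (hD : CousinParam.IsSmoothFamily D k j α)
    {A : Type*} (U : A → Set (ℂ × ℝ))
    (hU : ∀ a, CousinParam.IsOpenIn (closure D) (U a)) (hcover : (⋃ a, U a) = closure D)
    (f : A → A → ℂ × ℝ → ℂ)
    (hf : ∀ a b, CousinParam.IsOfClass (U a ∩ U b) k j α (f a b))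
    (hhol : ∀ a b, CousinParam.HolomorphicInside (U a ∩ U b) (f a b)) :
    -- first Cousin problem
    ((∀ a b, ∀ p ∈ U a ∩ U b, f a b p = -f b a p) →
      (∀ a b c, ∀ p ∈ U a ∩ U b ∩ U c, f a b p + f b c p = f a c p) →
      ∃ h : A → ℂ × ℝ → ℂ,
        (∀ a, CousinParam.IsOfClass (U a) k j α (h a)) ∧
        (∀ a, CousinParam.HolomorphicInside (U a) (h a)) ∧
        ∀ a b, ∀ p ∈ U a ∩ U b, h a p - h b p = f a b p) ∧
    -- second Cousin problem
    ((∀ a b, ∀ p ∈ U a ∩ U b, f a b p ≠ 0) →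
      (∀ a b, ∀ p ∈ U a ∩ U b, f a b p = (f b a p)⁻¹) →
      (∀ a b c, ∀ p ∈ U a ∩ U b ∩ U c, f a b p * f b c p = f a c p) →
      (∃ g : A → ℂ × ℝ → ℂ,
        (∀ a, ContinuousOn (g a) (U a)) ∧
        (∀ a, ∀ p ∈ U a, g a p ≠ 0) ∧
        ∀ a b, ∀ p ∈ U a ∩ U b, g a p * (g b p)⁻¹ = f a b p) →
      ∃ h : A → ℂ × ℝ → ℂ,
        (∀ a, CousinParam.IsOfClass (U a) k j α (h a)) ∧
        (∀ a, CousinParam.HolomorphicInside (U a) (h a)) ∧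
        (∀ a, ∀ p ∈ U a, h a p ≠ 0) ∧
        ∀ a b, ∀ p ∈ U a ∩ U b, h a p * (h b p)⁻¹ = f a b p) := by
  open CousinParam in
  obtain ⟨U', r, h⟩ := hD.exists_smoothFamily
  choose O hO hUO using hU
  have hmem : ∀ a p, p ∈ U a ↔ p ∈ closure D ∧ p ∈ O a := fun a p => by
    rw [hUO a]; exact and_comm
  have hUa : ∀ a, U a = closure D ∩ O a := fun a => Set.ext fun p => hmem a p
  have hUab : ∀ a b, U a ∩ U b = closure D ∩ (O a ∩ O b) := fun a b => by
    rw [hUa, hUa, ← inter_inter_distrib_left]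
  have hcover' : closure D ⊆ ⋃ a, O a := by
    rw [← hcover]
    exact iUnion_mono fun a p hp => ((hmem a p).1 hp).2
  have hf' : ∀ a b, ClassUpTo α (D ∩ O a ∩ O b) (closure D ∩ O a ∩ O b) k j (f a b) := by
    intro a b n j' hn hj
    have hV := (hO a).inter (hO b)
    have h1 := hf a b
    rw [hUab] at h1
    have h2 := h1.classOn (by rw [h.relInterior_eq hV]; exact closure_inter_subset hV) hn hj
    rwa [h.relInterior_eq hV, ← inter_assoc, ← inter_assoc] at h2
  have hhol' : ∀ a b, ∀ p ∈ D ∩ O a ∩ O b,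
      DifferentiableAt ℂ (fun x => f a b (x, p.2)) p.1 := by
    intro a b p hp
    have h1 := hhol a b p.2
    rw [hUab] at h1
    refine h1.differentiableAt (isOpen_interior.mem_nhds ?_)
    rw [h.interior_slice ((hO a).inter (hO b))]
    exact ⟨hp.1.1, hp.1.2, hp.2⟩
  have hclass : ∀ a (u : ℂ × ℝ → ℂ), ClassUpTo α (D ∩ O a) (closure D ∩ O a) k j u → IsOfClass (U a) k j α u := by
    intro a u hu
    refine isOfClass_of_classOn fun n j' hn hj => ?_
    rw [hUa, h.relInterior_eq (hO a)]
    exact hu n j' hn hj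
  have hholo : ∀ a (u : ℂ × ℝ → ℂ), (∀ p ∈ D ∩ O a, DifferentiableAt ℂ (fun x => u (x, p.2)) p.1) →
      HolomorphicInside (U a) u := by
    intro a u hu t x hx
    rw [hUa, h.interior_slice (hO a)] at hx
    exact (hu (x, t) hx).differentiableWithinAt
  refine ⟨fun _ hcoc => ?_, fun _ _ _ ⟨g, hg, hg0, hgf⟩ => ?_⟩
  · obtain ⟨u, hu, huhol, huf⟩ := h.exists_additive hα0.le hα1.le hO hcover' hf' hhol'
      fun a b c p hp ha hb hc =>
        hcoc a b c p ⟨⟨(hmem a p).2 ⟨hp, ha⟩, (hmem b p).2 ⟨hp, hb⟩⟩, (hmem c p).2 ⟨hp, hc⟩⟩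
    exact ⟨u, fun a => hclass a _ (hu a), fun a => hholo a _ (huhol a), fun a b p hp =>
      huf a b p ((hmem a p).1 hp.1).1 ((hmem a p).1 hp.1).2 ((hmem b p).1 hp.2).2⟩
  · obtain ⟨u, hu, huhol, hu0, huf⟩ := h.exists_multiplicative hα0.le hα1.le hO hcover' hf' hhol'
      (fun a => by rw [← hUa]; exact hg a) (fun a p hp => hg0 a p ((hmem a p).2 hp))
      fun a b p hp ha hb => hgf a b p ⟨(hmem a p).2 ⟨hp, ha⟩, (hmem b p).2 ⟨hp, hb⟩⟩
    exact ⟨u, fun a => hclass a _ (hu a), fun a => hholo a _ (huhol a),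
      fun a p hp => hu0 a p ((hmem a p).1 hp), fun a b p hp =>
      huf a b p ((hmem a p).1 hp.1).1 ((hmem a p).1 hp.1).2 ((hmem b p).1 hp.2).2⟩
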